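/- Let $K$ be a field with separable closure $K^{\mathrm{sep}}$ and $\mathfrak g_K=\operatorname{Gal}(K^{\mathrm{sep}}/K)$, let $n$ be a positive integer not divisible by the characteristic of $K$, and let $E/K$ be an elliptic curve with origin $O$ such that $E[n]$ is a trivial $\mathfrak g_K$-module. The period-index obstruction map $\Delta: H^1(K,E[n])\to \mathrm{Br}(K)=H^2(K,\mathbb G_m)$ is defined as follows. A class $\xi\in H^1(K,E[n])$, represented by a cocycle $\sigma\mapsto\xi(\sigma)$, corresponds to the pair $(C,[D])$ in which $C$ is the principal homogeneous space of $E$ that is $E$ over $K^{\mathrm{sep}}$ with $\sigma\in\mathfrak g_K$ acting on points by $Q\mapsto \sigma(Q)+\xi(\sigma)$, and $D=n[O]$, whose class in $\mathrm{Pic}(C_{K^{\mathrm{sep}}})$ is $\mathfrak g_K$-invariant. Then $\Delta(\xi)=\delta([D])$, where $\delta:\mathrm{Pic}(C_{K^{\mathrm{sep}}})^{\mathfrak g_K}\to \mathrm{Br}(K)$ sends $[D]$ to the class of the $2$-cocycle $f_\sigma\cdot\sigma(f_\tau)\cdot f_{\sigma\tau}^{-1}$, for functions $f_\sigma\in K^{\mathrm{sep}}(C)^*$,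 locally constant in $\sigma$, with $\operatorname{div} f_\sigma=\sigma(D)-D$. The map $\Delta$ is well defined. Choose an isomorphism $E[n]\cong(\mathbb Z/n\mathbb Z)^2$, that is, a basis $P,Q$ of $E[n]$. The Weil pairing $\zeta=e_n(P,Q)$, normalized by $e_n(P,Q)=\dfrac{f(X)/f(X-Q)}{g(X)/g(X-P)}$ for functions $f,g$ on $E$ over $K^{\mathrm{sep}}$ with $\operatorname{div}f=n[P]-n[O]$ and $\operatorname{div}g=n[Q]-n[O]$, is then a primitive $n$-th root of unity in $K$. For $a\in K^*/K^{*n}$ let $u_a:\mathfrak g_K\to\mathbb Z/n\mathbb Z$ be its Kummer character, $\sigma(\alpha)=\zeta^{u_a(\sigma)}\alpha$ with $\alpha^n=a$. Identify $(a,b)\in (K^*/K^{*n})^2$ with the class in $H^1(K,E[n])$ of $\sigma\mapsto u_a(\sigma)P+u_b(\sigma)Q$, so that $\Delta$ becomes a map $(K^*/K^{*n})^2\to\mathrm{Br}(K)$, and let the norm residue symbol $\langle a,b\rangle_n\in\mathrm{Br}(K)$ be the class of the cup product $(\sigma,\tau)\mapsto\zeta^{u_a(\sigma)u_b(\tau)}$.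 Then there exist $C_1,C_2\in K^*/K^{*n}$ such that, for all $a,b\in K^*/K^{*n}$, $$\Delta(a,b)=\langle C_1a,C_2b\rangle_n-\langle C_1,C_2\rangle_n .$$ -/

import Mathlib

namespace PeriodIndex

open WeierstrassCurve

/-! ### Galois groups, the Brauer group, and Kummer theory -/

/-- The absolute Galois group `Gal(Kˢᵉᵖ/K)`, with the Krull topology. -/
abbrev GalK (K : Type*) [Field K] : Type _ := SeparableClosure K ≃ₐ[K] SeparableClosure K

section Cohomology

variable {G : Type*} [Group G] [TopologicalSpace G]

/-- Continuous (that is, locally constant) inhomogeneous `1`-cocycles of `G` with values in a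
discrete module `A`, on which `σ` acts by `φ σ`. -/
def Z1 {A : Type*} [AddCommGroup A] (φ : G → A →+ A) : AddSubgroup (G → A) where
  carrier := {x | IsLocallyConstant x ∧ ∀ σ τ, x (σ * τ) = x σ + φ σ (x τ)}
  zero_mem' := ⟨IsLocallyConstant.const 0, by simp⟩
  add_mem' := by
    rintro a b ⟨ha, ha'⟩ ⟨hb, hb'⟩
    refine ⟨ha.add hb, fun σ τ => ?_⟩
    simp only [Pi.add_apply, map_add, ha', hb', add_add_add_comm]
  neg_mem' := by
    rintro a ⟨ha, ha'⟩
    refine ⟨ha.neg, fun σ τ => ?_⟩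
    simp only [Pi.neg_apply, map_neg, ha', neg_add]

/-- The `1`-coboundaries, as a subgroup of the group of `1`-cocycles. -/
def B1 {A : Type*} [AddCommGroup A] (φ : G → A →+ A) : AddSubgroup (Z1 φ) where
  carrier := {x | ∃ t : A, ∀ σ, x.1 σ = φ σ t - t}
  zero_mem' := ⟨0, by simp⟩
  add_mem' := by
    rintro a b ⟨s, hs⟩ ⟨t, ht⟩
    refine ⟨s + t, fun σ => ?_⟩
    simp only [AddSubgroup.coe_add, Pi.add_apply, map_add, hs, ht, add_sub_add_comm]
  neg_mem' := by
    rintro a ⟨s, hs⟩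
    refine ⟨-s, fun σ => ?_⟩
    simp only [AddSubgroup.coe_neg, Pi.neg_apply, map_neg, hs]
    rw [neg_sub, sub_neg_eq_add, neg_add_eq_sub]

/-- Continuous (that is, locally constant) inhomogeneous `2`-cocycles of `G` with values in a
discrete module `A`, written multiplicatively, on which `σ` acts by `φ σ`. -/
def Z2 {A : Type*} [CommGroup A] (φ : G → A →* A) : Subgroup (G × G → A) where
  carrier := {z | IsLocallyConstant z ∧
    ∀ σ τ ρ, φ σ (z (τ, ρ)) * z (σ, τ * ρ) = z (σ * τ, ρ) * z (σ, τ)}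
  one_mem' := ⟨IsLocallyConstant.const 1, by simp⟩
  mul_mem' := by
    rintro a b ⟨ha, ha'⟩ ⟨hb, hb'⟩
    refine ⟨ha.mul hb, fun σ τ ρ => ?_⟩
    simp only [Pi.mul_apply, map_mul]
    rw [mul_mul_mul_comm, ha', hb', mul_mul_mul_comm]
  inv_mem' := by
    rintro a ⟨ha, ha'⟩
    refine ⟨ha.inv, fun σ τ ρ => ?_⟩
    simp only [Pi.inv_apply, map_inv]
    rw [← mul_inv, ha', mul_inv]

/-- The coboundaries of continuous `1`-cochains, as a subgroup of the group of `2`-cocycles. -/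
def B2 {A : Type*} [CommGroup A] (φ : G → A →* A) : Subgroup (Z2 φ) where
  carrier := {z | ∃ h : G → A, IsLocallyConstant h ∧
    ∀ σ τ, z.1 (σ, τ) = h σ * φ σ (h τ) / h (σ * τ)}
  one_mem' := ⟨1, IsLocallyConstant.const 1, by simp⟩
  mul_mem' := by
    rintro a b ⟨h, hh, ha⟩ ⟨k, hk, hb⟩
    refine ⟨h * k, hh.mul hk, fun σ τ => ?_⟩
    simp only [Subgroup.coe_mul, Pi.mul_apply, map_mul, ha, hb]
    rw [div_mul_div_comm, mul_mul_mul_comm]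
  inv_mem' := by
    rintro a ⟨h, hh, ha⟩
    refine ⟨h⁻¹, hh.inv, fun σ τ => ?_⟩
    simp only [Subgroup.coe_inv, Pi.inv_apply, map_inv, ha]
    rw [← mul_inv, inv_div_inv, inv_div]

end Cohomology

section Brauer

variable (K : Type*) [Field K]

/-- The action of an element of the Galois group on the multiplicative group of `Kˢᵉᵖ`. -/
noncomputable def unitsAct (σ : GalK K) : (SeparableClosure K)ˣ →* (SeparableClosure K)ˣ :=
  Units.map (σ : SeparableClosure K →* SeparableClosure K)

/-- The Brauer group `Br(K) = H²(K, 𝔾ₘ)`, written additively. -/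
abbrev Br : Type _ := Additive (Z2 (unitsAct K) ⧸ B2 (unitsAct K))

/-- The Brauer class of a `2`-cocycle. -/
noncomputable def Br.mk (z : Z2 (unitsAct K)) : Br K := Additive.ofMul (QuotientGroup.mk z)

/-- The group `Kˣ / Kˣⁿ`. -/
abbrev ModPowers (n : ℕ) : Type _ := Kˣ ⧸ (powMonoidHom n : Kˣ →* Kˣ).range

end Brauer

section Kummer

variable {K : Type*} [Field K] {n : ℕ} [NeZero (n : K)]

lemma neZero_nat (K : Type*) [Field K] (n : ℕ) [NeZero (n : K)] : NeZero n :=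
  NeZero.of_neZero_natCast K

/-- A primitive root of unity of `K`, in `Kˢᵉᵖ`. -/
noncomputable abbrev zetaSep (ζ : K) : SeparableClosure K := algebraMap K (SeparableClosure K) ζ

lemma zeta_pow_add {ζ : K} (hζ : IsPrimitiveRoot ζ n) (i j : ZMod n) :
    zetaSep ζ ^ (i + j).val = zetaSep ζ ^ i.val * zetaSep ζ ^ j.val := by
  have := neZero_nat K n
  rw [ZMod.val_add, ← pow_add, ← map_pow, ← map_pow, pow_eq_pow_mod (i.val + j.val) hζ.pow_eq_one]

lemma zeta_pow_inj {ζ : K} (hζ : IsPrimitiveRoot ζ n) {i j : ZMod n}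
    (h : zetaSep ζ ^ i.val = zetaSep ζ ^ j.val) : i = j := by
  have := neZero_nat K n
  have hζ' : IsPrimitiveRoot (zetaSep ζ) n :=
    hζ.map_of_injective (algebraMap K (SeparableClosure K)).injective
  exact ZMod.val_injective n (hζ'.pow_inj (ZMod.val_lt i) (ZMod.val_lt j) h)

/-- Kummer theory: for a primitive `n`-th root of unity `ζ ∈ K`, every `a ∈ Kˣ` defines a unique
map `u : Gal(Kˢᵉᵖ/K) → ℤ/n` with `σ(α) = ζ^{u(σ)} α` for all `α` with `αⁿ = a`. -/
lemma exists_kummer {ζ : K} (hζ : IsPrimitiveRoot ζ n) (a : Kˣ) :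
    ∃ u : GalK K → ZMod n, ∀ (σ : GalK K) (α : SeparableClosure K),
      α ^ n = algebraMap K (SeparableClosure K) a → σ α = zetaSep ζ ^ (u σ).val * α := by
  have := neZero_nat K n
  have : NeZero (n : SeparableClosure K) := by
    refine ⟨fun h => NeZero.ne (n : K) ?_⟩
    apply (algebraMap K (SeparableClosure K)).injective
    simpa using h
  have hζ' : IsPrimitiveRoot (zetaSep ζ) n :=
    hζ.map_of_injective (algebraMap K (SeparableClosure K)).injective
  obtain ⟨α₀, h₀⟩ := IsSepClosed.exists_pow_nat_eq (algebraMap K (SeparableClosure K) (a : K)) n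
  have hne : ∀ α : SeparableClosure K, α ^ n = algebraMap K (SeparableClosure K) a → α ≠ 0 := by
    rintro α h rfl
    rw [zero_pow (NeZero.ne n)] at h
    exact a.ne_zero ((algebraMap K (SeparableClosure K)).injective (by simpa using h.symm))
  have h1 : ∀ σ : GalK K, ∃ u : ZMod n, σ α₀ = zetaSep ζ ^ u.val * α₀ := by
    intro σ
    have : (σ α₀ / α₀) ^ n = 1 := by
      rw [div_pow, ← map_pow, h₀, AlgEquiv.commutes, div_self]
      rw [← h₀]; exact pow_ne_zero _ (hne _ h₀)
    obtain ⟨i, hi, hi'⟩ := hζ'.eq_pow_of_pow_eq_one this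
    refine ⟨(i : ZMod n), ?_⟩
    rw [ZMod.val_natCast_of_lt hi, hi', div_mul_cancel₀ _ (hne _ h₀)]
  choose u hu using h1
  refine ⟨u, fun σ α hα => ?_⟩
  have : (α / α₀) ^ n = 1 := by
    rw [div_pow, hα, ← h₀, div_self (pow_ne_zero _ (hne _ h₀))]
  obtain ⟨i, -, hi⟩ := hζ'.eq_pow_of_pow_eq_one this
  have e : α = zetaSep ζ ^ i * α₀ := by rw [hi, div_mul_cancel₀ _ (hne _ h₀)]
  rw [e, map_mul, hu, map_pow, AlgEquiv.commutes, mul_left_comm]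

/-- The Kummer character of `a ∈ Kˣ` with respect to `ζ`. -/
noncomputable def kummerChar₀ {ζ : K} (hζ : IsPrimitiveRoot ζ n) (a : Kˣ) : GalK K → ZMod n :=
  (exists_kummer hζ a).choose

lemma kummerChar₀_spec {ζ : K} (hζ : IsPrimitiveRoot ζ n) (a : Kˣ) (σ : GalK K)
    (α : SeparableClosure K) (h : α ^ n = algebraMap K (SeparableClosure K) a) :
    σ α = zetaSep ζ ^ (kummerChar₀ hζ a σ).val * α :=
  (exists_kummer hζ a).choose_spec σ α h

lemma exists_root (n : ℕ) [NeZero (n : K)] (a : Kˣ) :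
    ∃ α : SeparableClosure K, α ≠ 0 ∧ α ^ n = algebraMap K (SeparableClosure K) a := by
  have := neZero_nat K n
  have : NeZero (n : SeparableClosure K) := by
    refine ⟨fun h => NeZero.ne (n : K) ?_⟩
    apply (algebraMap K (SeparableClosure K)).injective
    simpa using h
  obtain ⟨α₀, h₀⟩ := IsSepClosed.exists_pow_nat_eq (algebraMap K (SeparableClosure K) (a : K)) n
  refine ⟨α₀, ?_, h₀⟩
  rintro rfl
  rw [zero_pow (NeZero.ne n)] at h₀
  exact a.ne_zero ((algebraMap K (SeparableClosure K)).injective (by simpa using h₀.symm))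

/-- The Kummer character `u_a : Gal(Kˢᵉᵖ/K) → ℤ/n` of a class `a ∈ Kˣ/Kˣⁿ` with respect to a
primitive `n`-th root of unity `ζ ∈ K`: if `αⁿ = a`, then `σ(α) = ζ^{u_a(σ)} α`. -/
noncomputable def kummerChar {ζ : K} (hζ : IsPrimitiveRoot ζ n) (a : ModPowers K n) :
    GalK K → ZMod n :=
  Quotient.liftOn' a (kummerChar₀ hζ) (by
    intro a b hab
    rw [QuotientGroup.leftRel_apply] at hab
    obtain ⟨c, hc⟩ := hab
    funext σ
    obtain ⟨α, hα, hα'⟩ := exists_root n a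
    have hb : (α * algebraMap K (SeparableClosure K) c) ^ n
        = algebraMap K (SeparableClosure K) b := by
      have hbe : (b : K) = a * (c : K) ^ n := by
        have : b = a * c ^ n := by
          rw [show c ^ n = a⁻¹ * b from hc]; simp
        rw [this]; simp
      rw [mul_pow, hα', hbe, map_mul, map_pow]
    have h1 := kummerChar₀_spec hζ a σ α hα'
    have h2 := kummerChar₀_spec hζ b σ _ hb
    rw [map_mul, AlgEquiv.commutes, h1, ← mul_assoc] at h2
    have hc0 : algebraMap K (SeparableClosure K) c ≠ 0 := by simp
    exact zeta_pow_inj hζ (mul_right_cancel₀ hα (mul_right_cancel₀ hc0 h2)))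

lemma kummerChar_mk {ζ : K} (hζ : IsPrimitiveRoot ζ n) (a : Kˣ) :
    kummerChar hζ (QuotientGroup.mk a : ModPowers K n) = kummerChar₀ hζ a := rfl

lemma kummerChar_mul {ζ : K} (hζ : IsPrimitiveRoot ζ n) (a : ModPowers K n) (σ τ : GalK K) :
    kummerChar hζ a (σ * τ) = kummerChar hζ a σ + kummerChar hζ a τ := by
  obtain ⟨a, rfl⟩ := QuotientGroup.mk_surjective a
  rw [kummerChar_mk]
  obtain ⟨α, hα, hα'⟩ := exists_root n a
  apply zeta_pow_inj hζ
  apply mul_right_cancel₀ hα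
  rw [← kummerChar₀_spec hζ a _ α hα', AlgEquiv.mul_apply, kummerChar₀_spec hζ a τ α hα',
    map_mul, map_pow, AlgEquiv.commutes, kummerChar₀_spec hζ a σ α hα', zeta_pow_add hζ]
  ring

lemma kummerChar_isLocallyConstant {ζ : K} (hζ : IsPrimitiveRoot ζ n) (a : ModPowers K n) :
    IsLocallyConstant (kummerChar hζ a) := by
  obtain ⟨a, rfl⟩ := QuotientGroup.mk_surjective a
  obtain ⟨α, hα, hα'⟩ := exists_root n a
  rw [IsLocallyConstant.iff_exists_open]
  intro σ
  have hopen : IsOpen (MulAction.stabilizer (GalK K) α : Set (GalK K)) :=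
    stabilizer_isOpen_of_isIntegral α
  refine ⟨(fun τ => σ⁻¹ * τ) ⁻¹' (MulAction.stabilizer (GalK K) α : Set (GalK K)),
    hopen.preimage (continuous_const_mul σ⁻¹), by simp, fun τ hτ => ?_⟩
  have hfix : (σ⁻¹ * τ) α = α := hτ
  have h : τ = σ * (σ⁻¹ * τ) := by simp
  rw [h, kummerChar_mul, add_eq_left, kummerChar_mk]
  apply zeta_pow_inj hζ
  apply mul_right_cancel₀ hα
  rw [← kummerChar₀_spec hζ a _ α hα', hfix]
  simp

/-- `ζ`, as a unit of `Kˢᵉᵖ`. -/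
noncomputable def zetaUnit {ζ : K} (hζ : IsPrimitiveRoot ζ n) : (SeparableClosure K)ˣ :=
  Units.mk0 (zetaSep ζ) (by
    have := neZero_nat K n
    simpa using hζ.ne_zero (NeZero.ne n))

/-- The cup product of two Kummer characters, `(σ, τ) ↦ ζ^{u_a(σ) u_b(τ)}`. -/
noncomputable def symbolCocycle {ζ : K} (hζ : IsPrimitiveRoot ζ n) (a b : ModPowers K n) :
    Z2 (unitsAct K) :=
  ⟨fun p => zetaUnit hζ ^ (kummerChar hζ a p.1 * kummerChar hζ b p.2).val, by
    refine ⟨?_, fun σ τ ρ => ?_⟩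
    · have h1 := (kummerChar_isLocallyConstant hζ a).comp_continuous
        (continuous_fst (X := GalK K) (Y := GalK K))
      have h2 := (kummerChar_isLocallyConstant hζ b).comp_continuous
        (continuous_snd (X := GalK K) (Y := GalK K))
      exact (h1.mul h2).comp (fun i : ZMod n => zetaUnit hζ ^ i.val)
    · ext
      simp only [zetaUnit, unitsAct, map_pow, Units.val_mul, Units.val_pow_eq_pow_val, Units.coe_map,
        Units.val_mk0, MonoidHom.coe_coe, AlgEquiv.commutes, kummerChar_mul]
      rw [← zeta_pow_add hζ, ← zeta_pow_add hζ]
      congr 2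
      have key : ∀ p q r s : ZMod n, p * q + r * (s + q) = (r + p) * q + r * s := by
        intros; ring
      exact congrArg ZMod.val (key _ _ _ _)⟩

/-- The norm residue symbol `⟨a, b⟩_n ∈ Br(K)` with respect to a primitive `n`-th root of unity
`ζ ∈ K`: the cup product of the Kummer classes of `a` and `b` in `H²(K, μ_n ⊗ μ_n)`, carried to
`Br(K)` by means of the isomorphism `μ_n ≅ ℤ/n` given by `ζ`. -/
noncomputable def normResidue {ζ : K} (hζ : IsPrimitiveRoot ζ n) (a b : ModPowers K n) : Br K :=
  Br.mk K (symbolCocycle hζ a b)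

end Kummer

/-! ### Places and divisors of a function field, and the obstruction of a divisor class -/

section Places

/-- A place of the function field `F` over `k`: a valuation ring of `F` that contains `k` and is
different from `F`. If `F` is the function field of a regular projective curve over `k`, the places
are the closed points of that curve. -/
structure Place (k F : Type*) [Field k] [Field F] [Algebra k F] where
  /-- The valuation ring. -/
  ring : ValuationSubring F
  algebraMap_mem : ∀ a : k, algebraMap k F a ∈ ring
  ne_top : ring ≠ ⊤

/-- `f` has order `m` at the (discrete) valuation ring `A`: it has the same valuation as the
`m`-th power of a uniformizer. -/
def HasOrder {F : Type*} [Field F] (A : ValuationSubring F) (f : F) (m : ℤ) : Prop :=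
  ∃ t : A, Irreducible t ∧ A.valuation f = A.valuation (t : F) ^ m

/-- `div f = D`. -/
def HasDivisor {k F : Type*} [Field k] [Field F] [Algebra k F] (f : F) (D : Place k F →₀ ℤ) :
    Prop :=
  ∀ A : Place k F, HasOrder A.ring f (D A)

variable (K F : Type*) [Field K] [Field F] [Algebra K F] [Algebra (SeparableClosure K) F]

/-- A semilinear action of the absolute Galois group on a field `F` over `Kˢᵉᵖ`. When `F` is the
function field of a curve over `Kˢᵉᵖ`, this gives the Galois action on the function field
`Kˢᵉᵖ(C)` of a `K`-form `C` of that curve. -/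
structure SemilinearAction where
  /-- The action. -/
  act : GalK K →* (F ≃ₐ[K] F)
  semilinear : ∀ σ (a : SeparableClosure K),
    act σ (algebraMap (SeparableClosure K) F a) = algebraMap (SeparableClosure K) F (σ a)

variable {K F}

/-- The action on places, that is, on the closed points of `C` over `Kˢᵉᵖ`: the image of the
valuation ring under the action of `σ` on the function field. -/
noncomputable def SemilinearAction.onPlace (ρ : SemilinearAction K F) (σ : GalK K)
    (A : Place (SeparableClosure K) F) : Place (SeparableClosure K) F where
  ring := A.ring.comap (ρ.act σ).symm.toRingEquiv.toRingHom
  algebraMap_mem a := by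
    rw [ValuationSubring.mem_comap]
    have h : (ρ.act σ).symm (algebraMap (SeparableClosure K) F a)
        = algebraMap (SeparableClosure K) F (σ.symm a) := by
      rw [AlgEquiv.symm_apply_eq, ρ.semilinear, AlgEquiv.apply_symm_apply]
    change (ρ.act σ).symm (algebraMap (SeparableClosure K) F a) ∈ A.ring
    rw [h]
    exact A.algebraMap_mem _
  ne_top h := by
    apply A.ne_top
    rw [eq_top_iff]
    intro x _
    have hx : ρ.act σ x ∈ A.ring.comap (ρ.act σ).symm.toRingEquiv.toRingHom := by
      rw [h]; trivial
    rw [ValuationSubring.mem_comap] at hx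
    have hx' : (ρ.act σ).symm (ρ.act σ x) ∈ A.ring := hx
    simpa using hx'

/-- The action on divisors. -/
noncomputable def SemilinearAction.onDivisor (ρ : SemilinearAction K F) (σ : GalK K)
    (D : Place (SeparableClosure K) F →₀ ℤ) : Place (SeparableClosure K) F →₀ ℤ :=
  D.mapDomain (ρ.onPlace σ)

/-- `c = δ([D])`, where `δ : Pic(C_{Kˢᵉᵖ})^{Gal} → Br(K)` and `C` is the `K`-form of a curve given
by the semilinear action `ρ`. The map `δ` is the composite of the connecting maps of
`0 → Princ → Div → Pic → 0` and `0 → (Kˢᵉᵖ)ˣ → Kˢᵉᵖ(C)ˣ → Princ → 0`: choose functions `f σ` with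
`div (f σ) = σ D - D`; then `f σ * σ (f τ) * (f (σ τ))⁻¹` is a `2`-cocycle with constant values.
(In particular such `f` exist only if the class of `D` is Galois invariant.) -/
def IsBrauerObstruction (ρ : SemilinearAction K F) (D : Place (SeparableClosure K) F →₀ ℤ)
    (c : Br K) : Prop :=
  ∃ (f : GalK K → Fˣ) (z : Z2 (unitsAct K)), IsLocallyConstant f ∧
    (∀ σ, HasDivisor (f σ : F) (ρ.onDivisor σ D - D)) ∧
    (∀ σ τ, algebraMap (SeparableClosure K) F (z.1 (σ, τ)) * (f (σ * τ) : F)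
      = (f σ : F) * ρ.act σ (f τ : F)) ∧
    Br.mk K z = c

end Places

/-! ### Elliptic curves -/

section Elliptic

variable {K : Type*} [Field K] (W : WeierstrassCurve K)

/-- The group `E(Kˢᵉᵖ)`. -/
abbrev Pts : Type _ := (Affine.baseChange W (SeparableClosure K)).Point

open scoped Classical in
/-- The subgroup `E[n]` of `E(Kˢᵉᵖ)`. -/
noncomputable def nTorsion (n : ℕ) : AddSubgroup (Pts W) := (nsmulAddMonoidHom n).ker

open scoped Classical in
/-- The Galois action on `E(Kˢᵉᵖ)`. -/
noncomputable def ptsAct (σ : GalK K) : Pts W →+ Pts W :=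
  Affine.Point.map (W' := W) (σ : SeparableClosure K →ₐ[K] SeparableClosure K)

open scoped Classical in
/-- The Galois action on `E[n]`. -/
noncomputable def nTorsionAct (n : ℕ) (σ : GalK K) : nTorsion W n →+ nTorsion W n :=
  ((ptsAct W σ).comp (nTorsion W n).subtype).codRestrict (nTorsion W n) (by
    rintro ⟨P, hP⟩
    have hP' : n • P = 0 := hP
    change n • ptsAct W σ P = 0
    rw [← map_nsmul, hP', map_zero])

/-- The Galois cohomology group `H¹(K, E[n])`. -/
abbrev H1Torsion (n : ℕ) : Type _ := Z1 (nTorsionAct W n) ⧸ B1 (nTorsionAct W n)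

/-- `E[n]` is a trivial Galois module. -/
def TrivialTorsion (n : ℕ) : Prop :=
  ∀ (σ : GalK K) (P : nTorsion W n), nTorsionAct W n σ P = P

/-- The coordinate ring `Kˢᵉᵖ[E]` of the affine curve. -/
abbrev CoordRing : Type _ := (Affine.baseChange W (SeparableClosure K)).CoordinateRing

/-- The function field `Kˢᵉᵖ(E)`. -/
def FunField : Type _ := (Affine.baseChange W (SeparableClosure K)).FunctionField

noncomputable instance : Field (FunField W) :=
  inferInstanceAs (Field (FractionRing (CoordRing W)))

noncomputable instance : Algebra (CoordRing W) (FunField W) :=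
  inferInstanceAs (Algebra (CoordRing W) (FractionRing (CoordRing W)))

instance : IsFractionRing (CoordRing W) (FunField W) :=
  inferInstanceAs (IsFractionRing (CoordRing W) (FractionRing (CoordRing W)))

noncomputable instance : Algebra (SeparableClosure K) (FunField W) :=
  ((algebraMap (CoordRing W) (FunField W)).comp
    (algebraMap (SeparableClosure K) (CoordRing W))).toAlgebra

noncomputable instance : Algebra K (FunField W) :=
  ((algebraMap (SeparableClosure K) (FunField W)).comp
    (algebraMap K (SeparableClosure K))).toAlgebra

instance : IsScalarTower (SeparableClosure K) (CoordRing W) (FunField W) :=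
  IsScalarTower.of_algebraMap_eq fun _ => rfl

instance : IsScalarTower K (SeparableClosure K) (FunField W) :=
  IsScalarTower.of_algebraMap_eq fun _ => rfl

/-- The coordinate function `x` on `E`. -/
noncomputable def xFun : FunField W :=
  algebraMap (CoordRing W) (FunField W) (Affine.CoordinateRing.mk _ (Polynomial.C Polynomial.X))

/-- The coordinate function `y` on `E`. -/
noncomputable def yFun : FunField W :=
  algebraMap (CoordRing W) (FunField W) (Affine.CoordinateRing.mk _ Polynomial.X)

lemma equation_xFun_yFun : (Affine.baseChange W (FunField W)).Equation (xFun W) (yFun W) := by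
  have h : algebraMap (CoordRing W) (FunField W) (Affine.CoordinateRing.mk _
      (Affine.baseChange W (SeparableClosure K)).polynomial) = 0 := by
    rw [AdjoinRoot.mk_self, map_zero]
  have hC : ∀ a : K, algebraMap (CoordRing W) (FunField W) (Affine.CoordinateRing.mk _
      (Polynomial.C (Polynomial.C (algebraMap K (SeparableClosure K) a))))
      = algebraMap K (FunField W) a := fun _ => rfl
  rw [Affine.equation_iff]
  simp only [Affine.polynomial, map_add, map_sub, map_mul, map_pow] at h
  simp only [WeierstrassCurve.baseChange, WeierstrassCurve.map, hC] at h ⊢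
  rw [xFun, yFun, ← sub_eq_zero, ← h]
  ring

/-- The generic point `(x, y)` of `E`, a point of `E` with coordinates in the function field. -/
noncomputable def genericPoint [W.IsElliptic] : (Affine.baseChange W (FunField W)).Point :=
  have : (Affine.baseChange W (FunField W)).IsElliptic :=
    inferInstanceAs (W.map (algebraMap K (FunField W))).IsElliptic
  Affine.Point.mk (equation_xFun_yFun W)

open scoped Classical in
/-- A point of `E` over `Kˢᵉᵖ`, regarded as a (constant) point over the function field. -/
noncomputable def constPoint : Pts W →+ (Affine.baseChange W (FunField W)).Point :=
  Affine.Point.map (W' := W) (IsScalarTower.toAlgHom K (SeparableClosure K) (FunField W))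

/-- `τ` is the pullback of functions `f(X) ↦ f(X - P)` along the translation by `-P`: the
`Kˢᵉᵖ`-automorphism of the function field that carries the generic point `X` to `X - P`. -/
def IsTranslation [W.IsElliptic] (P : Pts W) (τ : FunField W ≃ₐ[SeparableClosure K] FunField W) :
    Prop :=
  open scoped Classical in
  Affine.Point.map (W' := W) ((τ.restrictScalars K : FunField W ≃ₐ[K] FunField W) :
    FunField W →ₐ[K] FunField W) (genericPoint W) = genericPoint W - constPoint W P

/-- `ρ` is the Galois action on the function field `Kˢᵉᵖ(C)` of the principal homogeneous space
`C` of `E` defined by the cocycle `ξ`. Here `C` is `E` over `Kˢᵉᵖ`, and `σ` acts on `C(Kˢᵉᵖ)` by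
`Q ↦ σ(Q) + ξ(σ)`, so that `C` has the class of `σ ↦ σ(p) - p = ξ(σ)`, with `p` the point `O`.
On functions, `σ` acts by `f(X) ↦ (σf)(X - ξ(σ))`: it acts on constants as usual, and
carries the generic point `X` to `X - ξ(σ)`. -/
def IsTorsorAction [W.IsElliptic] {n : ℕ} (ξ : GalK K → nTorsion W n)
    (ρ : SemilinearAction K (FunField W)) : Prop :=
  open scoped Classical in
  ∀ σ, Affine.Point.map (W' := W) (ρ.act σ : FunField W →ₐ[K] FunField W) (genericPoint W)
    = genericPoint W - constPoint W (ξ σ)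

/-- `A` is the place of the point `P` of `E`. For `P = O`, this is the only place where `x` has a
pole; for an affine point `P = (a, b)`, the only place where `x - a` and `y - b` vanish. -/
def IsPlaceOf (A : Place (SeparableClosure K) (FunField W)) : Pts W → Prop
  | .zero => xFun W ∉ A.ring
  | .some a b _ =>
      A.ring.valuation (xFun W - algebraMap (SeparableClosure K) (FunField W) a) < 1 ∧
      A.ring.valuation (yFun W - algebraMap (SeparableClosure K) (FunField W) b) < 1

/-- `Δ(ξ) = c`: if `(C, [D])` is the pair that corresponds to `ξ ∈ H¹(K, E[n])`, then `c = δ([D])`.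
Here `C` is the principal homogeneous space defined by a cocycle that represents `ξ`, which is `E`
over `Kˢᵉᵖ` with a twisted Galois action, and `D = n[O]`. -/
def IsPeriodIndexObstruction [W.IsElliptic] (n : ℕ) (ξ : H1Torsion W n) (c : Br K) : Prop :=
  ∃ (x : Z1 (nTorsionAct W n)) (ρ : SemilinearAction K (FunField W))
    (A : Place (SeparableClosure K) (FunField W)),
    QuotientAddGroup.mk x = ξ ∧ IsTorsorAction W x.1 ρ ∧ IsPlaceOf W A .zero ∧
    IsBrauerObstruction ρ (Finsupp.single A (n : ℤ)) c

open scoped Classical in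
/-- The period-index obstruction map `Δ : H¹(K, E[n]) → Br(K)`. -/
noncomputable def periodIndexObstruction [W.IsElliptic] (n : ℕ) (ξ : H1Torsion W n) : Br K :=
  if h : ∃ c, IsPeriodIndexObstruction W n ξ c then h.choose else 0

/-- `e_n(P, Q) = w`, where `e_n` is the Weil pairing on `E[n]`: if `div f = n[P] - n[O]` and
`div g = n[Q] - n[O]`, then `e_n(P, Q) = (f(X) / f(X - Q)) / (g(X) / g(X - P))`.
This is the quotient of `f` evaluated at `[X] - [X - Q]` by `g` evaluated at `[X] - [X - P]`; it is
also the commutator of lifts of `P` and `Q` to the theta group of the line bundle of `n[O]`. -/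
def IsWeilPairing [W.IsElliptic] (n : ℕ) (P Q : nTorsion W n) (w : SeparableClosure K) : Prop :=
  ∃ (A B O : Place (SeparableClosure K) (FunField W))
    (s t : FunField W ≃ₐ[SeparableClosure K] FunField W) (f g : FunField W),
    IsPlaceOf W A P ∧ IsPlaceOf W B Q ∧ IsPlaceOf W O .zero ∧
    IsTranslation W P s ∧ IsTranslation W Q t ∧
    HasDivisor f (Finsupp.single A (n : ℤ) - Finsupp.single O (n : ℤ)) ∧
    HasDivisor g (Finsupp.single B (n : ℤ) - Finsupp.single O (n : ℤ)) ∧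
    f * s g = algebraMap (SeparableClosure K) (FunField W) w * (g * t f)

variable {W} {n : ℕ} [NeZero (n : K)]

/-- Let `E[n]` be a trivial Galois module, `e : (ℤ/n)² ≅ E[n]` and `ζ ∈ K` a primitive `n`-th root
of unity. This is the induced map `(Kˣ/Kˣⁿ)² ≅ H¹(K, ℤ/n)² ≅ H¹(K, E[n])`. -/
noncomputable def kummerClass {ζ : K} (hζ : IsPrimitiveRoot ζ n) (htriv : TrivialTorsion W n)
    (e : ZMod n × ZMod n ≃+ nTorsion W n) (a b : ModPowers K n) : H1Torsion W n :=
  QuotientAddGroup.mk ⟨fun σ => e (kummerChar hζ a σ, kummerChar hζ b σ), by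
    refine ⟨?_, fun σ τ => ?_⟩
    · exact ((kummerChar_isLocallyConstant hζ a).prodMk (kummerChar_isLocallyConstant hζ b)).comp e
    · simp only [htriv σ _]
      rw [← map_add, kummerChar_mul, kummerChar_mul, Prod.mk_add_mk]⟩

end Elliptic

end PeriodIndex

/-! The proof takes place in the theta group of the line bundle of n[O], extended by the Galois
group (`thetaGroup`). Its elements are pairs (f, g), with g a semilinear automorphism of the
function field and div f = n[gO] - n[O], seen as operators a ↦ f·g(a). Two elements with the same g
differ by a constant (`exists_eq_constOp_mul`), so the group is an extension by (Kˢᵉᵖ)ˣ of the group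
of the automorphisms that lift.

Since n is invertible in K, the basis P, Q lifts to u, v with uⁿ = vⁿ = 1
(`exists_mem_thetaGroup_pow_eq_one`). The commutator of u and v is a constant, and the formula that
defines the Weil pairing is this commutator written out (`isWeilPairing_iff`). Let s_σ be the
untwisted action of σ. As P and Q are rational, s_σ u s_σ⁻¹ is u times an n-th root of unity. If α
is a leading coefficient of the function of u, then αⁿ lies in K and this root of unity is given by
its Kummer character (`exists_kummerChar`). This produces A from u and B from v.

For the cocycle a(σ)P + b(σ)Q the operators R_σ = u^{a(σ)} v^{b(σ)} s_σ lift the twisted Galois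
action, so R_σ R_τ R_{στ}⁻¹ represents Δ (`isPeriodIndexObstruction_iff_of_lift`). Reordering the
factors (`heisenberg_mul`) gives ζ to the power A(σ)a(τ) + B(σ)b(τ) - b(σ)a(τ), where A and B also
denote the Kummer characters. The cup product of characters is antisymmetric up to a coboundary, so
completing the product gives C₁ = B and C₂ = A⁻¹ (`mk_heisenbergCocycle`).

That ζ is primitive is nondegeneracy of the commutator (`orderOf_commutator`). If it had order d,
then u and v^d would commute and generate a group of order n·(n/d) lifting a group of translations.
An average over this group is a function θ for which div θ + n[O] is invariant under translations
that act freely on places. Hence n·(n/d) divides the degree n (`card_dvd_of_lift`), and d = n.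

Most of the file supplies the geometry: the coordinate ring is Dedekind, places are its maximal
ideals and one point at infinity, principal divisors have degree 0, and translations act freely on
closed points, whose residue fields may be inseparable over Kˢᵉᵖ. -/

namespace PeriodIndex

open WeierstrassCurve Polynomial IsDedekindDomain

/-! ### The coordinate ring of a smooth Weierstrass curve is a Dedekind domain -/

section Dedekind

variable {k : Type*} [Field k] {V : Affine k}

/-- Smoothness of the curve, over the residue field of an irreducible polynomial. -/
lemma not_sq_dvd_eval_polynomial [V.IsElliptic] {π s : k[X]} (hπ : Irreducible π)
    (h2 : π ^ 2 ∣ s ^ 2 + (C V.a₁ * X + C V.a₃) * s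
      - (X ^ 3 + C V.a₂ * X ^ 2 + C V.a₄ * X + C V.a₆))
    (h1 : π ∣ 2 * s + (C V.a₁ * X + C V.a₃)) : False := by
  have : Fact (Irreducible π) := ⟨hπ⟩
  let φ : k[X] →+* AdjoinRoot π := AdjoinRoot.mk π
  have hφ : ∀ a, φ (C a) = algebraMap k (AdjoinRoot π) a := fun _ => rfl
  have hE : (V.map (algebraMap k (AdjoinRoot π))).toAffine.Equation (φ X) (φ s) := by
    rw [Affine.equation_iff']
    have : φ (s ^ 2 + (C V.a₁ * X + C V.a₃) * s
      - (X ^ 3 + C V.a₂ * X ^ 2 + C V.a₄ * X + C V.a₆)) = 0 :=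
      AdjoinRoot.mk_eq_zero.mpr ((dvd_pow_self π two_ne_zero).trans h2)
    simp only [map_sub, map_add, map_mul, map_pow, hφ] at this
    simp only [WeierstrassCurve.map]
    linear_combination this
  have hN := Affine.equation_iff_nonsingular.mp hE
  rw [Affine.nonsingular_iff'] at hN
  have hY : φ (2 * s + (C V.a₁ * X + C V.a₃)) = 0 := AdjoinRoot.mk_eq_zero.mpr h1
  -- A square factor π² leaves a factor π in the derivative. By the chain rule this derivative is
  -- the x-partial plus s' times the y-partial, so both partials vanish at (X, s) modulo π.
  have hD : φ (derivative (s ^ 2 + (C V.a₁ * X + C V.a₃) * s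
      - (X ^ 3 + C V.a₂ * X ^ 2 + C V.a₄ * X + C V.a₆))) = 0 := by
    obtain ⟨g, hg⟩ := h2
    rw [hg]
    apply AdjoinRoot.mk_eq_zero.mpr
    rw [pow_two, derivative_mul, derivative_mul]
    exact ⟨derivative π * g + derivative π * g + π * derivative g, by ring⟩
  simp only [derivative_mul, derivative_pow, derivative_C, derivative_X, map_sub, map_add,
    map_mul, map_pow, hφ, map_zero, map_one, map_ofNat, Nat.cast_ofNat] at hD hY
  simp only [WeierstrassCurve.map] at hN
  rcases hN.2 with h | h
  · apply h
    linear_combination hD - φ (derivative s) * hY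
  · apply h
    linear_combination hY

/-- An integral element of the form g/d lies in k(X) and is integral over k[X], which is integrally
closed. This is applied to the trace and the norm of an integral function. -/
lemma dvd_of_isIntegral {F : Type*} [Field F] [Algebra k[X] F] [FaithfulSMul k[X] F] {t : F}
    {d g : k[X]} (hd : d ≠ 0) (h : t * algebraMap k[X] F d = algebraMap k[X] F g)
    (ht : IsIntegral k[X] t) : d ∣ g := by
  have hinj : Function.Injective (algebraMap k[X] F) := FaithfulSMul.algebraMap_injective _ _
  let ψ : FractionRing k[X] →+* F := IsFractionRing.lift hinj
  let _ : Algebra (FractionRing k[X]) F := ψ.toAlgebra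
  have : IsScalarTower k[X] (FractionRing k[X]) F := IsScalarTower.of_algebraMap_eq fun x =>
    (IsFractionRing.lift_algebraMap hinj x).symm
  have hd' : algebraMap k[X] F d ≠ 0 := by
    rwa [Ne, map_eq_zero_iff _ hinj]
  have ht' : t = algebraMap (FractionRing k[X]) F
      (algebraMap k[X] _ g / algebraMap k[X] (FractionRing k[X]) d) := by
    rw [map_div₀, ← IsScalarTower.algebraMap_apply, ← IsScalarTower.algebraMap_apply, ← h,
      mul_div_cancel_right₀ _ hd']
  rw [ht', isIntegral_algebraMap_iff (algebraMap (FractionRing k[X]) F).injective] at ht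
  obtain ⟨c, hc⟩ := IsIntegrallyClosed.isIntegral_iff.mp ht
  refine ⟨c, IsFractionRing.injective k[X] (FractionRing k[X]) ?_⟩
  have hd'' : algebraMap k[X] (FractionRing k[X]) d ≠ 0 := by
    simpa using hd
  rw [eq_div_iff hd''] at hc
  rw [← hc, map_mul, mul_comm]

lemma eval₂_affinePolynomial {S : Type*} [CommRing S] (i : k[X] →+* S) (y : S) :
    V.polynomial.eval₂ i y = y ^ 2 + i (C V.a₁ * X + C V.a₃) * y
      - i (X ^ 3 + C V.a₂ * X ^ 2 + C V.a₄ * X + C V.a₆) := by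
  simp only [Affine.polynomial, eval₂_sub, eval₂_add, eval₂_mul, eval₂_pow, eval₂_X, eval₂_C]

/-- The homomorphism from the coordinate ring given by a solution of the Weierstrass equation. -/
noncomputable def coordLift {S : Type*} [CommRing S] (i : k[X] →+* S) (y : S)
    (h : y ^ 2 + i (C V.a₁ * X + C V.a₃) * y
      - i (X ^ 3 + C V.a₂ * X ^ 2 + C V.a₄ * X + C V.a₆) = 0) : V.CoordinateRing →+* S :=
  AdjoinRoot.lift i y (by rw [eval₂_affinePolynomial, h])

lemma coordLift_C {S : Type*} [CommRing S] (i : k[X] →+* S) (y : S) (h) (p : k[X]) :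
    coordLift (V := V) i y h (Affine.CoordinateRing.mk V (C p)) = i p :=
  AdjoinRoot.lift_of _

lemma coordLift_X {S : Type*} [CommRing S] (i : k[X] →+* S) (y : S) (h) :
    coordLift (V := V) i y h (Affine.CoordinateRing.mk V X) = y :=
  AdjoinRoot.lift_root _

variable (V) in
lemma mk_relation : Affine.CoordinateRing.mk V X ^ 2
    + Affine.CoordinateRing.mk V (C (C V.a₁ * X + C V.a₃)) * Affine.CoordinateRing.mk V X
    - Affine.CoordinateRing.mk V (C (X ^ 3 + C V.a₂ * X ^ 2 + C V.a₄ * X + C V.a₆)) = 0 := by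
  rw [← map_pow, ← map_mul, ← map_add, ← map_sub]
  exact AdjoinRoot.mk_self

variable (V) in
/-- The involution `y ↦ -y - a₁x - a₃` of the coordinate ring. -/
noncomputable def coordConj : V.CoordinateRing →+* V.CoordinateRing :=
  coordLift ((Affine.CoordinateRing.mk V).comp C)
    (-Affine.CoordinateRing.mk V X - Affine.CoordinateRing.mk V (C (C V.a₁ * X + C V.a₃))) (by
      rw [← mk_relation V, RingHom.comp_apply, RingHom.comp_apply]
      ring)

lemma coordConj_C (p : k[X]) : coordConj V (Affine.CoordinateRing.mk V (C p)) =
    Affine.CoordinateRing.mk V (C p) :=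
  coordLift_C _ _ _ _

lemma coordConj_X : coordConj V (Affine.CoordinateRing.mk V X) =
    -Affine.CoordinateRing.mk V X - Affine.CoordinateRing.mk V (C (C V.a₁ * X + C V.a₃)) :=
  coordLift_X _ _ _

lemma coordConj_coordConj (r : V.CoordinateRing) : coordConj V (coordConj V r) = r := by
  obtain ⟨p, q, rfl⟩ := Affine.CoordinateRing.exists_smul_basis_eq r
  simp only [Affine.CoordinateRing.smul, mul_one, map_add, map_mul, coordConj_C, coordConj_X,
    map_sub, map_neg]
  ring

lemma mul_coordConj (r : V.CoordinateRing) :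
    r * coordConj V r = Affine.CoordinateRing.mk V (C (Algebra.norm k[X] r)) := by
  obtain ⟨p, q, rfl⟩ := Affine.CoordinateRing.exists_smul_basis_eq r
  have := Affine.CoordinateRing.coe_norm_smul_basis (W' := V) p q
  refine Eq.trans ?_ this.symm
  simp only [Affine.CoordinateRing.smul, mul_one, map_add, map_mul, coordConj_C, coordConj_X,
    map_sub, map_neg]

instance : Module.Finite k[X] V.CoordinateRing := .of_basis (Affine.CoordinateRing.basis V)

/-- The trace and norm of t over k[X] are polynomials, which gives divisibility of 2p - q(a₁X + a₃)
by π and of the norm of p + qy by π². If π did not divide q, then -p/q would be a double root of the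
Weierstrass polynomial modulo π, and even a root modulo π², against smoothness. -/
lemma isIntegral_div_irreducible [V.IsElliptic] {π p q : k[X]} (hπ : Irreducible π)
    {t : FractionRing V.CoordinateRing}
    (h : t * algebraMap k[X] _ π = algebraMap V.CoordinateRing _
      (p • (1 : V.CoordinateRing) + q • Affine.CoordinateRing.mk V X))
    (ht : IsIntegral k[X] t) : π ∣ p ∧ π ∣ q := by
  let F := FractionRing V.CoordinateRing
  have hinj : Function.Injective (coordConj V) :=
    Function.LeftInverse.injective coordConj_coordConj
  have hinj' : Function.Injective ((algebraMap V.CoordinateRing F).comp (coordConj V)) :=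
    (IsFractionRing.injective V.CoordinateRing F).comp hinj
  let c : F →+* F := IsFractionRing.lift hinj'
  have hc : ∀ r, c (algebraMap _ _ r) = algebraMap V.CoordinateRing F (coordConj V r) :=
    fun r => IsFractionRing.lift_algebraMap hinj' r
  have hX : ∀ g : k[X], algebraMap k[X] F g =
      algebraMap V.CoordinateRing F (Affine.CoordinateRing.mk V (C g)) := fun g => rfl
  have hcX : ∀ g : k[X], c (algebraMap k[X] F g) = algebraMap k[X] F g := fun g => by
    rw [hX, hc, coordConj_C]
  have hct : IsIntegral k[X] (c t) := by
    refine ht.map_of_comp_eq (RingHom.id _) c ?_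
    exact RingHom.ext fun g => (hcX g).symm
  have h' : c t * algebraMap k[X] F π = algebraMap V.CoordinateRing F (coordConj V
      (p • (1 : V.CoordinateRing) + q • Affine.CoordinateRing.mk V X)) := by
    rw [← hc, ← h, map_mul, hcX]
  have hπ0 : π ≠ 0 := hπ.ne_zero
  have hT : π ∣ 2 * p - q * (C V.a₁ * X + C V.a₃) := by
    refine dvd_of_isIntegral (F := F) hπ0 ?_ (ht.add hct)
    rw [add_mul, h, h', ← map_add, hX]
    congr 1
    simp only [Affine.CoordinateRing.smul, mul_one, map_add, map_mul, coordConj_C, coordConj_X,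
      map_sub, map_ofNat]
    ring
  have hN : π ^ 2 ∣ p ^ 2 - p * q * (C V.a₁ * X + C V.a₃) -
      q ^ 2 * (X ^ 3 + C V.a₂ * X ^ 2 + C V.a₄ * X + C V.a₆) := by
    rw [← Affine.CoordinateRing.norm_smul_basis]
    refine dvd_of_isIntegral (F := F) (pow_ne_zero 2 hπ0) ?_ (ht.mul hct)
    rw [hX (Algebra.norm _ _), ← mul_coordConj, map_mul, ← h, ← h', map_pow]
    ring
  by_cases hq : π ∣ q
  · refine ⟨?_, hq⟩
    have : π ∣ p ^ 2 := by
      obtain ⟨r, rfl⟩ := hq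
      obtain ⟨m, hm⟩ := hN
      exact ⟨π * m + p * r * (C V.a₁ * X + C V.a₃) +
        π * r ^ 2 * (X ^ 3 + C V.a₂ * X ^ 2 + C V.a₄ * X + C V.a₆), by linear_combination hm⟩
    exact hπ.prime.dvd_of_dvd_pow this
  · exfalso
    have hcop : IsCoprime q (π ^ 2) :=
      ((hπ.coprime_iff_not_dvd.mpr hq).symm).pow_right
    obtain ⟨u, w, huw⟩ := hcop
    have hcop1 : IsCoprime π q := hπ.coprime_iff_not_dvd.mpr hq
    -- Here u inverts q modulo π², so that -(u p) stands for -p/q.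
    refine not_sq_dvd_eval_polynomial (V := V) hπ (s := -(u * p)) ?_ ?_
    · obtain ⟨m, hm⟩ := hN
      have hcop2 : IsCoprime (π ^ 2) (q ^ 2) := hcop1.pow
      refine hcop2.dvd_of_dvd_mul_left ?_
      set h := (C V.a₁ * X + C V.a₃ : k[X])
      refine ⟨m + (p ^ 2 * (w ^ 2 * π ^ 2 - 2 * w) + p * h * q * w), ?_⟩
      have e : q * u = 1 - w * π ^ 2 := by linear_combination huw
      have e2 : q ^ 2 * u ^ 2 = (1 - w * π ^ 2) ^ 2 := by rw [← e]; ring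
      linear_combination hm + p ^ 2 * e2 - p * h * q * e
    · refine hcop1.dvd_of_dvd_mul_left ?_
      obtain ⟨m, hm⟩ := hT
      refine ⟨-m + 2 * p * w * π, ?_⟩
      linear_combination (-1) * hm - 2 * p * huw

/-- The irreducible factors of the denominator are cancelled one at a time by
`isIntegral_div_irreducible`. -/
lemma mem_range_of_isIntegral [V.IsElliptic] (d : k[X]) (hd : d ≠ 0) :
    ∀ (t : FractionRing V.CoordinateRing) (r : V.CoordinateRing),
      t * algebraMap k[X] _ d = algebraMap V.CoordinateRing _ r → IsIntegral k[X] t →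
      ∃ r', algebraMap V.CoordinateRing _ r' = t := by
  have hX : ∀ g : k[X], algebraMap k[X] (FractionRing V.CoordinateRing) g =
      algebraMap V.CoordinateRing _ (Affine.CoordinateRing.mk V (C g)) := fun g => rfl
  have hinj : Function.Injective (algebraMap k[X] (FractionRing V.CoordinateRing)) :=
    FaithfulSMul.algebraMap_injective _ _
  induction d using WfDvdMonoid.induction_on_irreducible with
  | zero => exact absurd rfl hd
  | unit u hu =>
    intro t r h _
    obtain ⟨v, hv⟩ := hu.exists_right_inv
    refine ⟨r * Affine.CoordinateRing.mk V (C v), ?_⟩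
    rw [map_mul, ← h, ← hX, mul_assoc, ← map_mul, hv, map_one, mul_one]
  | mul a π ha hπ ih =>
    intro t r h ht
    have hI : IsIntegral k[X] (t * algebraMap k[X] (FractionRing V.CoordinateRing) a) :=
      ht.mul isIntegral_algebraMap
    obtain ⟨p, q, rfl⟩ := Affine.CoordinateRing.exists_smul_basis_eq r
    obtain ⟨⟨p', rfl⟩, ⟨q', rfl⟩⟩ := isIntegral_div_irreducible hπ (by
      rw [← h, map_mul]; ring) hI
    refine ih ha t (p' • (1 : V.CoordinateRing) + q' • Affine.CoordinateRing.mk V X) ?_ ht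
    have hπ0 : algebraMap k[X] (FractionRing V.CoordinateRing) π ≠ 0 := by
      rw [Ne, map_eq_zero_iff _ hinj]; exact hπ.ne_zero
    apply mul_left_cancel₀ hπ0
    rw [map_mul] at h
    rw [mul_left_comm, h, mul_smul, mul_smul, ← smul_add, Affine.CoordinateRing.smul π, map_mul,
      hX]

/-- Dimension one comes from integrality over k[X]. The content is integral closedness, where
smoothness enters. -/
instance isDedekindDomain_coordinateRing [V.IsElliptic] : IsDedekindDomain V.CoordinateRing :=
  { maximalOfPrime := (Ring.DimensionLEOne.of_isIntegral k[X] V.CoordinateRing).maximalOfPrime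
    algebraMap_injective := IsFractionRing.injective _ _
    isIntegral_iff := by
      intro t
      refine ⟨fun ht => ?_, ?_⟩
      · have ht' : IsIntegral k[X] t := isIntegral_trans t ht
        obtain ⟨r, s, hs, rfl⟩ := IsFractionRing.div_surjective (A := V.CoordinateRing) t
        have hs0 : s ≠ 0 := nonZeroDivisors.ne_zero hs
        have hX : ∀ g : k[X], algebraMap k[X] (FractionRing V.CoordinateRing) g =
          algebraMap V.CoordinateRing _ (Affine.CoordinateRing.mk V (C g)) := fun g => rfl
        -- Multiplying numerator and denominator by the conjugate of s moves the denominator into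
        -- k[X].
        refine mem_range_of_isIntegral (Algebra.norm k[X] s) (Algebra.norm_ne_zero_iff.mpr hs0) _
          (r * coordConj V s) ?_ ht'
        have hs1 : algebraMap V.CoordinateRing (FractionRing V.CoordinateRing) s ≠ 0 := by
          simpa using hs0
        rw [hX, ← mul_coordConj, map_mul, map_mul]
        field_simp
      · rintro ⟨r, rfl⟩
        exact isIntegral_algebraMap
    noetherian := (isNoetherianRing_iff.mp inferInstance).noetherian }

end Dedekind

/-! ### Orders of functions at discrete valuation rings -/

section Orders

variable {F : Type*} [Field F] {A : ValuationSubring F}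

/-- Divisibility in a valuation ring is total, so any two irreducible elements are associated. Hence
`HasOrder` does not depend on the choice of uniformizer. -/
lemma valuation_eq_of_irreducible {s t : A} (hs : Irreducible s) (ht : Irreducible t) :
    A.valuation (s : F) = A.valuation (t : F) := by
  have key : ∀ {s t : A}, Irreducible s → Irreducible t → s ∣ t →
      A.valuation (s : F) = A.valuation (t : F) := by
    rintro s _ hs ht ⟨c, rfl⟩
    have hc : IsUnit c := (ht.isUnit_or_isUnit rfl).resolve_left hs.not_isUnit
    rw [A.valuation_eq_one_iff] at hc
    simp [hc]
  rcases ValuationRing.dvd_total s t with h | h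
  · exact key hs ht h
  · exact (key ht hs h).symm

/-- A uniformizer of a discrete valuation ring. -/
structure IsUniformizer (A : ValuationSubring F) (t : F) : Prop where
  ne_zero : t ≠ 0
  lt_one : A.valuation t < 1
  exists_zpow : ∀ f : F, f ≠ 0 → ∃ m : ℤ, A.valuation f = A.valuation t ^ m

lemma IsUniformizer.valuation_pos {t : F} (ht : IsUniformizer A t) : 0 < A.valuation t := by
  rw [zero_lt_iff, Ne, A.valuation.zero_iff]
  exact ht.ne_zero

lemma IsUniformizer.zpow_injective {t : F} (ht : IsUniformizer A t) {m m' : ℤ}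
    (h : A.valuation t ^ m = A.valuation t ^ m') : m = m' :=
  (zpow_right_strictAnti₀ ht.valuation_pos ht.lt_one).injective h

lemma IsUniformizer.zpow_lt_one {t : F} (ht : IsUniformizer A t) {m : ℤ} :
    A.valuation t ^ m < 1 ↔ 0 < m := by
  conv_lhs => rw [← zpow_zero (A.valuation t)]
  exact (zpow_right_strictAnti₀ ht.valuation_pos ht.lt_one).lt_iff_gt

lemma IsUniformizer.irreducible {t : F} (ht : IsUniformizer A t) :
    Irreducible (⟨t, (A.valuation_le_one_iff t).mp ht.lt_one.le⟩ : A) := by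
  constructor
  · rw [A.valuation_eq_one_iff]
    exact ht.lt_one.ne
  · intro a b hab
    have hab' : t = a * b := congrArg Subtype.val hab
    have ha : (a : F) ≠ 0 := by rintro h; exact ht.ne_zero (by rw [hab', h, zero_mul])
    have hb : (b : F) ≠ 0 := by rintro h; exact ht.ne_zero (by rw [hab', h, mul_zero])
    obtain ⟨i, hi⟩ := ht.exists_zpow _ ha
    obtain ⟨j, hj⟩ := ht.exists_zpow _ hb
    -- Two nonunit factors would have positive orders with sum 1.
    by_contra! hcon
    have h1 : A.valuation (a : F) < 1 := (A.valuation_lt_one_or_eq_one a).resolve_right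
      fun h => hcon.1 ((A.valuation_eq_one_iff a).mpr h)
    have h2 : A.valuation (b : F) < 1 := (A.valuation_lt_one_or_eq_one b).resolve_right
      fun h => hcon.2 ((A.valuation_eq_one_iff b).mpr h)
    rw [hi, ht.zpow_lt_one] at h1
    rw [hj, ht.zpow_lt_one] at h2
    have : (1 : ℤ) = i + j := by
      apply ht.zpow_injective
      rw [zpow_one, zpow_add₀ ht.valuation_pos.ne', ← hi, ← hj, ← map_mul, ← hab']
    omega

lemma IsUniformizer.hasOrder_iff {t f : F} (ht : IsUniformizer A t) {m : ℤ} :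
    HasOrder A f m ↔ A.valuation f = A.valuation t ^ m := by
  constructor
  · rintro ⟨s, hs, h⟩
    rw [h, valuation_eq_of_irreducible hs ht.irreducible]
  · intro h
    exact ⟨_, ht.irreducible, h⟩

lemma HasOrder.valuation_eq {f g : F} {m : ℤ} (hf : HasOrder A f m) (hg : HasOrder A g m) :
    A.valuation f = A.valuation g := by
  obtain ⟨s, hs, h⟩ := hf
  obtain ⟨t, ht, h'⟩ := hg
  rw [h, h', valuation_eq_of_irreducible hs ht]

lemma HasOrder.mul {f g : F} {m m' : ℤ} (hf : HasOrder A f m) (hg : HasOrder A g m') :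
    HasOrder A (f * g) (m + m') := by
  obtain ⟨s, hs, h⟩ := hf
  obtain ⟨t, ht, h'⟩ := hg
  refine ⟨s, hs, ?_⟩
  have hs0 : A.valuation (s : F) ≠ 0 := by
    rw [Ne, A.valuation.zero_iff]; simpa using hs.ne_zero
  rw [map_mul, h, h', valuation_eq_of_irreducible ht hs, zpow_add₀ hs0]

lemma HasOrder.inv {f : F} {m : ℤ} (hf : HasOrder A f m) : HasOrder A f⁻¹ (-m) := by
  obtain ⟨s, hs, h⟩ := hf
  exact ⟨s, hs, by rw [map_inv₀, h, zpow_neg]⟩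

lemma HasOrder.unique {f : F} {m m' : ℤ} (hf : HasOrder A f m) (hf' : HasOrder A f m') :
    m = m' := by
  obtain ⟨s, hs, h⟩ := hf
  obtain ⟨t, ht, h'⟩ := hf'
  rw [h, valuation_eq_of_irreducible hs ht] at h'
  have hs0 : 0 < A.valuation (t : F) := by
    rw [zero_lt_iff, Ne, A.valuation.zero_iff]; simpa using ht.ne_zero
  exact (zpow_right_strictAnti₀ hs0 ((A.valuation_lt_one_or_eq_one t).resolve_right
    fun h => ht.not_isUnit ((A.valuation_eq_one_iff t).mpr h))).injective h'

lemma HasOrder.ne_zero {f : F} {m : ℤ} (hf : HasOrder A f m) : f ≠ 0 := by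
  obtain ⟨s, hs, h⟩ := hf
  rw [← A.valuation.ne_zero_iff, h]
  apply zpow_ne_zero
  rw [A.valuation.ne_zero_iff]
  simpa using hs.ne_zero

lemma mem_comap_symm_iff {φ : F ≃+* F} {f : F} :
    φ f ∈ A.comap φ.symm.toRingHom ↔ f ∈ A := by
  rw [ValuationSubring.mem_comap]
  simp

lemma valuation_comap_le_iff {φ : F ≃+* F} {f g : F} :
    (A.comap φ.symm.toRingHom).valuation (φ f) ≤ (A.comap φ.symm.toRingHom).valuation (φ g) ↔
      A.valuation f ≤ A.valuation g := by
  rw [ValuationSubring.valuation_le_iff, ValuationSubring.valuation_le_iff]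
  constructor
  · rintro ⟨⟨a, ha⟩, h⟩
    refine ⟨⟨φ.symm a, ha⟩, φ.injective ?_⟩
    simpa using h
  · rintro ⟨⟨a, ha⟩, h⟩
    refine ⟨⟨φ a, mem_comap_symm_iff.mpr ha⟩, ?_⟩
    simp [← h]

lemma IsUniformizer.comap {t : F} (ht : IsUniformizer A t) (φ : F ≃+* F) :
    IsUniformizer (A.comap φ.symm.toRingHom) (φ t) := by
  have h1 : ∀ f g, A.valuation f = A.valuation g →
      (A.comap φ.symm.toRingHom).valuation (φ f) = (A.comap φ.symm.toRingHom).valuation (φ g) :=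
    fun f g h => le_antisymm (valuation_comap_le_iff.mpr h.le) (valuation_comap_le_iff.mpr h.ge)
  refine ⟨by simpa using ht.ne_zero, ?_, fun f hf => ?_⟩
  · have := ht.lt_one
    rw [← A.valuation.map_one, ← not_le] at this
    rw [← Valuation.map_one (A.comap φ.symm.toRingHom).valuation, ← not_le, ← map_one φ]
    rwa [valuation_comap_le_iff]
  · obtain ⟨m, hm⟩ := ht.exists_zpow (φ.symm f) (by simpa using hf)
    refine ⟨m, ?_⟩
    rw [← map_zpow₀] at hm ⊢
    simpa using h1 _ _ hm

end Orders

/-! ### Centers of valuation rings on a Dedekind domain -/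

section Center

variable {R F : Type*} [CommRing R] [Field F] [Algebra R F]

/-- The center on a Dedekind domain of a valuation ring that contains it. -/
def centerIdeal (A : ValuationSubring F) (hA : ∀ r : R, algebraMap R F r ∈ A) : Ideal R :=
  (IsLocalRing.maximalIdeal A).comap ((algebraMap R F).codRestrict A.toSubring hA)

lemma mem_centerIdeal {A : ValuationSubring F} {hA : ∀ r : R, algebraMap R F r ∈ A} {r : R} :
    r ∈ centerIdeal A hA ↔ A.valuation (algebraMap R F r) < 1 := by
  rw [centerIdeal, Ideal.mem_comap]
  exact (A.valuation_lt_one_iff _)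

end Center

/-! ### Valuation rings containing a Dedekind domain are its localizations at primes -/

section FinitePlaces

variable {R F : Type*} [CommRing R] [IsDedekindDomain R] [Field F] [Algebra R F]
  [IsFractionRing R F]

lemma eq_of_valuationSubring_le (v : HeightOneSpectrum R) {A : ValuationSubring F}
    (h : (v.valuation F).valuationSubring ≤ A) (hA : A ≠ ⊤) :
    A = (v.valuation F).valuationSubring := by
  rw [← HeightOneSpectrum.valuationSubringAtPrime_eq_valuationSubring] at h ⊢
  exact (ValuationSubring.eq_of_le_of_ne_top _ h hA).symm

lemma valuationSubring_le_of_forall (v : HeightOneSpectrum R) {A : ValuationSubring F}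
    (hA : ∀ r : R, algebraMap R F r ∈ A)
    (h : ∀ r : R, A.valuation (algebraMap R F r) < 1 → r ∈ v.asIdeal) :
    (v.valuation F).valuationSubring ≤ A := by
  intro f hf
  obtain ⟨n, d, hnd⟩ := v.exists_primeCompl_mul_eq_of_integer f hf
  have hd : A.valuation (algebraMap R F (d : R)) = 1 :=
    le_antisymm ((A.valuation_le_one_iff _).mpr (hA _))
      (not_lt.mp fun h' => d.2 (h _ h'))
  rw [← A.valuation_le_one_iff]
  calc A.valuation f = A.valuation (f * algebraMap R F (d : R)) := by rw [map_mul, hd, mul_one]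
    _ ≤ 1 := by rw [hnd]; exact (A.valuation_le_one_iff _).mpr (hA _)

/-- If the center were zero, all nonzero elements of R would be units of A and A would be F.
Otherwise A contains the localization at the center, and a discrete valuation ring is maximal among
proper subrings that are valuation rings. -/
lemma exists_heightOneSpectrum {A : ValuationSubring F} (hA : ∀ r : R, algebraMap R F r ∈ A)
    (htop : A ≠ ⊤) : ∃ v : HeightOneSpectrum R, A = (v.valuation F).valuationSubring ∧
      ∀ r, r ∈ v.asIdeal ↔ A.valuation (algebraMap R F r) < 1 := by
  have hp : (centerIdeal A hA).IsPrime := by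
    rw [centerIdeal]; exact Ideal.comap_isPrime _ _
  have h0 : centerIdeal A hA ≠ ⊥ := by
    intro h
    apply htop
    rw [eq_top_iff]
    intro f _
    obtain ⟨r, s, hs, rfl⟩ := IsFractionRing.div_surjective (A := R) f
    have hs1 : A.valuation (algebraMap R F s) = 1 := by
      refine le_antisymm ((A.valuation_le_one_iff _).mpr (hA _)) (not_lt.mp fun h' => ?_)
      have : s ∈ centerIdeal A hA := mem_centerIdeal.mpr h'
      rw [h] at this
      exact nonZeroDivisors.ne_zero hs this
    rw [← A.valuation_le_one_iff, map_div₀, hs1, div_one]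
    exact (A.valuation_le_one_iff _).mpr (hA _)
  refine ⟨⟨centerIdeal A hA, hp, h0⟩, ?_, fun r => mem_centerIdeal⟩
  exact eq_of_valuationSubring_le _ (valuationSubring_le_of_forall _ hA
    fun r hr => mem_centerIdeal.mpr hr) htop

lemma valuationSubring_valuation_eq_iff (v : HeightOneSpectrum R) (f g : F) :
    (v.valuation F).valuationSubring.valuation f = (v.valuation F).valuationSubring.valuation g ↔
      v.valuation F f = v.valuation F g :=
  ((v.valuation F).isEquiv_valuation_valuationSubring.eq_iff).symm

lemma exists_isUniformizer (v : HeightOneSpectrum R) :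
    ∃ t, v.valuation F t = WithZero.exp (-1 : ℤ) ∧
      IsUniformizer (v.valuation F).valuationSubring t := by
  obtain ⟨t, ht⟩ := v.valuation_exists_uniformizer F
  have ht0 : t ≠ 0 := by
    rintro rfl
    rw [map_zero] at ht
    exact WithZero.exp_ne_zero ht.symm
  refine ⟨t, ht, ht0, ?_, fun f hf => ?_⟩
  · rw [← map_one (Valuation.valuationSubring _).valuation]
    rw [← (v.valuation F).isEquiv_valuation_valuationSubring.lt_iff_lt, ht, map_one,
      ← WithZero.exp_zero, WithZero.exp_lt_exp]
    decide
  · refine ⟨-WithZero.log (v.valuation F f), ?_⟩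
    rw [← map_zpow₀, valuationSubring_valuation_eq_iff, map_zpow₀, ht, ← WithZero.exp_zsmul]
    rw [smul_neg, smul_eq_mul, mul_one, neg_neg, WithZero.exp_log]
    simpa using hf

/-- The sign appears because a uniformizer has adic valuation `exp (-1)`. -/
lemma hasOrder_valuationSubring_iff (v : HeightOneSpectrum R) {f : F} {m : ℤ} :
    HasOrder (v.valuation F).valuationSubring f m ↔ v.valuation F f = WithZero.exp (-m) := by
  obtain ⟨t, ht, hu⟩ := exists_isUniformizer (F := F) v
  rw [hu.hasOrder_iff, ← map_zpow₀, valuationSubring_valuation_eq_iff, map_zpow₀, ht,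
    ← WithZero.exp_zsmul, smul_neg, smul_eq_mul, mul_one]

end FinitePlaces

/-! ### Degrees of ideals of the coordinate ring -/

section Degree

variable {k : Type*} [Field k] {V : Affine k}

lemma finite_quotient {I : Ideal V.CoordinateRing} (hI : I ≠ ⊥) :
    Module.Finite k (V.CoordinateRing ⧸ I) :=
  Module.Finite.equiv
    (Ideal.quotientEquivDirectSum k (Affine.CoordinateRing.basis V) hI).symm

/-- In the exact sequence 0 → I/pI → R/pI → R/I → 0 the kernel is one-dimensional over R/p:
multiplication by any a in I outside pI identifies R/p with I/pI. -/
lemma finrank_quotient_prime_mul [V.IsElliptic] {I p : Ideal V.CoordinateRing} (hI : I ≠ ⊥)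
    (hp : Prime p) : Module.finrank k (V.CoordinateRing ⧸ (p * I)) =
      Module.finrank k (V.CoordinateRing ⧸ p) + Module.finrank k (V.CoordinateRing ⧸ I) := by
  have hpp : p.IsPrime := Ideal.isPrime_of_prime hp
  have hmax : p.IsMaximal := hpp.isMaximal hp.ne_zero
  have hle : p * I ≤ I := Ideal.mul_le_right
  have hpI : p * I ≠ ⊥ := mul_ne_zero hp.ne_zero hI
  obtain ⟨a, haI, ha⟩ : ∃ a ∈ I, a ∉ p * I := by
    by_contra! h
    have : p * I = I := le_antisymm hle h
    exact hp.not_isUnit (by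
      rw [mul_eq_right₀ hI] at this
      rw [this]; exact isUnit_one)
  -- No ideal lies strictly between pI and I: such an ideal is IJ with J containing the maximal
  -- ideal p.
  have hsup : Ideal.span {a} ⊔ p * I = I := by
    have hJ : Ideal.span {a} ⊔ p * I ≤ I :=
      sup_le ((Ideal.span_singleton_le_iff_mem _).mpr haI) hle
    obtain ⟨J, hJ'⟩ := Ideal.dvd_iff_le.mpr hJ
    have hpJ : p ≤ J := by
      have : I * J ∣ I * p := by
        rw [← hJ', mul_comm I p]
        exact Ideal.dvd_iff_le.mpr le_sup_right
      exact Ideal.dvd_iff_le.mp ((mul_dvd_mul_iff_left hI).mp this)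
    by_cases h : J = ⊤
    · rw [hJ', h, Ideal.mul_top]
    · replace h := (hmax.eq_of_le h hpJ).symm
      exfalso
      apply ha
      rw [mul_comm, ← h, ← hJ']
      exact Ideal.mem_sup_left (Ideal.mem_span_singleton_self a)
  have := finite_quotient hpI
  let g : (V.CoordinateRing ⧸ (p * I)) →ₗ[k] (V.CoordinateRing ⧸ I) :=
    (Ideal.Quotient.factorₐ k hle).toLinearMap
  have hg : Function.Surjective g := Ideal.Quotient.factor_surjective hle
  let h0 : V.CoordinateRing →ₗ[k] (V.CoordinateRing ⧸ (p * I)) :=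
    (Ideal.Quotient.mkₐ k (p * I)).toLinearMap ∘ₗ LinearMap.mulRight k a
  have h0_apply : ∀ r, h0 r = Ideal.Quotient.mk (p * I) (r * a) := fun r => rfl
  have hker : LinearMap.ker h0 = p.restrictScalars k := by
    ext r
    rw [LinearMap.mem_ker, h0_apply, Ideal.Quotient.eq_zero_iff_mem, Submodule.restrictScalars_mem]
    constructor
    · intro hr
      by_contra hrp
      obtain ⟨u, i, hi, hu⟩ := hmax.exists_inv hrp
      apply ha
      have : a = u * (r * a) + i * a := by rw [← mul_assoc, ← add_mul, hu, one_mul]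
      rw [this]
      exact add_mem (Ideal.mul_mem_left _ _ hr) (Ideal.mul_mem_mul hi haI)
    · exact fun hr => Ideal.mul_mem_mul hr haI
  have hrange : LinearMap.range h0 = LinearMap.ker g := by
    ext z
    obtain ⟨z, rfl⟩ := Ideal.Quotient.mk_surjective z
    rw [LinearMap.mem_ker]
    change _ ↔ Ideal.Quotient.mk I z = 0
    rw [Ideal.Quotient.eq_zero_iff_mem]
    constructor
    · rintro ⟨r, hr⟩
      rw [h0_apply, Ideal.Quotient.eq] at hr
      have := sub_mem (Ideal.mul_mem_left I r haI) (hle hr)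
      simpa using this
    · intro hz
      rw [← hsup] at hz
      obtain ⟨y, hy, w, hw, rfl⟩ := Submodule.mem_sup.mp hz
      obtain ⟨r, rfl⟩ := Ideal.mem_span_singleton'.mp hy
      refine ⟨r, ?_⟩
      rw [h0_apply, Ideal.Quotient.eq]
      simpa using hw
  have e1 := LinearMap.finrank_range_add_finrank_ker g
  rw [LinearMap.range_eq_top.mpr hg, finrank_top, ← hrange] at e1
  have e2 : Module.finrank k (LinearMap.range h0) = Module.finrank k (V.CoordinateRing ⧸ p) := by
    rw [← (LinearMap.quotKerEquivRange h0).finrank_eq, hker]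
    rfl
  omega

/-- The degree of a closed point of the affine curve. -/
noncomputable def pointDegree [V.IsElliptic] (v : HeightOneSpectrum V.CoordinateRing) : ℕ :=
  Module.finrank k (V.CoordinateRing ⧸ v.asIdeal)

-- Multiplicities outside the support vanish. Allowing any finite S that contains the support lets
-- the sums for p and I in the induction step run over a common set.
open scoped Classical in
lemma finrank_quotient_eq_sum_count [V.IsElliptic] (I : Ideal V.CoordinateRing) :
    I ≠ ⊥ → ∀ S : Finset (HeightOneSpectrum V.CoordinateRing),
    (∀ v : HeightOneSpectrum V.CoordinateRing,
      (Associates.mk v.asIdeal).count (Associates.mk I).factors ≠ 0 → v ∈ S) →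
    Module.finrank k (V.CoordinateRing ⧸ I) =
      ∑ v ∈ S, pointDegree v * (Associates.mk v.asIdeal).count (Associates.mk I).factors := by
  induction I using UniqueFactorizationMonoid.induction_on_prime with
  | h₁ => exact fun h => absurd rfl h
  | h₂ I hI =>
    intro _ S hS
    have hI' : I = ⊤ := Ideal.isUnit_iff.mp hI
    subst hI'
    have hsub : Subsingleton (V.CoordinateRing ⧸ (⊤ : Ideal V.CoordinateRing)) :=
      Ideal.Quotient.subsingleton_iff.mpr rfl
    have h1 : (Associates.mk (⊤ : Ideal V.CoordinateRing)) = 1 := Associates.mk_eq_one.mpr hI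
    rw [Module.finrank_zero_of_subsingleton, h1, Associates.factors_one]
    symm
    apply Finset.sum_eq_zero
    intro v _
    rw [Associates.count_zero (Associates.irreducible_mk.mpr v.irreducible), mul_zero]
  | h₃ I p hI hp ih =>
    intro hpI S hS
    have hc : ∀ v : HeightOneSpectrum V.CoordinateRing,
        (Associates.mk v.asIdeal).count (Associates.mk (p * I)).factors =
        (Associates.mk v.asIdeal).count (Associates.mk p).factors +
        (Associates.mk v.asIdeal).count (Associates.mk I).factors := fun v => by
      rw [← Associates.mk_mul_mk]
      exact Associates.count_mul (Associates.mk_ne_zero.mpr hp.ne_zero)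
        (Associates.mk_ne_zero.mpr hI) (Associates.irreducible_mk.mpr v.irreducible)
    let w : HeightOneSpectrum V.CoordinateRing := ⟨p, Ideal.isPrime_of_prime hp, hp.ne_zero⟩
    have hpi : Irreducible (Associates.mk p) := Associates.irreducible_mk.mpr hp.irreducible
    have hw1 : (Associates.mk p).count (Associates.mk p).factors = 1 :=
      Associates.count_self hpi
    have hwS : w ∈ S := hS w (by rw [hc]; change (Associates.mk p).count _ + _ ≠ 0; omega)
    have hw : ∀ v ∈ S, pointDegree v * (Associates.mk v.asIdeal).count (Associates.mk p).factors =
        if v = w then pointDegree w else 0 := by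
      intro v _
      split_ifs with h
      · subst h
        change _ * (Associates.mk p).count _ = _
        rw [hw1, mul_one]
      · rw [Associates.count_eq_zero_of_ne (Associates.irreducible_mk.mpr v.irreducible) hpi,
          mul_zero]
        intro h'
        apply h
        ext1
        exact associated_iff_eq.mp (Associates.mk_eq_mk_iff_associated.mp h')
    rw [finrank_quotient_prime_mul hI hp, ih hI S fun v hv => hS v (by rw [hc]; omega)]
    simp only [hc, mul_add, Finset.sum_add_distrib]
    rw [Finset.sum_congr rfl hw, Finset.sum_ite_eq' S w, if_pos hwS]
    rfl

/-- The degree of the divisor of zeros of a regular function. -/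
lemma natDegree_norm_eq_sum [V.IsElliptic] {F : Type*} [Field F] [Algebra V.CoordinateRing F]
    [IsFractionRing V.CoordinateRing F] {r : V.CoordinateRing} (hr : r ≠ 0)
    (S : Finset (HeightOneSpectrum V.CoordinateRing))
    (hS : ∀ v : HeightOneSpectrum V.CoordinateRing,
      v.valuation F (algebraMap _ F r) ≠ 1 → v ∈ S) :
    ((Algebra.norm k[X] r).natDegree : ℤ) =
      ∑ v ∈ S, (pointDegree v : ℤ) * -WithZero.log (v.valuation F (algebraMap _ F r)) := by
  classical
  have hv : ∀ v : HeightOneSpectrum V.CoordinateRing, v.valuation F (algebraMap _ F r) =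
      WithZero.exp (-((Associates.mk v.asIdeal).count
        (Associates.mk (Ideal.span {r})).factors : ℤ)) := fun v => by
    rw [v.valuation_of_algebraMap, v.intValuation_if_neg hr]
  -- Both sides are the dimension over k of the quotient by (r).
  rw [← finrank_quotient_span_eq_natDegree_norm (Affine.CoordinateRing.basis V) hr,
    finrank_quotient_eq_sum_count _ (by simpa using hr) S]
  · push_cast
    refine Finset.sum_congr rfl fun v _ => ?_
    rw [hv, WithZero.log_exp, neg_neg]
  · intro v hv'
    apply hS
    rw [hv, ← WithZero.exp_zero, Ne, WithZero.exp_inj]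
    omega

lemma XYIdeal_ne_bot {a : k} {y : k[X]} : Affine.CoordinateRing.XYIdeal V a y ≠ ⊥ := by
  intro h
  have : Affine.CoordinateRing.XClass V a ∈ Affine.CoordinateRing.XYIdeal V a y :=
    Ideal.subset_span (by simp)
  rw [h] at this
  exact Affine.CoordinateRing.XClass_ne_zero a this

lemma finrank_quotient_XYIdeal {a b : k} (h : V.Nonsingular a b) :
    Module.finrank k (V.CoordinateRing ⧸ Affine.CoordinateRing.XYIdeal V a (C b)) = 1 := by
  have h1 : (V.polynomial.eval (C b)).eval a = 0 := h.1
  rw [(Affine.CoordinateRing.quotientXYIdealEquiv h1).toLinearEquiv.finrank_eq,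
    Module.finrank_self]

lemma XYIdeal_isMaximal {a b : k} (h : V.Nonsingular a b) :
    (Affine.CoordinateRing.XYIdeal V a (C b)).IsMaximal :=
  Ideal.Quotient.maximal_of_isField _ <|
    (Affine.CoordinateRing.quotientXYIdealEquiv (y := C b)
      h.1).toRingEquiv.toMulEquiv.isField (Field.toIsField k)

/-- The closed point of the affine curve given by a rational point. -/
noncomputable def ratPoint [V.IsElliptic] {a b : k} (h : V.Nonsingular a b) :
    HeightOneSpectrum V.CoordinateRing :=
  ⟨Affine.CoordinateRing.XYIdeal V a (C b), (XYIdeal_isMaximal h).isPrime, XYIdeal_ne_bot⟩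

lemma pointDegree_ratPoint [V.IsElliptic] {a b : k} (h : V.Nonsingular a b) :
    pointDegree (ratPoint h) = 1 :=
  finrank_quotient_XYIdeal h

lemma finrank_quotient_XYIdeal_pow [V.IsElliptic] {a b : k} (h : V.Nonsingular a b) (n : ℕ) :
    Module.finrank k (V.CoordinateRing ⧸ (Affine.CoordinateRing.XYIdeal V a (C b)) ^ n) = n := by
  induction n with
  | zero =>
    have hsub : Subsingleton (V.CoordinateRing ⧸
        (Affine.CoordinateRing.XYIdeal V a (C b)) ^ 0) :=
      Ideal.Quotient.subsingleton_iff.mpr (by rw [pow_zero, Ideal.one_eq_top])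
    exact Module.finrank_zero_of_subsingleton
  | succ n ih =>
    rw [pow_succ', finrank_quotient_prime_mul (pow_ne_zero n XYIdeal_ne_bot)
      (show Prime (Affine.CoordinateRing.XYIdeal V a (C b)) from (ratPoint h).prime), ih,
      finrank_quotient_XYIdeal h, add_comm]

end Degree

/-! ### The behaviour of regular functions at infinity -/

section Infinity

variable {k : Type*} [Field k] {V : Affine k} {F : Type*} [Field F] [Algebra V.CoordinateRing F]

variable (V F) in
/-- The coordinate function `x`. -/
noncomputable abbrev coordX : F := algebraMap V.CoordinateRing F (Affine.CoordinateRing.mk V (C X))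

variable (V F) in
/-- The coordinate function `y`. -/
noncomputable abbrev coordY : F := algebraMap V.CoordinateRing F (Affine.CoordinateRing.mk V X)

variable [Algebra k F] [IsScalarTower k V.CoordinateRing F]

lemma algebraMap_mk_C (p : k[X]) :
    algebraMap V.CoordinateRing F (Affine.CoordinateRing.mk V (C p)) = aeval (coordX V F) p := by
  induction p using Polynomial.induction_on' with
  | add p q hp hq => simp only [map_add, hp, hq]
  | monomial m a =>
    rw [← C_mul_X_pow_eq_monomial, map_mul, map_mul, map_mul, map_mul, aeval_C, map_pow, map_pow,
      map_pow, map_pow, aeval_X]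
    congr 1
    exact (IsScalarTower.algebraMap_apply k V.CoordinateRing F a).symm

lemma algebraMap_smul_basis (p q : k[X]) : algebraMap V.CoordinateRing F
    (p • (1 : V.CoordinateRing) + q • Affine.CoordinateRing.mk V X) =
      aeval (coordX V F) p + aeval (coordX V F) q * coordY V F := by
  simp only [Affine.CoordinateRing.smul, mul_one, map_add, map_mul]
  rw [algebraMap_mk_C p, algebraMap_mk_C q]

variable (V F) in
lemma coord_equation : coordY V F ^ 2 + algebraMap k F V.a₁ * coordX V F * coordY V F
    + algebraMap k F V.a₃ * coordY V F = coordX V F ^ 3 + algebraMap k F V.a₂ * coordX V F ^ 2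
      + algebraMap k F V.a₄ * coordX V F + algebraMap k F V.a₆ := by
  have := congrArg (algebraMap V.CoordinateRing F) (mk_relation V)
  simp only [map_add, map_sub, map_mul, map_pow, map_zero] at this
  have hC : ∀ a : k, algebraMap V.CoordinateRing F (Affine.CoordinateRing.mk V (C (C a))) =
      algebraMap k F a := fun a => (IsScalarTower.algebraMap_apply k V.CoordinateRing F a).symm
  simp only [hC] at this
  linear_combination this

lemma isTrivialOn (A : Place k F) : A.ring.valuation.IsTrivialOn k := by
  refine ⟨fun a ha => le_antisymm ((A.ring.valuation_le_one_iff _).mpr (A.algebraMap_mem a)) ?_⟩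
  have h := (A.ring.valuation_le_one_iff _).mpr (A.algebraMap_mem a⁻¹)
  rw [map_inv₀, map_inv₀] at h
  exact (inv_le_one₀ (by
    rw [zero_lt_iff, Ne, Valuation.zero_iff, map_eq_zero]; exact ha)).mp h

lemma valuation_algebraMap_le (A : Place k F) (a : k) :
    A.ring.valuation (algebraMap k F a) ≤ 1 :=
  (A.ring.valuation_le_one_iff _).mpr (A.algebraMap_mem a)

/-- The Weierstrass equation makes y integral over k[x]: a pole of y would give v(y)² ≤ v(y) with
v(y) > 1. A place is therefore either centered on the affine curve or has a pole of x. -/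
lemma coordY_mem (A : Place k F) (hx : coordX V F ∈ A.ring) : coordY V F ∈ A.ring := by
  by_contra hy
  rw [← A.ring.valuation_le_one_iff, not_le] at hy
  rw [← A.ring.valuation_le_one_iff] at hx
  have hm : ∀ a, algebraMap k F a ∈ A.ring := A.algebraMap_mem
  have e : coordY V F ^ 2 = (coordX V F ^ 3 + algebraMap k F V.a₂ * coordX V F ^ 2
      + algebraMap k F V.a₄ * coordX V F + algebraMap k F V.a₆)
      - (algebraMap k F V.a₁ * coordX V F + algebraMap k F V.a₃) * coordY V F := by
    linear_combination coord_equation V F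
  rw [A.ring.valuation_le_one_iff] at hx
  have h1 : A.ring.valuation (coordX V F ^ 3 + algebraMap k F V.a₂ * coordX V F ^ 2
      + algebraMap k F V.a₄ * coordX V F + algebraMap k F V.a₆) ≤ 1 := by
    rw [A.ring.valuation_le_one_iff]
    exact add_mem (add_mem (add_mem (pow_mem hx 3) (mul_mem (hm _) (pow_mem hx 2)))
      (mul_mem (hm _) hx)) (hm _)
  have h2 : A.ring.valuation (algebraMap k F V.a₁ * coordX V F + algebraMap k F V.a₃) ≤ 1 := by
    rw [A.ring.valuation_le_one_iff]
    exact add_mem (mul_mem (hm _) hx) (hm _)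
  have h3 : A.ring.valuation (coordY V F ^ 2) ≤ A.ring.valuation (coordY V F) := by
    rw [e]
    refine (Valuation.map_sub _ _ _).trans (max_le (h1.trans hy.le) ?_)
    rw [map_mul]
    exact mul_le_of_le_one_left' h2
  rw [map_pow] at h3
  have h4 : A.ring.valuation (coordY V F) < A.ring.valuation (coordY V F) ^ 2 := by
    rw [pow_two]
    exact lt_mul_of_one_lt_left (zero_lt_one.trans hy) hy
  exact absurd h3 (not_le.mpr h4)

lemma algebraMap_mem_of_coordX_mem (A : Place k F) (hx : coordX V F ∈ A.ring)
    (r : V.CoordinateRing) : algebraMap V.CoordinateRing F r ∈ A.ring := by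
  have hp : ∀ p : k[X], aeval (coordX V F) p ∈ A.ring := fun p => by
    rw [aeval_eq_sum_range]
    refine sum_mem fun i _ => ?_
    rw [Algebra.smul_def]
    exact mul_mem (A.algebraMap_mem _) (pow_mem hx _)
  obtain ⟨p, q, rfl⟩ := Affine.CoordinateRing.exists_smul_basis_eq r
  rw [algebraMap_smul_basis]
  exact add_mem (hp p) (mul_mem (hp q) (coordY_mem A hx))

/-- At infinity, `y` has a pole of order `3` and `x` has a pole of order `2`. -/
lemma valuation_coord_of_notMem (A : Place k F) (hx : coordX V F ∉ A.ring) :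
    1 < A.ring.valuation (coordX V F) ∧
      A.ring.valuation (coordY V F) ^ 2 = A.ring.valuation (coordX V F) ^ 3 := by
  rw [← A.ring.valuation_le_one_iff, not_le] at hx
  refine ⟨hx, ?_⟩
  have ht := isTrivialOn A
  set v := A.ring.valuation
  have hx0 : 0 < v (coordX V F) := zero_lt_one.trans hx
  have h3 : v (coordX V F ^ 3 + algebraMap k F V.a₂ * coordX V F ^ 2
      + algebraMap k F V.a₄ * coordX V F + algebraMap k F V.a₆) = v (coordX V F) ^ 3 := by
    have hd : (C (1 : k) * X ^ 3 + C V.a₂ * X ^ 2 + C V.a₄ * X + C V.a₆).natDegree = 3 :=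
      natDegree_cubic one_ne_zero
    have h0 : (C (1 : k) * X ^ 3 + C V.a₂ * X ^ 2 + C V.a₄ * X + C V.a₆) ≠ 0 := by
      intro h; rw [h] at hd; simp at hd
    have := valuation_aeval_eq_valuation_X_pow_natDegree_of_one_lt_valuation_X (v := v)
      (coordX V F) hx h0
    rw [hd] at this
    rw [← this]
    congr 1
    simp
  rw [← coord_equation V F] at h3
  have hle : ∀ a, v (algebraMap k F a) ≤ 1 := valuation_algebraMap_le A
  have h4 : v (algebraMap k F V.a₁ * coordX V F + algebraMap k F V.a₃) ≤ v (coordX V F) := by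
    refine (Valuation.map_add _ _ _).trans (max_le ?_ ((hle _).trans hx.le))
    rw [map_mul]
    exact mul_le_of_le_one_left' (hle _)
  -- If v(y) ≤ v(x), the left side of the Weierstrass equation has valuation at most v(x)², whereas
  -- the right side has valuation v(x)³.
  have h5 : v (coordX V F) < v (coordY V F) := by
    by_contra! h
    have : v (coordX V F) ^ 3 ≤ v (coordX V F) ^ 2 := by
      rw [← h3, add_assoc, ← add_mul]
      refine (Valuation.map_add _ _ _).trans (max_le ?_ ?_)
      · rw [map_pow]; exact pow_le_pow_left₀ zero_le h 2
      · rw [map_mul, pow_two]; exact mul_le_mul' h4 h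
    exact absurd this (not_le.mpr (pow_lt_pow_right₀ hx (by norm_num)))
  rw [← h3, add_assoc, ← add_mul, Valuation.map_add_eq_of_lt_left, map_pow]
  rw [map_mul, map_pow, pow_two]
  exact (mul_le_mul_left h4 _).trans_lt (mul_lt_mul_of_pos_right h5 (hx0.trans h5))

/-- In p(x) + q(x)y the two terms have pole orders 2 deg p and 2 deg q + 3. These have different
parity, so nothing cancels, and the larger one is the degree of the norm. -/
lemma valuation_of_notMem (A : Place k F) (hx : coordX V F ∉ A.ring) {r : V.CoordinateRing}
    (hr : r ≠ 0) : A.ring.valuation (algebraMap V.CoordinateRing F r) =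
      A.ring.valuation (coordX V F / coordY V F) ^ (-((Algebra.norm k[X] r).natDegree : ℤ)) := by
  obtain ⟨hx1, hxy⟩ := valuation_coord_of_notMem A hx
  have ht := isTrivialOn A
  set v := A.ring.valuation
  have hx0 : 0 < v (coordX V F) := zero_lt_one.trans hx1
  have hy0 : v (coordY V F) ≠ 0 := by
    intro h
    rw [h, zero_pow two_ne_zero] at hxy
    exact pow_ne_zero 3 hx0.ne' hxy.symm
  set s := v (coordX V F / coordY V F) with hs
  have hs' : s = v (coordX V F) / v (coordY V F) := map_div₀ _ _ _
  have hs0 : s ≠ 0 := by rw [hs']; exact div_ne_zero hx0.ne' hy0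
  have hX : v (coordX V F) = s⁻¹ ^ 2 := by
    rw [hs', inv_div, div_pow, hxy, pow_succ _ 2, mul_div_cancel_left₀ _ (pow_ne_zero 2 hx0.ne')]
  have hY : v (coordY V F) = s⁻¹ ^ 3 := by
    rw [pow_succ, ← hX, hs', inv_div, mul_div_cancel₀ _ hx0.ne']
  have hs1 : 1 < s⁻¹ := by
    by_contra! h
    rw [hX] at hx1
    exact absurd hx1 (not_lt.mpr (pow_le_one₀ zero_le h))
  have hp : ∀ p : k[X], p ≠ 0 → v (aeval (coordX V F) p) = s⁻¹ ^ (2 * p.natDegree) := by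
    intro p hp0
    rw [valuation_aeval_eq_valuation_X_pow_natDegree_of_one_lt_valuation_X (v := v) _ hx1 hp0, hX,
      pow_mul]
  have hq : ∀ q : k[X], q ≠ 0 →
      v (aeval (coordX V F) q * coordY V F) = s⁻¹ ^ (2 * q.natDegree + 3) := by
    intro q hq0
    rw [map_mul, hp q hq0, hY, pow_add]
  rw [zpow_neg, ← inv_zpow, zpow_natCast]
  obtain ⟨p, q, rfl⟩ := Affine.CoordinateRing.exists_smul_basis_eq r
  rw [algebraMap_smul_basis]
  have hdeg := Affine.CoordinateRing.degree_norm_smul_basis (W' := V) p q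
  by_cases hp0 : p = 0
  · have hq0 : q ≠ 0 := by rintro rfl; simp [hp0] at hr
    subst hp0
    rw [map_zero, zero_add, hq q hq0]
    congr 1
    symm
    apply natDegree_eq_of_degree_eq_some
    rw [hdeg, degree_eq_natDegree hq0]
    simp [two_mul]
  by_cases hq0 : q = 0
  · subst hq0
    rw [map_zero, zero_mul, add_zero, hp p hp0]
    congr 1
    symm
    apply natDegree_eq_of_degree_eq_some
    rw [hdeg, degree_eq_natDegree hp0]
    simp [two_mul]
  have hdeg' : (Algebra.norm k[X] (p • (1 : V.CoordinateRing) +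
      q • Affine.CoordinateRing.mk V X)).natDegree =
        max (2 * p.natDegree) (2 * q.natDegree + 3) := by
    apply natDegree_eq_of_degree_eq_some
    rw [hdeg, degree_eq_natDegree hp0, degree_eq_natDegree hq0]
    rw [two_nsmul, two_nsmul, two_mul, two_mul]
    exact (Nat.mono_cast.map_max).symm
  rw [hdeg']
  rcases lt_or_gt_of_ne (show 2 * p.natDegree ≠ 2 * q.natDegree + 3 by omega) with h | h
  · rw [max_eq_right h.le, Valuation.map_add_eq_of_lt_right, hq q hq0]
    rw [hq q hq0, hp p hp0]
    exact pow_lt_pow_right₀ hs1 h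
  · rw [max_eq_left h.le, Valuation.map_add_eq_of_lt_left, hp p hp0]
    rw [hq q hq0, hp p hp0]
    exact pow_lt_pow_right₀ hs1 h

end Infinity

lemma Place.ext' {k F : Type*} [Field k] [Field F] [Algebra k F] {A B : Place k F}
    (h : A.ring = B.ring) : A = B := by
  cases A; cases B; cases h; rfl

/-! ### Classification of the places of the function field -/

section Places

variable {k : Type*} [Field k] {V : Affine k} {F : Type*} [Field F] [Algebra V.CoordinateRing F]
  [IsFractionRing V.CoordinateRing F] [Algebra k F] [IsScalarTower k V.CoordinateRing F]

/-- The order of x/y is 3 - 2 = 1. Every nonzero function is a quotient of regular functions, to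
which `valuation_of_notMem` applies. -/
lemma isUniformizer_of_notMem (A : Place k F) (hx : coordX V F ∉ A.ring) :
    IsUniformizer A.ring (coordX V F / coordY V F) := by
  have hx1 := (valuation_coord_of_notMem A hx).1
  have hX0 : Affine.CoordinateRing.mk V (C X) ≠ 0 := by
    intro h; apply hx; rw [coordX, h, map_zero]; exact zero_mem _
  have hv := valuation_of_notMem A hx hX0
  have hy0 : coordY V F ≠ 0 := by
    intro h
    have := (valuation_coord_of_notMem A hx).2
    rw [h, map_zero, zero_pow two_ne_zero] at this
    exact pow_ne_zero 3 (zero_lt_one.trans hx1).ne' this.symm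
  have hx0 : coordX V F ≠ 0 := by
    intro h; apply hx; rw [h]; exact zero_mem _
  refine ⟨div_ne_zero hx0 hy0, ?_, fun f hf => ?_⟩
  · by_contra! h
    rw [hv, zpow_neg, zpow_natCast] at hx1
    exact absurd hx1 (not_lt.mpr (inv_le_one_of_one_le₀ (one_le_pow₀ h)))
  · obtain ⟨r, s, hs, rfl⟩ := IsFractionRing.div_surjective (A := V.CoordinateRing) f
    have hs0 : s ≠ 0 := nonZeroDivisors.ne_zero hs
    have hr0 : r ≠ 0 := by rintro rfl; simp at hf
    have ht0 : A.ring.valuation (coordX V F / coordY V F) ≠ 0 := by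
      rw [Valuation.ne_zero_iff]; exact div_ne_zero hx0 hy0
    rw [map_div₀, valuation_of_notMem A hx hr0, valuation_of_notMem A hx hs0, ← zpow_sub₀ ht0]
    exact ⟨_, rfl⟩

lemma hasOrder_of_notMem (A : Place k F) (hx : coordX V F ∉ A.ring) {r : V.CoordinateRing}
    (hr : r ≠ 0) : HasOrder A.ring (algebraMap V.CoordinateRing F r)
      (-((Algebra.norm k[X] r).natDegree : ℤ)) := by
  rw [(isUniformizer_of_notMem A hx).hasOrder_iff]
  exact valuation_of_notMem A hx hr

/-- Whether r/s lies in the valuation ring is decided by the degrees of the norms of r and s, which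
do not involve the place. -/
lemma place_infinity_unique (A B : Place k F) (hA : coordX V F ∉ A.ring)
    (hB : coordX V F ∉ B.ring) : A = B := by
  have key : ∀ (A : Place k F) (_ : coordX V F ∉ A.ring) (r s : V.CoordinateRing), r ≠ 0 → s ≠ 0 →
      (algebraMap _ F r / algebraMap _ F s ∈ A.ring ↔
        (Algebra.norm k[X] r).natDegree ≤ (Algebra.norm k[X] s).natDegree) := by
    intro A hA r s hr hs
    have hu := isUniformizer_of_notMem A hA
    rw [← A.ring.valuation_le_one_iff, map_div₀, valuation_of_notMem A hA hr,
      valuation_of_notMem A hA hs, ← zpow_sub₀ hu.valuation_pos.ne', ← not_lt,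
      ← inv_lt_one₀ (zpow_pos hu.valuation_pos _), ← zpow_neg, hu.zpow_lt_one]
    omega
  apply Place.ext'
  ext f
  obtain ⟨r, s, hs, rfl⟩ := IsFractionRing.div_surjective (A := V.CoordinateRing) f
  have hs0 : s ≠ 0 := nonZeroDivisors.ne_zero hs
  by_cases hr0 : r = 0
  · simp only [hr0, map_zero, zero_div, zero_mem]
  · rw [key A hA r s hr0 hs0, key B hB r s hr0 hs0]

variable (V F) in
lemma transcendental_coordX : Transcendental k (coordX V F) := by
  rintro ⟨p, hp, h⟩
  rw [← algebraMap_mk_C, map_eq_zero_iff _ (IsFractionRing.injective V.CoordinateRing F)] at h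
  apply hp
  have : Function.Injective (algebraMap k[X] V.CoordinateRing) :=
    FaithfulSMul.algebraMap_injective _ _
  exact (map_eq_zero_iff _ this).mp h

-- The valuation rings containing k intersect in the integral closure of k. Since x is
-- transcendental, one of them omits x.
variable (V F) in
lemma exists_place_infinity : ∃ A : Place k F, coordX V F ∉ A.ring := by
  have hnot : ¬ IsIntegral (Subring.closure (Set.range (algebraMap k F))) (coordX V F) := by
    intro h
    apply transcendental_coordX V F
    have hle : Subring.closure (Set.range (algebraMap k F)) ≤ (algebraMap k F).range :=
      Subring.closure_le.mpr (by simp)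
    let φ : Subring.closure (Set.range (algebraMap k F)) →+* k :=
      ((algebraMap k F).rangeRestrictFieldEquiv.symm : (algebraMap k F).fieldRange →+* k).comp
        (Subring.inclusion (S := Subring.closure (Set.range (algebraMap k F)))
          (T := (algebraMap k F).fieldRange.toSubring) hle)
    have hI : IsIntegral k (coordX V F) := by
      refine h.map_of_comp_eq φ (RingHom.id F) ?_
      ext z
      obtain ⟨c, hc⟩ := hle z.2
      have hz : (Subring.inclusion (S := Subring.closure (Set.range (algebraMap k F)))
          (T := (algebraMap k F).fieldRange.toSubring) hle z) =
          (algebraMap k F).rangeRestrictFieldEquiv c := Subtype.ext hc.symm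
      change algebraMap k F ((algebraMap k F).rangeRestrictFieldEquiv.symm _) = (z : F)
      rw [← hc]
      congr 1
      rw [RingEquiv.symm_apply_eq]
      exact hz
    exact hI.isAlgebraic
  have := iInf_valuationSubring_superset (K := F) (s := Set.range (algebraMap k F))
  have h2 : coordX V F ∉ (⨅ V : {V : ValuationSubring F //
      Set.range (algebraMap k F) ⊆ V.toSubring}, V.1.toSubring) := by
    rw [this]; exact hnot
  rw [Subring.mem_iInf] at h2
  push Not at h2
  obtain ⟨⟨B, hB⟩, hB'⟩ := h2
  refine ⟨⟨B, fun a => hB ⟨a, rfl⟩, ?_⟩, hB'⟩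
  rintro rfl
  exact hB' trivial

lemma eq_C_of_natDegree_norm_eq_zero {r : V.CoordinateRing}
    (h : (Algebra.norm k[X] r).natDegree = 0) : ∃ c : k, r = algebraMap k _ c := by
  obtain ⟨p, q, rfl⟩ := Affine.CoordinateRing.exists_smul_basis_eq r
  have hdeg := Affine.CoordinateRing.degree_norm_smul_basis (W' := V) p q
  have h0 := degree_le_of_natDegree_le h.le
  rw [hdeg] at h0
  have hq : q = 0 := by
    by_contra hq
    have := (le_max_right _ _).trans h0
    rw [degree_eq_natDegree hq, two_nsmul] at this
    have h' : ((q.natDegree + q.natDegree + 3 : ℕ) : WithBot ℕ) ≤ ((0 : ℕ) : WithBot ℕ) := by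
      exact_mod_cast this
    rw [Nat.cast_le] at h'
    omega
  have hp : p.natDegree = 0 := by
    by_contra hp
    have hp0 : p ≠ 0 := by rintro rfl; simp at hp
    have := (le_max_left _ _).trans h0
    rw [degree_eq_natDegree hp0, two_nsmul] at this
    have h' : ((p.natDegree + p.natDegree : ℕ) : WithBot ℕ) ≤ ((0 : ℕ) : WithBot ℕ) := by
      exact_mod_cast this
    rw [Nat.cast_le] at h'
    omega
  rw [natDegree_eq_zero] at hp
  obtain ⟨c, rfl⟩ := hp
  refine ⟨c, ?_⟩
  rw [hq, zero_smul, add_zero, Affine.CoordinateRing.smul, mul_one]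
  rfl

/-- The map from points to the class group is a homomorphism, so nP = 0 makes the n-th power of the
ideal of P principal. A generator is a function with divisor n[P] - n[O]. -/
lemma exists_span_eq_pow [DecidableEq k] {a b : k} (h : V.Nonsingular a b) {n : ℕ}
    (hn : n • (Affine.Point.some a b h : V.Point) = 0) :
    ∃ r, Ideal.span {r} = Affine.CoordinateRing.XYIdeal V a (C b) ^ n := by
  have h1 : n • Affine.Point.toClass (Affine.Point.some a b h : V.Point) = 0 := by
    rw [← map_nsmul, hn, map_zero]
  rw [Affine.Point.toClass_some] at h1
  have h2 : ClassGroup.mk V.FunctionField (Affine.CoordinateRing.XYIdeal' h ^ n) = 1 := by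
    rw [map_pow]
    exact h1
  obtain ⟨r, -, hr⟩ := (ClassGroup.mk_eq_one_of_coe_ideal
    (I' := Affine.CoordinateRing.XYIdeal V a (C b) ^ n) (by
      rw [Units.val_pow_eq_pow_val, Affine.CoordinateRing.XYIdeal'_eq,
        FractionalIdeal.coeIdeal_pow])).mp h2
  exact ⟨r, hr.symm⟩

variable [V.IsElliptic]

/-- The place of a closed point of the affine curve. -/
noncomputable def finitePlace (v : HeightOneSpectrum V.CoordinateRing) : Place k F where
  ring := (v.valuation F).valuationSubring
  algebraMap_mem a := by
    rw [IsScalarTower.algebraMap_apply k V.CoordinateRing F]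
    exact v.valuation_le_one _
  ne_top h := by
    obtain ⟨t, ht, -⟩ := exists_isUniformizer (F := F) v
    have : t⁻¹ ∈ (v.valuation F).valuationSubring := by rw [h]; trivial
    rw [Valuation.mem_valuationSubring_iff, map_inv₀, ht, ← WithZero.exp_neg,
      ← WithZero.exp_zero, WithZero.exp_le_exp] at this
    norm_num at this

lemma hasOrder_finitePlace (v : HeightOneSpectrum V.CoordinateRing) {f : F} {m : ℤ} :
    HasOrder (finitePlace (F := F) v).ring f m ↔ v.valuation F f = WithZero.exp (-m) :=
  hasOrder_valuationSubring_iff v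

lemma coordX_mem_finitePlace (v : HeightOneSpectrum V.CoordinateRing) :
    coordX V F ∈ (finitePlace (F := F) v).ring :=
  v.valuation_le_one _

lemma mem_asIdeal_iff (v : HeightOneSpectrum V.CoordinateRing) (r : V.CoordinateRing) :
    r ∈ v.asIdeal ↔ (finitePlace (F := F) v).ring.valuation (algebraMap _ F r) < 1 := by
  rw [← v.valuation_lt_one_iff_mem (K := F), ← map_one (finitePlace (F := F) v).ring.valuation,
    ← map_one (v.valuation F)]
  exact (v.valuation F).isEquiv_valuation_valuationSubring.lt_iff_lt

lemma finitePlace_injective :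
    Function.Injective (finitePlace : HeightOneSpectrum V.CoordinateRing → Place k F) := by
  intro v w h
  ext r
  rw [mem_asIdeal_iff (F := F), mem_asIdeal_iff (F := F), h]

lemma exists_finitePlace (A : Place k F) (hx : coordX V F ∈ A.ring) :
    ∃ v : HeightOneSpectrum V.CoordinateRing, finitePlace v = A := by
  obtain ⟨v, hv, -⟩ := exists_heightOneSpectrum (algebraMap_mem_of_coordX_mem A hx) A.ne_top
  exact ⟨v, Place.ext' hv.symm⟩

/-- The two conditions put the generators of the maximal ideal of (a, b) into the center of A. That
ideal being maximal, it equals the center. -/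
lemma ratPoint_mem_iff {a b : k} (h : V.Nonsingular a b) (A : Place k F) :
    (A.ring.valuation (coordX V F - algebraMap k F a) < 1 ∧
      A.ring.valuation (coordY V F - algebraMap k F b) < 1) ↔ A = finitePlace (ratPoint h) := by
  have hX : algebraMap V.CoordinateRing F (Affine.CoordinateRing.XClass V a) =
      coordX V F - algebraMap k F a := by
    rw [Affine.CoordinateRing.XClass, C_sub, map_sub, map_sub,
      IsScalarTower.algebraMap_apply k V.CoordinateRing F]
    rfl
  have hY : algebraMap V.CoordinateRing F (Affine.CoordinateRing.YClass V (C b)) =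
      coordY V F - algebraMap k F b := by
    rw [Affine.CoordinateRing.YClass, map_sub, map_sub,
      IsScalarTower.algebraMap_apply k V.CoordinateRing F]
    rfl
  constructor
  · rintro ⟨h1, h2⟩
    have hx : coordX V F ∈ A.ring := by
      rw [← sub_add_cancel (coordX V F) (algebraMap k F a)]
      exact add_mem ((A.ring.valuation_le_one_iff _).mp h1.le) (A.algebraMap_mem a)
    obtain ⟨v, rfl⟩ := exists_finitePlace A hx
    congr 1
    have hle : (ratPoint h).asIdeal ≤ v.asIdeal := by
      refine Ideal.span_le.mpr ?_
      rintro r (rfl | rfl)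
      · rw [SetLike.mem_coe, mem_asIdeal_iff (F := F), hX]
        exact h1
      · rw [SetLike.mem_coe, mem_asIdeal_iff (F := F), hY]
        exact h2
    ext1
    exact ((XYIdeal_isMaximal h).eq_of_le v.isPrime.ne_top hle).symm
  · rintro rfl
    rw [← hX, ← hY, ← mem_asIdeal_iff, ← mem_asIdeal_iff]
    exact ⟨Ideal.subset_span (by simp), Ideal.subset_span (by simp)⟩

/-- The divisor of a generator of a power of the ideal of a rational point. -/
lemma hasDivisor_of_span_eq_pow {a b : k} (h : V.Nonsingular a b) {n : ℕ} {r : V.CoordinateRing}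
    (hr : Ideal.span {r} = Affine.CoordinateRing.XYIdeal V a (C b) ^ n) (O : Place k F)
    (hO : coordX V F ∉ O.ring) :
    HasDivisor (algebraMap V.CoordinateRing F r)
      (Finsupp.single (finitePlace (ratPoint h)) (n : ℤ) - Finsupp.single O (n : ℤ)) := by
  classical
  have hr0 : r ≠ 0 := by
    rintro rfl
    rw [Set.singleton_zero, Ideal.span_zero] at hr
    exact pow_ne_zero n XYIdeal_ne_bot hr.symm
  intro A
  rw [Finsupp.sub_apply, Finsupp.single_apply, Finsupp.single_apply]
  by_cases hA : coordX V F ∈ A.ring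
  · obtain ⟨v, rfl⟩ := exists_finitePlace A hA
    rw [if_neg (show O ≠ finitePlace v from fun h' => hO (h' ▸ hA)), sub_zero,
      hasOrder_finitePlace, HeightOneSpectrum.valuation_of_algebraMap, v.intValuation_if_neg hr0,
      hr, Associates.mk_pow, Associates.count_pow
        (Associates.mk_ne_zero.mpr (XYIdeal_ne_bot (V := V) (a := a) (y := C b)))
        (Associates.irreducible_mk.mpr v.irreducible)]
    split_ifs with h'
    · rw [← finitePlace_injective h']
      change WithZero.exp (-((n * (Associates.mk (Affine.CoordinateRing.XYIdeal V a (C b))).count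
        (Associates.mk (Affine.CoordinateRing.XYIdeal V a (C b))).factors : ℕ) : ℤ)) = _
      rw [Associates.count_self (show Irreducible (Associates.mk
        (Affine.CoordinateRing.XYIdeal V a (C b))) from
          Associates.irreducible_mk.mpr (ratPoint h).irreducible), mul_one]
    · have : (Associates.mk v.asIdeal).count
          (Associates.mk (Affine.CoordinateRing.XYIdeal V a (C b))).factors = 0 := by
        apply Associates.count_eq_zero_of_ne (Associates.irreducible_mk.mpr v.irreducible)
          (Associates.irreducible_mk.mpr (ratPoint h).irreducible)
        intro h''
        apply h'
        congr 1
        ext1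
        exact (associated_iff_eq.mp (Associates.mk_eq_mk_iff_associated.mp h'')).symm
      rw [this, mul_zero]
      rfl
  · obtain rfl := place_infinity_unique O A hO hA
    rw [if_pos rfl, if_neg (show finitePlace (ratPoint h) ≠ O from
      fun h' => hO (h' ▸ coordX_mem_finitePlace _)), zero_sub]
    -- The pole order at infinity is the degree of the norm, that is, the dimension of the quotient
    -- by the n-th power of the ideal.
    have hdeg : (Algebra.norm k[X] r).natDegree = n := by
      rw [← finrank_quotient_span_eq_natDegree_norm (Affine.CoordinateRing.basis V) hr0, hr,
        finrank_quotient_XYIdeal_pow h]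
    have := hasOrder_of_notMem O hO hr0
    rwa [hdeg] at this

end Places

/-! ### Functions are determined by their divisors up to constants -/

section Global

lemma exists_uniformizer_place {k F : Type*} [Field k] [Field F] [Algebra k F] (V : Affine k)
    [V.IsElliptic] [Algebra V.CoordinateRing F] [IsFractionRing V.CoordinateRing F]
    [IsScalarTower k V.CoordinateRing F] (A : Place k F) : ∃ t, IsUniformizer A.ring t := by
  by_cases hx : coordX V F ∈ A.ring
  · obtain ⟨v, rfl⟩ := exists_finitePlace A hx
    obtain ⟨t, -, ht⟩ := exists_isUniformizer (F := F) v
    exact ⟨t, ht⟩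
  · exact ⟨_, isUniformizer_of_notMem A hx⟩

lemma hasOrder_zero_iff {k F : Type*} [Field k] [Field F] [Algebra k F] (V : Affine k)
    [V.IsElliptic] [Algebra V.CoordinateRing F] [IsFractionRing V.CoordinateRing F]
    [IsScalarTower k V.CoordinateRing F] (A : Place k F) {f : F} :
    HasOrder A.ring f 0 ↔ A.ring.valuation f = 1 := by
  obtain ⟨t, ht⟩ := exists_uniformizer_place V A
  rw [ht.hasOrder_iff, zpow_zero]

/-- A function without poles is constant. -/
lemma exists_eq_algebraMap_of_forall_mem {k F : Type*} [Field k] [Field F] [Algebra k F]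
    (V : Affine k)
    [V.IsElliptic] [Algebra V.CoordinateRing F] [IsFractionRing V.CoordinateRing F]
    [IsScalarTower k V.CoordinateRing F] {f : F} (hf : ∀ A : Place k F, f ∈ A.ring) :
    ∃ c : k, f = algebraMap k F c := by
  -- A function integral at all affine points is regular. Without a pole at infinity its norm then
  -- has degree 0, which leaves only constants.
  obtain ⟨r, rfl⟩ := HeightOneSpectrum.mem_integers_of_valuation_le_one (R := V.CoordinateRing) F f
    fun v => hf (finitePlace v)
  by_cases hr : r = 0
  · exact ⟨0, by rw [hr, map_zero, map_zero]⟩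
  obtain ⟨A, hA⟩ := exists_place_infinity V F
  have h1 := (A.ring.valuation_le_one_iff _).mpr (hf A)
  have hu := isUniformizer_of_notMem A hA
  rw [valuation_of_notMem A hA hr, ← not_lt, ← inv_lt_one₀ (zpow_pos hu.valuation_pos _),
    ← zpow_neg, hu.zpow_lt_one] at h1
  obtain ⟨c, rfl⟩ := eq_C_of_natDegree_norm_eq_zero (r := r) (by omega)
  exact ⟨c, (IsScalarTower.algebraMap_apply k V.CoordinateRing F c).symm⟩

/-- Two functions with the same divisor are proportional. -/
lemma exists_eq_mul_of_hasDivisor {k F : Type*} [Field k] [Field F] [Algebra k F] (V : Affine k)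
    [V.IsElliptic] [Algebra V.CoordinateRing F] [IsFractionRing V.CoordinateRing F]
    [IsScalarTower k V.CoordinateRing F] {f g : F} {D : Place k F →₀ ℤ} (hf : HasDivisor f D)
    (hg : HasDivisor g D) : ∃ c : k, c ≠ 0 ∧ f = algebraMap k F c * g := by
  obtain ⟨A, hA⟩ := exists_place_infinity V F
  have hg0 : g ≠ 0 := (hg A).ne_zero
  have hf0 : f ≠ 0 := (hf A).ne_zero
  obtain ⟨c, hc⟩ := exists_eq_algebraMap_of_forall_mem V (f := f / g) fun B => by
    rw [← B.ring.valuation_le_one_iff, map_div₀, (hf B).valuation_eq (hg B), div_self]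
    rwa [Valuation.ne_zero_iff]
  refine ⟨c, ?_, ?_⟩
  · rintro rfl
    rw [map_zero, div_eq_zero_iff] at hc
    tauto
  · rw [← hc, div_mul_cancel₀ _ hg0]

end Global

/-! ### Semilinear automorphisms of the function field and translations -/

section Semilinear

variable {K : Type*} [Field K] (W : WeierstrassCurve K)

instance isElliptic_baseChange [W.IsElliptic] (S : Type*) [Field S] [Algebra K S] :
    (Affine.baseChange W S).IsElliptic :=
  inferInstanceAs (W.map (algebraMap K S)).IsElliptic

variable {W}

lemma algebraMap_K_eq (a : K) : algebraMap K (FunField W) a =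
    algebraMap (SeparableClosure K) (FunField W) (algebraMap K (SeparableClosure K) a) :=
  IsScalarTower.algebraMap_apply _ _ _ _

lemma funField_induction (r : CoordRing W) : ∃ p q : (SeparableClosure K)[X],
    algebraMap (CoordRing W) (FunField W) r = aeval (xFun W) p + aeval (xFun W) q * yFun W := by
  obtain ⟨p, q, rfl⟩ := Affine.CoordinateRing.exists_smul_basis_eq r
  exact ⟨p, q, algebraMap_smul_basis (V := Affine.baseChange W (SeparableClosure K)) p q⟩

lemma semilinear_aeval {σ : GalK K} {φ : FunField W →+* FunField W}
    (hφ : ∀ a : SeparableClosure K, φ (algebraMap _ _ a) = algebraMap _ _ (σ a))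
    (p : (SeparableClosure K)[X]) (x : FunField W) :
    φ (aeval x p) = aeval (φ x) (p.map (σ : SeparableClosure K →+* SeparableClosure K)) := by
  rw [aeval_def, hom_eval₂, aeval_def, eval₂_map]
  congr 1
  ext a
  exact hφ a

lemma semilinear_ext {σ : GalK K} {φ ψ : FunField W →+* FunField W}
    (hφ : ∀ a : SeparableClosure K, φ (algebraMap _ _ a) = algebraMap _ _ (σ a))
    (hψ : ∀ a : SeparableClosure K, ψ (algebraMap _ _ a) = algebraMap _ _ (σ a))
    (hx : φ (xFun W) = ψ (xFun W)) (hy : φ (yFun W) = ψ (yFun W)) : φ = ψ := by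
  have key : ∀ r : CoordRing W, φ (algebraMap _ _ r) = ψ (algebraMap _ _ r) := by
    intro r
    obtain ⟨p, q, h⟩ := funField_induction r
    rw [h, map_add, map_add, map_mul, map_mul, semilinear_aeval hφ, semilinear_aeval hφ,
      semilinear_aeval hψ, semilinear_aeval hψ, hx, hy]
  ext f
  obtain ⟨r, s, -, rfl⟩ := IsFractionRing.div_surjective (A := CoordRing W) f
  rw [map_div₀, map_div₀, key, key]

/-- A solution of the Weierstrass equation with transcendental `x` gives a semilinear endomorphism
of the function field. -/
lemma exists_semilinear (σ : GalK K) {x y : FunField W}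
    (h : (Affine.baseChange W (FunField W)).Equation x y)
    (hx : Transcendental (SeparableClosure K) x) :
    ∃ φ : FunField W →ₐ[K] FunField W,
      (∀ a : SeparableClosure K, φ (algebraMap _ _ a) = algebraMap _ _ (σ a)) ∧
      φ (xFun W) = x ∧ φ (yFun W) = y := by
  let i : (SeparableClosure K)[X] →+* FunField W :=
    eval₂RingHom ((algebraMap (SeparableClosure K) (FunField W)).comp
      (σ : SeparableClosure K →+* SeparableClosure K)) x
  have hi : ∀ p, i p = aeval x (p.map (σ : SeparableClosure K →+* SeparableClosure K)) := by
    intro p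
    rw [aeval_def, eval₂_map]
    rfl
  have hiC : ∀ a, i (C a) = algebraMap _ _ (σ a) := fun a => by
    rw [hi, map_C, aeval_C]; rfl
  have hiK : ∀ a : K, i (C (algebraMap K (SeparableClosure K) a)) = algebraMap K _ a := fun a => by
    rw [hiC, AlgEquiv.commutes, algebraMap_K_eq]
  have hiX : i X = x := by rw [hi, map_X, aeval_X]
  have h' : y ^ 2 + i (C (Affine.baseChange W (SeparableClosure K)).a₁ * X +
      C (Affine.baseChange W (SeparableClosure K)).a₃) * y
      - i (X ^ 3 + C (Affine.baseChange W (SeparableClosure K)).a₂ * X ^ 2 +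
        C (Affine.baseChange W (SeparableClosure K)).a₄ * X +
        C (Affine.baseChange W (SeparableClosure K)).a₆) = 0 := by
    rw [Affine.equation_iff] at h
    simp only [WeierstrassCurve.baseChange, WeierstrassCurve.map, map_add, map_mul, map_pow, hiX]
      at h ⊢
    simp only [hiK]
    linear_combination h
  let φ₀ : CoordRing W →+* FunField W :=
    coordLift (V := Affine.baseChange W (SeparableClosure K)) i y h'
  have hinj0 : ∀ p, i p = 0 → p = 0 := by
    intro p hp
    rw [hi] at hp
    by_contra hp0
    exact hx ⟨_, (Polynomial.map_ne_zero_iff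
      (σ : SeparableClosure K →+* SeparableClosure K).injective).mpr hp0, hp⟩
  -- If r is killed, so is its norm. The norm is a polynomial in x, and the image of x is
  -- transcendental.
  have hinj : Function.Injective φ₀ := by
    rw [injective_iff_map_eq_zero]
    intro r hr
    have h1 := congrArg φ₀ (mul_coordConj r)
    rw [map_mul, hr, zero_mul] at h1
    have h2 : φ₀ (Affine.CoordinateRing.mk _ (C (Algebra.norm _ r))) = i (Algebra.norm _ r) :=
      coordLift_C _ _ _ _
    rw [h2] at h1
    exact Algebra.norm_eq_zero_iff.mp (hinj0 _ h1.symm)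
  let φ₁ : FunField W →+* FunField W := IsFractionRing.lift hinj
  have hφ₁ : ∀ r, φ₁ (algebraMap (CoordRing W) _ r) = φ₀ r :=
    fun r => IsFractionRing.lift_algebraMap hinj r
  have hφa : ∀ a : SeparableClosure K, φ₁ (algebraMap _ _ a) = algebraMap _ _ (σ a) := by
    intro a
    rw [IsScalarTower.algebraMap_apply (SeparableClosure K) (CoordRing W) (FunField W), hφ₁]
    exact (coordLift_C i y h' (C a)).trans (hiC a)
  refine ⟨{ φ₁ with commutes' := fun a => ?_ }, hφa, ?_, ?_⟩
  · change φ₁ _ = _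
    rw [algebraMap_K_eq, hφa, AlgEquiv.commutes]
  · exact (hφ₁ _).trans ((coordLift_C i y h' X).trans hiX)
  · exact (hφ₁ _).trans (coordLift_X i y h')

-- Let M be the field of functions algebraic over the constants. If x(X - P) were algebraic, then X
-- - P would be an M-point, and so would X = (X - P) + P, although x is transcendental. This makes X
-- - P a legitimate image of the generic point under an endomorphism.
open scoped Classical in
lemma point_map_transcendental [W.IsElliptic] (P : Pts W) :
    ∃ (x y : FunField W) (h : (Affine.baseChange W (FunField W)).Nonsingular x y),
      genericPoint W - constPoint W P = .some x y h ∧ Transcendental (SeparableClosure K) x := by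
  let M := algebraicClosure (SeparableClosure K) (FunField W)
  have : IsScalarTower K M (FunField W) := IsScalarTower.of_algebraMap_eq fun _ => rfl
  let j : M →ₐ[K] FunField W := M.val.restrictScalars K
  let ι : SeparableClosure K →ₐ[K] M := IsScalarTower.toAlgHom K (SeparableClosure K) M
  have hc : constPoint W P = Affine.Point.map (W' := W) j (Affine.Point.map (W' := W) ι P) := by
    rw [Affine.Point.map_map]
    rfl
  have hnot : ∀ Q : (Affine.baseChange W M).Point,
      genericPoint W - constPoint W P ≠ Affine.Point.map (W' := W) j Q := by
    intro Q hQ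
    rw [hc, sub_eq_iff_eq_add, ← map_add] at hQ
    generalize Q + Affine.Point.map (W' := W) ι P = T at hQ
    rcases T with _ | ⟨a, b, hab⟩
    · exact Affine.Point.some_ne_zero _ hQ
    · have ha : xFun W = j a := (Affine.Point.some.inj hQ).1
      refine transcendental_coordX (Affine.baseChange W (SeparableClosure K)) (FunField W) ?_
      change IsAlgebraic _ (xFun W)
      rw [ha]
      exact mem_algebraicClosure_iff.mp a.2
  rcases hQ : genericPoint W - constPoint W P with _ | ⟨x, y, h⟩
  · exact absurd hQ (hnot 0)
  · refine ⟨x, y, h, rfl, fun hx => ?_⟩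
    have hx' : x ∈ M := mem_algebraicClosure_iff.mpr hx
    -- The Weierstrass equation is monic quadratic in y with coefficients in M.
    have hy' : y ∈ M := by
      have heq := h.1
      rw [Affine.equation_iff] at heq
      have hI : IsIntegral M y := by
        refine ⟨X ^ 2 + C (algebraMap K M W.a₁ * ⟨x, hx'⟩ + algebraMap K M W.a₃) * X -
          C (⟨x, hx'⟩ ^ 3 + algebraMap K M W.a₂ * ⟨x, hx'⟩ ^ 2 + algebraMap K M W.a₄ * ⟨x, hx'⟩ +
            algebraMap K M W.a₆), ?_, ?_⟩
        · monicity!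
        · simp only [eval₂_sub, eval₂_add, eval₂_mul, eval₂_pow, eval₂_X, eval₂_C, map_add, map_mul,
            map_pow, ← IsScalarTower.algebraMap_apply K M (FunField W)]
          simp only [WeierstrassCurve.baseChange, WeierstrassCurve.map] at heq
          change y ^ 2 + (algebraMap K (FunField W) W.a₁ * x + algebraMap K (FunField W) W.a₃) * y -
            (x ^ 3 + algebraMap K (FunField W) W.a₂ * x ^ 2 + algebraMap K (FunField W) W.a₄ * x +
              algebraMap K (FunField W) W.a₆) = 0
          linear_combination heq
      have : IsAlgebraic (SeparableClosure K) y :=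
        IsAlgebraic.restrictScalars (SeparableClosure K) hI.isAlgebraic
      exact mem_algebraicClosure_iff.mpr this
    refine hnot (.some ⟨x, hx'⟩ ⟨y, hy'⟩
      ((Affine.baseChange_nonsingular W (f := j) j.injective _ _).mp h)) ?_
    rw [hQ, Affine.Point.map_some]
    rfl

open scoped Classical in
/-- `φ` acts on constants through `σ`, and carries the generic point `X` to `X - P`. -/
def IsSemi [W.IsElliptic] (σ : GalK K) (P : Pts W) (φ : FunField W →ₐ[K] FunField W) : Prop :=
  (∀ a : SeparableClosure K, φ (algebraMap _ _ a) = algebraMap _ _ (σ a)) ∧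
    Affine.Point.map (W' := W) φ (genericPoint W) = genericPoint W - constPoint W P

section

open scoped Classical

variable {σ τ : GalK K} {P Q : Pts W} {φ ψ : FunField W →ₐ[K] FunField W}

lemma map_constPoint (hφ : ∀ a : SeparableClosure K, φ (algebraMap _ _ a) = algebraMap _ _ (σ a))
    (Q : Pts W) :
    Affine.Point.map (W' := W) φ (constPoint W Q) = constPoint W (ptsAct W σ Q) := by
  rw [constPoint, ptsAct, Affine.Point.map_map, Affine.Point.map_map]
  congr 1
  congr 1
  exact AlgHom.ext hφ

lemma ptsAct_one (P : Pts W) : ptsAct W 1 P = P := by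
  cases P <;> rfl

lemma ptsAct_mul (σ τ : GalK K) (P : Pts W) : ptsAct W (σ * τ) P = ptsAct W σ (ptsAct W τ P) := by
  cases P <;> rfl

variable [W.IsElliptic]

lemma exists_isSemi_algHom (σ : GalK K) (P : Pts W) : ∃ φ, IsSemi σ P φ := by
  obtain ⟨x, y, h, hxy, hx⟩ := point_map_transcendental P
  obtain ⟨φ, h1, h2, h3⟩ := exists_semilinear σ h.1 hx
  refine ⟨φ, h1, ?_⟩
  rw [hxy]
  change Affine.Point.map (W' := W) φ (.some (xFun W) (yFun W) _) = _
  rw [Affine.Point.map_some, Affine.Point.some.injEq]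
  exact ⟨h2, h3⟩

lemma IsSemi.ext (hφ : IsSemi σ P φ) (hψ : IsSemi σ P ψ) : φ = ψ := by
  have h := hφ.2.trans hψ.2.symm
  change Affine.Point.map (W' := W) φ (.some (xFun W) (yFun W) _) =
    Affine.Point.map (W' := W) ψ (.some (xFun W) (yFun W) _) at h
  rw [Affine.Point.map_some, Affine.Point.map_some, Affine.Point.some.injEq] at h
  have := semilinear_ext (φ := (φ : FunField W →+* FunField W))
    (ψ := (ψ : FunField W →+* FunField W)) hφ.1 hψ.1 h.1 h.2
  exact AlgHom.ext fun f => RingHom.congr_fun this f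

/-- This is the group law of the semidirect product of E(Kˢᵉᵖ) with the Galois group: applying φ to
X - Q gives X - P - σQ. -/
lemma IsSemi.comp (hφ : IsSemi σ P φ) (hψ : IsSemi τ Q ψ) :
    IsSemi (σ * τ) (P + ptsAct W σ Q) (φ.comp ψ) := by
  refine ⟨fun a => ?_, ?_⟩
  · rw [AlgHom.comp_apply, hψ.1, hφ.1]
    rfl
  · rw [← Affine.Point.map_map, hψ.2, map_sub, hφ.2, map_constPoint hφ.1, map_add]
    abel

lemma isSemi_id : IsSemi (W := W) 1 0 (AlgHom.id K _) := by
  refine ⟨fun a => rfl, ?_⟩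
  rw [map_zero, sub_zero]
  rfl

lemma exists_isSemi (σ : GalK K) (P : Pts W) :
    ∃ φ : FunField W ≃ₐ[K] FunField W, IsSemi σ P (φ : FunField W →ₐ[K] FunField W) := by
  obtain ⟨φ, hφ⟩ := exists_isSemi_algHom σ P
  -- The inverse of (σ, P) in the semidirect product is (σ⁻¹, -σ⁻¹P).
  obtain ⟨ψ, hψ⟩ := exists_isSemi_algHom σ⁻¹ (-(ptsAct W σ⁻¹ P))
  have h1 : φ.comp ψ = AlgHom.id K _ := by
    refine (hφ.comp hψ).ext ?_
    rw [map_neg, ← ptsAct_mul, mul_inv_cancel, ptsAct_one, add_neg_cancel]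
    exact isSemi_id
  have h2 : ψ.comp φ = AlgHom.id K _ := by
    refine (hψ.comp hφ).ext ?_
    rw [inv_mul_cancel, neg_add_cancel]
    exact isSemi_id
  exact ⟨AlgEquiv.ofAlgHom φ ψ h1 h2, hφ⟩

end

end Semilinear

/-! ### The action of semilinear automorphisms on places and divisors -/

section PlaceAction

variable {K : Type*} [Field K] (W : WeierstrassCurve K)

/-- The places of the function field of `E` over `Kˢᵉᵖ`. -/
abbrev Pl : Type _ := Place (SeparableClosure K) (FunField W)

/-- The automorphisms of the function field that are semilinear over `Kˢᵉᵖ`. -/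
def semiGroup : Subgroup (FunField W ≃ₐ[K] FunField W) where
  carrier := {φ | ∃ σ : GalK K, ∀ a : SeparableClosure K,
    φ (algebraMap _ _ a) = algebraMap _ _ (σ a)}
  one_mem' := ⟨1, fun _ => rfl⟩
  mul_mem' := by
    rintro φ ψ ⟨σ, hσ⟩ ⟨τ, hτ⟩
    exact ⟨σ * τ, fun a => by rw [AlgEquiv.mul_apply, hτ, hσ, AlgEquiv.mul_apply]⟩
  inv_mem' := by
    rintro φ ⟨σ, hσ⟩
    refine ⟨σ⁻¹, fun a => φ.injective ?_⟩
    rw [hσ, ← AlgEquiv.mul_apply, ← AlgEquiv.mul_apply, mul_inv_cancel, mul_inv_cancel]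
    rfl

variable {W}

lemma semiGroup_inv_apply (g : semiGroup W) (f : FunField W) :
    ((g⁻¹ : semiGroup W) : FunField W ≃ₐ[K] FunField W) f =
      (g : FunField W ≃ₐ[K] FunField W).symm f := rfl

noncomputable instance : SMul (semiGroup W) (Pl W) where
  smul g A :=
    { ring := A.ring.comap (g : FunField W ≃ₐ[K] FunField W).symm.toRingEquiv.toRingHom
      algebraMap_mem := fun a => by
        obtain ⟨σ, hσ⟩ := (g⁻¹).2
        rw [ValuationSubring.mem_comap]
        have : (g : FunField W ≃ₐ[K] FunField W).symm (algebraMap _ _ a) ∈ A.ring := by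
          rw [← semiGroup_inv_apply, hσ]
          exact A.algebraMap_mem _
        exact this
      ne_top := fun h => by
        apply A.ne_top
        rw [eq_top_iff]
        intro x _
        have hx : (g : FunField W ≃ₐ[K] FunField W) x ∈
            A.ring.comap (g : FunField W ≃ₐ[K] FunField W).symm.toRingEquiv.toRingHom := by
          rw [h]; trivial
        rw [ValuationSubring.mem_comap] at hx
        have hx' : (g : FunField W ≃ₐ[K] FunField W).symm
          ((g : FunField W ≃ₐ[K] FunField W) x) ∈ A.ring := hx
        simpa using hx' }

lemma mem_smul_ring_iff {g : semiGroup W} {A : Pl W} {f : FunField W} :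
    f ∈ (g • A).ring ↔ (g : FunField W ≃ₐ[K] FunField W).symm f ∈ A.ring := Iff.rfl

lemma apply_mem_smul_ring_iff {g : semiGroup W} {A : Pl W} {f : FunField W} :
    (g : FunField W ≃ₐ[K] FunField W) f ∈ (g • A).ring ↔ f ∈ A.ring := by
  rw [mem_smul_ring_iff, AlgEquiv.symm_apply_apply]

noncomputable instance : MulAction (semiGroup W) (Pl W) where
  one_smul A := Place.ext' (by ext f; rfl)
  mul_smul g h A := Place.ext' (by ext f; rfl)

lemma valuation_smul_le_iff {g : semiGroup W} {A : Pl W} {f f' : FunField W} :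
    (g • A).ring.valuation ((g : FunField W ≃ₐ[K] FunField W) f) ≤
      (g • A).ring.valuation ((g : FunField W ≃ₐ[K] FunField W) f') ↔
      A.ring.valuation f ≤ A.ring.valuation f' :=
  valuation_comap_le_iff (A := A.ring) (φ := (g : FunField W ≃ₐ[K] FunField W).toRingEquiv)

lemma valuation_smul_lt_one_iff {g : semiGroup W} {A : Pl W} {f : FunField W} :
    (g • A).ring.valuation f < 1 ↔
      A.ring.valuation ((g : FunField W ≃ₐ[K] FunField W).symm f) < 1 := by
  obtain ⟨f, rfl⟩ := (g : FunField W ≃ₐ[K] FunField W).surjective f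
  have h := valuation_smul_le_iff (g := g) (A := A) (f := 1) (f' := f)
  simp only [map_one] at h
  rw [AlgEquiv.symm_apply_apply, ← not_le, ← not_le]
  exact not_congr h

lemma mapDomain_smul_apply (D : Pl W →₀ ℤ) (g : semiGroup W) (A : Pl W) :
    D.mapDomain (g • ·) A = D (g⁻¹ • A) := by
  conv_lhs => rw [← smul_inv_smul g A]
  exact Finsupp.mapDomain_apply (MulAction.injective g) D _

variable [W.IsElliptic]

lemma exists_isUniformizer_place (A : Pl W) : ∃ t, IsUniformizer A.ring t :=
  exists_uniformizer_place (Affine.baseChange W (SeparableClosure K)) A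

lemma HasOrder.smul {A : Pl W} {f : FunField W} {m : ℤ} (h : HasOrder A.ring f m)
    (g : semiGroup W) :
    HasOrder (g • A).ring ((g : FunField W ≃ₐ[K] FunField W) f) m := by
  obtain ⟨t, ht⟩ := exists_isUniformizer_place A
  have ht' : IsUniformizer (g • A).ring ((g : FunField W ≃ₐ[K] FunField W) t) :=
    ht.comap (g : FunField W ≃ₐ[K] FunField W).toRingEquiv
  rw [ht.hasOrder_iff, ← map_zpow₀] at h
  rw [ht'.hasOrder_iff, ← map_zpow₀, ← map_zpow₀]
  exact le_antisymm (valuation_smul_le_iff.mpr h.le) (valuation_smul_le_iff.mpr h.ge)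

lemma HasDivisor.smul {f : FunField W} {D : Pl W →₀ ℤ} (h : HasDivisor f D) (g : semiGroup W) :
    HasDivisor ((g : FunField W ≃ₐ[K] FunField W) f) (D.mapDomain (g • ·)) := by
  intro A
  rw [mapDomain_smul_apply]
  have := (h (g⁻¹ • A)).smul g
  rwa [smul_inv_smul] at this

end PlaceAction

lemma HasDivisor.mul {k F : Type*} [Field k] [Field F] [Algebra k F] {f g : F}
    {D D' : Place k F →₀ ℤ} (hf : HasDivisor f D) (hg : HasDivisor g D') :
    HasDivisor (f * g) (D + D') := fun A => (hf A).mul (hg A)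

lemma HasDivisor.inv {k F : Type*} [Field k] [Field F] [Algebra k F] {f : F}
    {D : Place k F →₀ ℤ} (hf : HasDivisor f D) :
    HasDivisor f⁻¹ (-D) := fun A => (hf A).inv

/-! ### The addition law near the origin -/

section NearInfinity

/-- The quantities `x(X + P) - x(P)` and `y(X + P) - y(P)`, multiplied by powers of `x - x(P)`. -/
lemma addition_near_infinity {F : Type*} [Field F] {V : Affine F} {x y a b : F}
    (h : V.Equation x y) (h' : V.Equation a b) (hx : x ≠ a) :
    (V.addX x a ((y - b) / (x - a)) - a) * (x - a) ^ 2 =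
      (3 * a ^ 2 + 2 * V.a₂ * a + V.a₄ - V.a₁ * b) * (x - a)
        - (2 * b + V.a₁ * a + V.a₃) * (y - b) ∧
    (V.addY x a y ((y - b) / (x - a)) - b
        + V.a₁ * (V.addX x a ((y - b) / (x - a)) - a)) * (x - a) ^ 3 =
      -((3 * a ^ 2 + 2 * V.a₂ * a + V.a₄ - V.a₁ * b) * (x - a) * (y - b)
        + (2 * b + V.a₁ * a + V.a₃) * (V.a₁ * (y - b) * (x - a) - (3 * a + V.a₂) * (x - a) ^ 2
          - (3 * a ^ 2 + 2 * V.a₂ * a + V.a₄ - V.a₁ * b) * (x - a)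
          + (2 * b + V.a₁ * a + V.a₃) * (y - b))) := by
  rw [Affine.equation_iff] at h h'
  have hu : x - a ≠ 0 := sub_ne_zero.mpr hx
  set ℓ := (y - b) / (x - a) with hℓ
  have hℓu : ℓ * (x - a) = y - b := div_mul_cancel₀ _ hu
  have h1 : (V.addX x a ℓ - a) * (x - a) ^ 2 =
      (3 * a ^ 2 + 2 * V.a₂ * a + V.a₄ - V.a₁ * b) * (x - a)
        - (2 * b + V.a₁ * a + V.a₃) * (y - b) := by
    have e : (V.addX x a ℓ - a) * (x - a) ^ 2 = (ℓ * (x - a)) ^ 2 + V.a₁ * (ℓ * (x - a)) * (x - a)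
      - (V.a₂ + x + 2 * a) * (x - a) ^ 2 := by rw [Affine.addX]; ring
    rw [e, hℓu]
    linear_combination h - h'
  refine ⟨h1, ?_⟩
  have hcube : (y - b) ^ 2 = (x - a) ^ 3 - (V.a₁ * (y - b) * (x - a)
      - (3 * a + V.a₂) * (x - a) ^ 2
      - (3 * a ^ 2 + 2 * V.a₂ * a + V.a₄ - V.a₁ * b) * (x - a)
      + (2 * b + V.a₁ * a + V.a₃) * (y - b)) := by
    linear_combination h - h'
  have e : (V.addY x a y ℓ - b + V.a₁ * (V.addX x a ℓ - a)) * (x - a) ^ 3 =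
      -((ℓ * (x - a)) * ((V.addX x a ℓ - a) * (x - a) ^ 2)
        + (y - b - ℓ * (x - a)) * (x - a) ^ 3
        + (2 * b + V.a₁ * a + V.a₃) * (x - a) ^ 3) := by
    rw [Affine.addY, Affine.negY, Affine.negAddY]; ring
  rw [e, h1, hℓu]
  -- The terms in (y - b)² and (x - a)³ both have a pole of order 6 at O. The Weierstrass equation
  -- recentered at (a, b) cancels them.
  linear_combination (2 * b + V.a₁ * a + V.a₃) * hcube

/-- At O the point X + P specializes to P = (a, b). By `addition_near_infinity` the two differences
are governed by fractions whose numerators have poles of order at most 3 and 5, over the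
denominators (x - a)² and (x - a)³, with poles of order 4 and 6. -/
lemma valuation_near_infinity {K : Type*} [Field K] {W : WeierstrassCurve K} {A : Pl W}
    (hA : xFun W ∉ A.ring) {a b : SeparableClosure K}
    (h : (Affine.baseChange W (SeparableClosure K)).Equation a b)
    (hne : xFun W ≠ algebraMap _ _ a) :
    A.ring.valuation ((Affine.baseChange W (FunField W)).addX (xFun W) (algebraMap _ _ a)
      ((yFun W - algebraMap _ _ b) / (xFun W - algebraMap _ _ a)) - algebraMap _ _ a) < 1 ∧
    A.ring.valuation ((Affine.baseChange W (FunField W)).addY (xFun W) (algebraMap _ _ a) (yFun W)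
      ((yFun W - algebraMap _ _ b) / (xFun W - algebraMap _ _ a)) - algebraMap _ _ b) < 1 := by
  obtain ⟨hx1, hxy⟩ :=
    valuation_coord_of_notMem (V := Affine.baseChange W (SeparableClosure K)) A hA
  change 1 < A.ring.valuation (xFun W) at hx1
  change A.ring.valuation (yFun W) ^ 2 = A.ring.valuation (xFun W) ^ 3 at hxy
  have hc : ∀ c : SeparableClosure K, A.ring.valuation (algebraMap _ _ c) ≤ 1 :=
    valuation_algebraMap_le A
  have hE : (Affine.baseChange W (FunField W)).Equation (algebraMap _ (FunField W) a)
      (algebraMap _ (FunField W) b) :=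
    h.baseChange (IsScalarTower.toAlgHom K (SeparableClosure K) (FunField W))
  obtain ⟨e1, e2⟩ := addition_near_infinity (equation_xFun_yFun W) hE hne
  set x₃ := (Affine.baseChange W (FunField W)).addX (xFun W) (algebraMap _ _ a)
    ((yFun W - algebraMap _ _ b) / (xFun W - algebraMap _ _ a))
  set y₃ := (Affine.baseChange W (FunField W)).addY (xFun W) (algebraMap _ _ a) (yFun W)
    ((yFun W - algebraMap _ _ b) / (xFun W - algebraMap _ _ a))
  set v := A.ring.valuation
  have hx0 : 0 < v (xFun W) := zero_lt_one.trans hx1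
  have hxy1 : v (xFun W) < v (yFun W) := by
    by_contra! hle
    have h1 := pow_le_pow_left₀ zero_le hle 2
    rw [hxy] at h1
    exact absurd h1 (not_le.mpr (pow_lt_pow_right₀ hx1 (by norm_num)))
  have hyx2 : v (yFun W) < v (xFun W) ^ 2 := by
    by_contra! hle
    have h1 := pow_le_pow_left₀ zero_le hle 2
    rw [hxy, ← pow_mul] at h1
    exact absurd h1 (not_le.mpr (pow_lt_pow_right₀ hx1 (by norm_num)))
  have hu : v (xFun W - algebraMap _ _ a) = v (xFun W) :=
    Valuation.map_sub_eq_of_lt_left _ ((hc a).trans_lt hx1)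
  have hw : v (yFun W - algebraMap _ _ b) = v (yFun W) :=
    Valuation.map_sub_eq_of_lt_left _ ((hc b).trans_lt (hx1.trans hxy1))
  have hA1 : v (Affine.baseChange W (FunField W)).a₁ ≤ 1 := by
    have := hc (algebraMap K _ W.a₁)
    rwa [← algebraMap_K_eq] at this
  have hmem : ∀ c : SeparableClosure K, algebraMap _ (FunField W) c ∈ A.ring := A.algebraMap_mem
  have hmemK : ∀ c : K, algebraMap _ (FunField W) c ∈ A.ring := fun c => by
    rw [algebraMap_K_eq]; exact hmem _
  have hnat : ∀ m : ℕ, (m : FunField W) ∈ A.ring := fun m => natCast_mem _ m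
  have h2 : (2 : FunField W) ∈ A.ring := by exact_mod_cast hnat 2
  have h3 : (3 : FunField W) ∈ A.ring := by exact_mod_cast hnat 3
  set γ := (3 * algebraMap _ (FunField W) a ^ 2 + 2 * (Affine.baseChange W (FunField W)).a₂ *
    algebraMap _ _ a + (Affine.baseChange W (FunField W)).a₄ -
    (Affine.baseChange W (FunField W)).a₁ * algebraMap _ _ b) with hγ
  set β := (2 * algebraMap _ (FunField W) b + (Affine.baseChange W (FunField W)).a₁ *
    algebraMap _ _ a + (Affine.baseChange W (FunField W)).a₃) with hβ
  have hγ1 : v γ ≤ 1 := by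
    rw [A.ring.valuation_le_one_iff]
    exact sub_mem (add_mem (add_mem (mul_mem h3 (pow_mem (hmem a) 2))
      (mul_mem (mul_mem h2 (hmemK _)) (hmem a))) (hmemK _)) (mul_mem (hmemK _) (hmem b))
  have hβ1 : v β ≤ 1 := by
    rw [A.ring.valuation_le_one_iff]
    exact add_mem (add_mem (mul_mem h2 (hmem b)) (mul_mem (hmemK _) (hmem a))) (hmemK _)
  have hδ1 : v (3 * algebraMap _ (FunField W) a + (Affine.baseChange W (FunField W)).a₂) ≤ 1 := by
    rw [A.ring.valuation_le_one_iff]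
    exact add_mem (mul_mem h3 (hmem a)) (hmemK _)
  have hy3 : v (yFun W) < v (xFun W) ^ 3 :=
    hyx2.trans (pow_lt_pow_right₀ hx1 (by norm_num))
  have hxy3 : v (xFun W) * v (yFun W) < v (xFun W) ^ 3 := by
    rw [pow_succ', mul_lt_mul_iff_right₀ hx0]
    exact hyx2
  have hx23 : v (xFun W) ^ 2 < v (xFun W) ^ 3 := pow_lt_pow_right₀ hx1 (by norm_num)
  have hx13 : v (xFun W) < v (xFun W) ^ 3 := hxy1.trans hy3
  have r1 : v (x₃ - algebraMap _ _ a) < 1 := by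
    have : v (x₃ - algebraMap _ _ a) * v (xFun W) ^ 2 < 1 * v (xFun W) ^ 2 := by
      rw [← hu, ← map_pow, ← map_mul, e1, map_pow, hu, one_mul]
      refine v.map_sub_lt ?_ ?_
      · rw [map_mul, hu]
        exact (mul_le_of_le_one_left' hγ1).trans_lt (hxy1.trans hyx2)
      · rw [map_mul, hw]
        exact (mul_le_of_le_one_left' hβ1).trans_lt hyx2
    exact lt_of_mul_lt_mul_right' this
  refine ⟨r1, ?_⟩
  have r2 : v (y₃ - algebraMap _ _ b + (Affine.baseChange W (FunField W)).a₁ *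
      (x₃ - algebraMap _ _ a)) < 1 := by
    have : v (y₃ - algebraMap _ _ b + (Affine.baseChange W (FunField W)).a₁ *
      (x₃ - algebraMap _ _ a)) * v (xFun W) ^ 3 < 1 * v (xFun W) ^ 3 := by
      rw [← hu, ← map_pow, ← map_mul, e2, map_pow, hu, one_mul, Valuation.map_neg]
      refine v.map_add_lt ?_ ?_
      · rw [map_mul, map_mul, hu, hw, mul_assoc]
        exact (mul_le_of_le_one_left' hγ1).trans_lt hxy3
      · rw [map_mul]
        refine (mul_le_of_le_one_left' hβ1).trans_lt ?_
        refine v.map_add_lt (v.map_sub_lt (v.map_sub_lt ?_ ?_) ?_) ?_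
        · rw [map_mul, map_mul, hu, hw, mul_assoc, mul_comm (v (yFun W))]
          exact (mul_le_of_le_one_left' hA1).trans_lt hxy3
        · rw [map_mul, map_pow, hu]
          exact (mul_le_of_le_one_left' hδ1).trans_lt hx23
        · rw [map_mul, hu]
          exact (mul_le_of_le_one_left' hγ1).trans_lt hx13
        · rw [map_mul, hw]
          exact (mul_le_of_le_one_left' hβ1).trans_lt hy3
    exact lt_of_mul_lt_mul_right' this
  have : y₃ - algebraMap _ _ b = (y₃ - algebraMap _ _ b + (Affine.baseChange W (FunField W)).a₁ *
      (x₃ - algebraMap _ _ a)) - (Affine.baseChange W (FunField W)).a₁ *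
      (x₃ - algebraMap _ _ a) := by ring
  rw [this]
  refine v.map_sub_lt r2 ?_
  rw [map_mul]
  exact (mul_le_of_le_one_left' hA1).trans_lt r1

end NearInfinity

/-! ### Places of points, and how translations move them -/

section PlaceOfPoint

variable {K : Type*} [Field K] {W : WeierstrassCurve K} [W.IsElliptic]

lemma isPlaceOf_some_iff {a b : SeparableClosure K}
    (h : (Affine.baseChange W (SeparableClosure K)).Nonsingular a b) (A : Pl W) :
    IsPlaceOf W A (.some a b h) ↔ A = finitePlace (ratPoint h) :=
  ratPoint_mem_iff h A

lemma isPlaceOf_unique {A B : Pl W} {P : Pts W} (hA : IsPlaceOf W A P) (hB : IsPlaceOf W B P) :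
    A = B := by
  rcases P with _ | ⟨a, b, h⟩
  · exact place_infinity_unique (V := Affine.baseChange W (SeparableClosure K)) A B hA hB
  · rw [isPlaceOf_some_iff] at hA hB
    rw [hA, hB]

variable (W) in
lemma exists_isPlaceOf (P : Pts W) : ∃ A : Pl W, IsPlaceOf W A P := by
  rcases P with _ | ⟨a, b, h⟩
  · exact exists_place_infinity (Affine.baseChange W (SeparableClosure K)) (FunField W)
  · exact ⟨_, (isPlaceOf_some_iff h _).mpr rfl⟩

variable (W) in
/-- The place of a point. -/
noncomputable def placeAt (P : Pts W) : Pl W := (exists_isPlaceOf W P).choose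

variable (W) in
lemma isPlaceOf_placeAt (P : Pts W) : IsPlaceOf W (placeAt W P) P :=
  (exists_isPlaceOf W P).choose_spec

lemma isPlaceOf_iff {A : Pl W} {P : Pts W} : IsPlaceOf W A P ↔ A = placeAt W P :=
  ⟨fun h => isPlaceOf_unique h (isPlaceOf_placeAt W P), fun h => h ▸ isPlaceOf_placeAt W P⟩

lemma placeAt_some {a b : SeparableClosure K}
    (h : (Affine.baseChange W (SeparableClosure K)).Nonsingular a b) :
    placeAt W (.some a b h) = finitePlace (ratPoint h) :=
  (isPlaceOf_some_iff h _).mp (isPlaceOf_placeAt W _)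

lemma placeAt_injective : Function.Injective (placeAt W) := by
  have h0 : ∀ {a b : SeparableClosure K}
    (h : (Affine.baseChange W (SeparableClosure K)).Nonsingular a b),
      placeAt W 0 ≠ placeAt W (.some a b h) := by
    intro a b h h'
    have h1 : xFun W ∉ (placeAt W 0).ring := isPlaceOf_placeAt W 0
    rw [h', placeAt_some] at h1
    exact h1 (coordX_mem_finitePlace _)
  rintro (_ | ⟨a, b, h⟩) (_ | ⟨c, d, h'⟩) hP
  · rfl
  · exact absurd hP (h0 h')
  · exact absurd hP.symm (h0 h)
  · rw [placeAt_some, placeAt_some] at hP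
    have h1 := (ratPoint_mem_iff h (finitePlace (ratPoint h) : Pl W)).mpr rfl
    have h2 := (ratPoint_mem_iff h' (finitePlace (ratPoint h) : Pl W)).mpr hP
    -- A function takes at most one constant value at a place, because nonzero constants have
    -- valuation 1.
    have key : ∀ (A : Pl W) (z : FunField W) (s t : SeparableClosure K),
        A.ring.valuation (z - algebraMap _ _ s) < 1 → A.ring.valuation (z - algebraMap _ _ t) < 1 →
        s = t := by
      intro A z s t hs ht
      by_contra hst
      have h3 : A.ring.valuation (algebraMap _ _ (t - s)) < 1 := by
        have := A.ring.valuation.map_sub (z - algebraMap _ _ s) (z - algebraMap _ _ t)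
        rw [sub_sub_sub_cancel_left, ← map_sub] at this
        exact this.trans_lt (max_lt hs ht)
      rw [(isTrivialOn A).eq_one _ (sub_ne_zero.mpr (Ne.symm hst))] at h3
      exact lt_irrefl _ h3
    have ha := key _ _ _ _ h1.1 h2.1
    have hb := key _ _ _ _ h1.2 h2.2
    subst ha hb
    rfl

/-- The semilinear automorphism that carries the generic point `X` to `X - P`. -/
noncomputable def semiAut (σ : GalK K) (P : Pts W) : semiGroup W :=
  ⟨(exists_isSemi σ P).choose, σ, (exists_isSemi σ P).choose_spec.1⟩

lemma isSemi_semiAut (σ : GalK K) (P : Pts W) :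
    IsSemi σ P (((semiAut σ P : semiGroup W) : FunField W ≃ₐ[K] FunField W) :
      FunField W →ₐ[K] FunField W) :=
  (exists_isSemi σ P).choose_spec

lemma eq_semiAut {σ : GalK K} {P : Pts W} {g : FunField W ≃ₐ[K] FunField W}
    (h : IsSemi σ P (g : FunField W →ₐ[K] FunField W)) : g = semiAut σ P := by
  have := h.ext (isSemi_semiAut σ P)
  exact AlgEquiv.ext fun f => AlgHom.congr_fun this f

open scoped Classical in
lemma semiAut_mul (σ τ : GalK K) (P Q : Pts W) :
    semiAut σ P * semiAut τ Q = semiAut (σ * τ) (P + ptsAct W σ Q) :=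
  Subtype.ext (eq_semiAut ((isSemi_semiAut σ P).comp (isSemi_semiAut τ Q)))

lemma semiAut_one : semiAut 1 (0 : Pts W) = 1 :=
  (Subtype.ext (eq_semiAut isSemi_id)).symm

lemma semiAut_algebraMap (σ : GalK K) (P : Pts W) (a : SeparableClosure K) :
    ((semiAut σ P : semiGroup W) : FunField W ≃ₐ[K] FunField W) (algebraMap _ _ a) =
      algebraMap _ _ (σ a) :=
  (isSemi_semiAut σ P).1 a

open scoped Classical in
lemma semiAut_inv (σ : GalK K) (P : Pts W) :
    (semiAut σ P)⁻¹ = semiAut σ⁻¹ (-(ptsAct W σ⁻¹ P)) := by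
  rw [inv_eq_iff_mul_eq_one, semiAut_mul, map_neg, ← ptsAct_mul, mul_inv_cancel, ptsAct_one,
    add_neg_cancel, semiAut_one]

lemma semiAut_zero_xFun (σ : GalK K) :
    ((semiAut σ (0 : Pts W) : semiGroup W) : FunField W ≃ₐ[K] FunField W) (xFun W) = xFun W ∧
    ((semiAut σ (0 : Pts W) : semiGroup W) : FunField W ≃ₐ[K] FunField W) (yFun W) = yFun W := by
  classical
  have h := (isSemi_semiAut σ (0 : Pts W)).2
  rw [map_zero, sub_zero] at h
  exact Affine.Point.some.inj h

open scoped Classical in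
/-- The coordinates of the translate of the generic point by a constant point. -/
lemma semiAut_coord (σ : GalK K) {P : Pts W} {a b : SeparableClosure K}
    {h : (Affine.baseChange W (SeparableClosure K)).Nonsingular a b} (hP : -P = .some a b h) :
    xFun W ≠ algebraMap _ _ a ∧
    ((semiAut σ P : semiGroup W) : FunField W ≃ₐ[K] FunField W) (xFun W) =
      (Affine.baseChange W (FunField W)).addX (xFun W) (algebraMap _ _ a)
        ((yFun W - algebraMap _ _ b) / (xFun W - algebraMap _ _ a)) ∧
    ((semiAut σ P : semiGroup W) : FunField W ≃ₐ[K] FunField W) (yFun W) =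
      (Affine.baseChange W (FunField W)).addY (xFun W) (algebraMap _ _ a) (yFun W)
        ((yFun W - algebraMap _ _ b) / (xFun W - algebraMap _ _ a)) := by
  have hne : xFun W ≠ algebraMap _ _ a := by
    intro hx
    refine transcendental_coordX (Affine.baseChange W (SeparableClosure K)) (FunField W) ?_
    change IsAlgebraic _ (xFun W)
    rw [hx]
    exact isAlgebraic_algebraMap a
  have h1 := (isSemi_semiAut σ P).2
  rw [sub_eq_add_neg, ← map_neg, hP] at h1
  change Affine.Point.some _ _ _ = Affine.Point.some (xFun W) (yFun W) _ +
    Affine.Point.some (algebraMap _ _ a) (algebraMap _ _ b) _ at h1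
  have h2 := Affine.Point.some.inj (h1.trans (Affine.Point.add_of_X_ne hne))
  rw [Affine.slope_of_X_ne hne] at h2
  exact ⟨hne, h2⟩

-- For P = (a, b), pulling x - a and y - b back to O by the inverse automorphism, which carries X to
-- X + σ⁻¹P, gives the differences of `valuation_near_infinity`.
open scoped Classical in
lemma semiAut_smul_placeAt_zero (σ : GalK K) (P : Pts W) :
    semiAut σ P • placeAt W 0 = placeAt W P := by
  rw [← isPlaceOf_iff]
  have h0 : xFun W ∉ (placeAt W 0).ring := isPlaceOf_placeAt W 0
  rcases P with _ | ⟨a, b, h⟩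
  · change xFun W ∉ _
    rw [← (semiAut_zero_xFun (W := W) σ).1]
    exact mt apply_mem_smul_ring_iff.mp h0
  · have hneg : -(-(ptsAct W σ⁻¹ (.some a b h))) = .some (σ⁻¹ a) (σ⁻¹ b)
        ((Affine.baseChange_nonsingular W
          (f := ((σ⁻¹ : GalK K) : SeparableClosure K →ₐ[K] SeparableClosure K))
          (σ⁻¹ : GalK K).injective _ _).mpr h) := by
      rw [neg_neg]; rfl
    obtain ⟨hne, hx, hy⟩ := semiAut_coord σ⁻¹ hneg
    have hE := valuation_near_infinity h0 (a := σ⁻¹ a) (b := σ⁻¹ b)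
      ((Affine.baseChange_nonsingular W
          (f := ((σ⁻¹ : GalK K) : SeparableClosure K →ₐ[K] SeparableClosure K))
          (σ⁻¹ : GalK K).injective _ _).mpr h).1 hne
    rw [← hx, ← hy, ← semiAut_inv] at hE
    have key : ∀ (z : FunField W) (c : SeparableClosure K),
        ((semiAut σ (.some a b h : Pts W) : semiGroup W) : FunField W ≃ₐ[K] FunField W).symm
          (z - algebraMap _ _ c) = (((semiAut σ (.some a b h : Pts W))⁻¹ : semiGroup W) :
            FunField W ≃ₐ[K] FunField W) z - algebraMap _ _ (σ⁻¹ c) := by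
      intro z c
      rw [← semiGroup_inv_apply, map_sub]
      congr 1
      rw [semiAut_inv, semiAut_algebraMap]
    refine ⟨?_, ?_⟩
    · rw [valuation_smul_lt_one_iff, key]
      exact hE.1
    · rw [valuation_smul_lt_one_iff, key]
      exact hE.2

open scoped Classical in
lemma semiAut_smul_placeAt (σ : GalK K) (P Q : Pts W) :
    semiAut σ P • placeAt W Q = placeAt W (P + ptsAct W σ Q) := by
  rw [← semiAut_smul_placeAt_zero 1 Q, smul_smul, semiAut_mul, semiAut_smul_placeAt_zero]

end PlaceOfPoint

/-! ### Residue fields of places and their dimension -/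

section ResidueSpace

variable {k F : Type*} [Field k] [Field F] [Algebra k F]

/-- The valuation ring of a place, as a subspace. -/
def Place.ringSubmodule (A : Place k F) : Submodule k F where
  carrier := A.ring
  add_mem' := fun ha hb => add_mem ha hb
  zero_mem' := zero_mem A.ring
  smul_mem' c f hf := by
    rw [Algebra.smul_def]
    exact mul_mem (A.algebraMap_mem c) hf

/-- The maximal ideal of the valuation ring of a place, as a subspace of the ring. -/
def Place.maxSubmodule (A : Place k F) : Submodule k A.ringSubmodule where
  carrier := {f | A.ring.valuation (f : F) < 1}
  add_mem' := fun ha hb => A.ring.valuation.map_add_lt ha hb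
  zero_mem' := by simp
  smul_mem' c f hf := by
    change A.ring.valuation (c • (f : F)) < 1
    rw [Algebra.smul_def, map_mul]
    exact (mul_le_of_le_one_left' ((A.ring.valuation_le_one_iff _).mpr
      (A.algebraMap_mem c))).trans_lt hf

variable {V : Affine k} [V.IsElliptic] [Algebra V.CoordinateRing F]
  [IsFractionRing V.CoordinateRing F] [IsScalarTower k V.CoordinateRing F]

/-- An element of the localization is n/d with d outside the prime, and is congruent to un for u
inverse to d modulo the prime. -/
lemma exists_sub_algebraMap_lt_one (v : HeightOneSpectrum V.CoordinateRing) {f : F}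
    (hf : f ∈ (finitePlace (F := F) v).ring) :
    ∃ r : V.CoordinateRing, (finitePlace (F := F) v).ring.valuation (f - algebraMap _ F r) < 1 := by
  obtain ⟨n, d, hnd⟩ := v.exists_primeCompl_mul_eq_of_integer f hf
  have hmax := v.isMaximal
  obtain ⟨u, i, hi, hu⟩ := hmax.exists_inv d.2
  refine ⟨u * n, ?_⟩
  have hi' := (mem_asIdeal_iff (F := F) v i).mp hi
  have e : f - algebraMap V.CoordinateRing F (u * n) = f * algebraMap V.CoordinateRing F i := by
    have hu' := congrArg (algebraMap V.CoordinateRing F) hu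
    rw [map_add, map_mul, map_one] at hu'
    rw [map_mul, ← hnd]
    linear_combination f * -hu'
  rw [e, map_mul]
  exact (mul_le_of_le_one_left' ((ValuationSubring.valuation_le_one_iff _ _).mpr hf)).trans_lt hi'

/-- An automorphism over the constants that carries one closed point to another identifies the
residue fields. -/
lemma pointDegree_eq_finrank (v : HeightOneSpectrum V.CoordinateRing) (A : Place k F)
    (φ : F ≃ₐ[k] F) (h1 : ∀ f, φ f ∈ A.ring ↔ f ∈ (finitePlace (F := F) v).ring)
    (h2 : ∀ f, A.ring.valuation (φ f) < 1 ↔ (finitePlace (F := F) v).ring.valuation f < 1) :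
    pointDegree v = Module.finrank k (A.ringSubmodule ⧸ A.maxSubmodule) := by
  have hmem : ∀ r : V.CoordinateRing, φ (algebraMap _ F r) ∈ A.ringSubmodule := fun r =>
    (h1 _).mpr (v.valuation_le_one r)
  let j : V.CoordinateRing →ₗ[k] A.ringSubmodule :=
    (φ.toLinearMap ∘ₗ (IsScalarTower.toAlgHom k V.CoordinateRing F).toLinearMap).codRestrict _ hmem
  let q := A.maxSubmodule.mkQ ∘ₗ j
  have hq : Function.Surjective q := by
    intro z
    obtain ⟨⟨f, hf⟩, rfl⟩ := A.maxSubmodule.mkQ_surjective z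
    obtain ⟨f, rfl⟩ := φ.surjective f
    obtain ⟨r, hr⟩ := exists_sub_algebraMap_lt_one v ((h1 f).mp hf)
    refine ⟨r, ?_⟩
    rw [← h2, map_sub, Valuation.map_sub_swap] at hr
    exact (Submodule.Quotient.eq _).mpr hr
  have hker : LinearMap.ker q = v.asIdeal.restrictScalars k := by
    ext r
    rw [LinearMap.mem_ker, Submodule.restrictScalars_mem, mem_asIdeal_iff (F := F), ← h2]
    exact Submodule.Quotient.mk_eq_zero _
  rw [← (LinearMap.quotKerEquivOfSurjective q hq).finrank_eq, hker]
  rfl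

lemma pointDegree_eq_of_algEquiv (v w : HeightOneSpectrum V.CoordinateRing)
    (φ : F ≃ₐ[k] F)
    (h1 : ∀ f, φ f ∈ (finitePlace (F := F) w).ring ↔ f ∈ (finitePlace (F := F) v).ring)
    (h2 : ∀ f, (finitePlace (F := F) w).ring.valuation (φ f) < 1 ↔
      (finitePlace (F := F) v).ring.valuation f < 1) :
    pointDegree v = pointDegree w :=
  (pointDegree_eq_finrank v _ φ h1 h2).trans (pointDegree_eq_finrank w _ AlgEquiv.refl
    (fun _ => Iff.rfl) (fun _ => Iff.rfl)).symm

end ResidueSpace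

lemma HasDivisor.unique {k F : Type*} [Field k] [Field F] [Algebra k F] {f : F}
    {D D' : Place k F →₀ ℤ} (h : HasDivisor f D) (h' : HasDivisor f D') : D = D' :=
  Finsupp.ext fun A => (h A).unique (h' A)

/-! ### Degrees of divisors, and degree zero of principal divisors -/

section PlaceDegree

variable {K : Type*} [Field K] {W : WeierstrassCurve K} [W.IsElliptic]

open scoped Classical in
/-- The degree of a place. -/
noncomputable def placeDegree (A : Pl W) : ℕ :=
  -- The value 1 is attained by the place at infinity, which is the rational point O.
  if h : ∃ v : HeightOneSpectrum (CoordRing W), finitePlace v = A then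
    pointDegree (V := Affine.baseChange W (SeparableClosure K)) h.choose else 1

lemma placeDegree_finitePlace (v : HeightOneSpectrum (CoordRing W)) :
    placeDegree (finitePlace v : Pl W) =
      pointDegree (V := Affine.baseChange W (SeparableClosure K)) v := by
  have h : ∃ w : HeightOneSpectrum (CoordRing W), (finitePlace w : Pl W) = finitePlace v :=
    ⟨v, rfl⟩
  rw [placeDegree, dif_pos h, finitePlace_injective h.choose_spec]

lemma placeAt_cases (A : Pl W) :
    A = placeAt W 0 ∨ ∃ v : HeightOneSpectrum (CoordRing W), finitePlace v = A := by
  by_cases hA : xFun W ∈ A.ring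
  · exact .inr (exists_finitePlace A hA)
  · exact .inl (isPlaceOf_iff.mp hA)

lemma placeAt_zero_ne_finitePlace (v : HeightOneSpectrum (CoordRing W)) :
    placeAt W 0 ≠ finitePlace v := by
  intro h
  have h1 : xFun W ∉ (placeAt W 0).ring := isPlaceOf_placeAt W 0
  rw [h] at h1
  exact h1 (coordX_mem_finitePlace v)

lemma placeDegree_placeAt (P : Pts W) : placeDegree (placeAt W P) = 1 := by
  rcases P with _ | ⟨a, b, h⟩
  · rw [placeDegree, dif_neg]
    rintro ⟨v, hv⟩
    exact placeAt_zero_ne_finitePlace v hv.symm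
  · rw [placeAt_some, placeDegree_finitePlace, pointDegree_ratPoint]

open scoped Classical in
/-- Translations preserve the degree. -/
lemma placeDegree_smul (P : Pts W) (A : Pl W) :
    placeDegree (semiAut 1 P • A) = placeDegree A := by
  rcases placeAt_cases A with rfl | ⟨v, rfl⟩
  · rw [semiAut_smul_placeAt_zero, placeDegree_placeAt, placeDegree_placeAt]
  rcases placeAt_cases (semiAut 1 P • (finitePlace v : Pl W)) with h | ⟨w, hw⟩
  · rw [smul_eq_iff_eq_inv_smul, semiAut_inv, semiAut_smul_placeAt_zero] at h
    rw [h, semiAut_smul_placeAt, placeDegree_placeAt, placeDegree_placeAt]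
  · rw [← hw, placeDegree_finitePlace, placeDegree_finitePlace]
    let φ : FunField W ≃ₐ[SeparableClosure K] FunField W :=
      AlgEquiv.ofRingEquiv (f := ((semiAut 1 P : semiGroup W) :
        FunField W ≃ₐ[K] FunField W).toRingEquiv) (fun a => semiAut_algebraMap 1 P a)
    refine (pointDegree_eq_of_algEquiv (F := FunField W) v w φ (fun f => ?_) (fun f => ?_)).symm
    · rw [hw]
      exact apply_mem_smul_ring_iff
    · rw [hw]
      refine valuation_smul_lt_one_iff.trans ?_
      have e : ((semiAut 1 P : semiGroup W) : FunField W ≃ₐ[K] FunField W).symm (φ f) = f :=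
        AlgEquiv.symm_apply_apply _ f
      rw [e]

/-- The degree of a divisor. -/
noncomputable def divDegree : (Pl W →₀ ℤ) →+ ℤ :=
  Finsupp.liftAddHom fun A => AddMonoidHom.mulLeft (placeDegree A : ℤ)

lemma divDegree_single (A : Pl W) (m : ℤ) :
    divDegree (Finsupp.single A m) = placeDegree A * m := by
  rw [divDegree, Finsupp.liftAddHom_apply_single]
  rfl

/-- The degree of the norm counts both the zeros of r on the affine curve, with degrees, and the
order of its pole at O. -/
lemma exists_hasDivisor_algebraMap {r : CoordRing W} (hr : r ≠ 0) :
    ∃ D : Pl W →₀ ℤ, HasDivisor (algebraMap _ (FunField W) r) D ∧ divDegree D = 0 := by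
  classical
  have hr' : algebraMap (CoordRing W) (FunField W) r ≠ 0 := by simpa using hr
  have hfin : {v : HeightOneSpectrum (CoordRing W) |
      v.valuation (FunField W) (algebraMap _ _ r) ≠ 1}.Finite := by
    refine ((HeightOneSpectrum.Support.finite (CoordRing W)
      (algebraMap (CoordRing W) (FunField W) r)⁻¹)).subset fun v hv => ?_
    change 1 < v.valuation (FunField W) _
    rw [map_inv₀, one_lt_inv₀ (by simpa [zero_lt_iff] using hr)]
    exact lt_of_le_of_ne (v.valuation_le_one r) hv
  let S := hfin.toFinset
  have hS : ∀ v : HeightOneSpectrum (CoordRing W),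
      v.valuation (FunField W) (algebraMap _ _ r) ≠ 1 → v ∈ S := fun v hv => by simpa [S] using hv
  let d : HeightOneSpectrum (CoordRing W) → ℤ := fun v =>
    -WithZero.log (v.valuation (FunField W) (algebraMap _ _ r))
  let N : ℤ := (Algebra.norm (SeparableClosure K)[X] r).natDegree
  refine ⟨∑ v ∈ S, Finsupp.single (finitePlace v) (d v) - Finsupp.single (placeAt W 0) N, ?_, ?_⟩
  · intro A
    rw [Finsupp.sub_apply, Finsupp.finsetSum_apply]
    rcases placeAt_cases A with rfl | ⟨v, rfl⟩
    · rw [Finset.sum_eq_zero fun v _ => Finsupp.single_eq_of_ne (placeAt_zero_ne_finitePlace v),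
        Finsupp.single_eq_same, zero_sub]
      exact hasOrder_of_notMem (V := Affine.baseChange W (SeparableClosure K)) _
        (isPlaceOf_placeAt W 0) hr
    · rw [Finsupp.single_eq_of_ne (placeAt_zero_ne_finitePlace v).symm, sub_zero]
      have hsum : ∑ w ∈ S, Finsupp.single (finitePlace w : Pl W) (d w) (finitePlace v) = d v := by
        rw [Finset.sum_eq_single v]
        · exact Finsupp.single_eq_same
        · exact fun w _ hw => Finsupp.single_eq_of_ne fun h => hw (finitePlace_injective h).symm
        · intro hv
          have : v.valuation (FunField W) (algebraMap _ _ r) = 1 := by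
            by_contra h
            exact hv (hS v h)
          rw [Finsupp.single_eq_same]
          simp only [d, this]
          rw [WithZero.log_one, neg_zero]
      rw [hsum, hasOrder_finitePlace]
      simp only [d]
      rw [neg_neg, WithZero.exp_log]
      simpa using hr
  · rw [map_sub, map_sum, divDegree_single, placeDegree_placeAt, Nat.cast_one, one_mul,
      sub_eq_zero]
    simp only [divDegree_single, placeDegree_finitePlace]
    exact (natDegree_norm_eq_sum (V := Affine.baseChange W (SeparableClosure K))
      (F := FunField W) hr S hS).symm

lemma exists_hasDivisor {f : FunField W} (hf : f ≠ 0) :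
    ∃ D : Pl W →₀ ℤ, HasDivisor f D ∧ divDegree D = 0 := by
  obtain ⟨r, s, hs, rfl⟩ := IsFractionRing.div_surjective (A := CoordRing W) f
  have hr : r ≠ 0 := by
    rintro rfl
    simp at hf
  obtain ⟨D, hD, h0⟩ := exists_hasDivisor_algebraMap hr
  obtain ⟨D', hD', h0'⟩ := exists_hasDivisor_algebraMap (nonZeroDivisors.ne_zero hs)
  refine ⟨D + -D', ?_, by rw [map_add, map_neg, h0, h0', neg_zero, add_zero]⟩
  rw [div_eq_mul_inv]
  exact hD.mul hD'.inv

end PlaceDegree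

/-! ### Nonzero translations fix no closed point -/

section Freeness

/-- The derivative of the Weierstrass equation along the secant through `(x, y)` and `(a, b)`. -/
lemma secant_derivative {F : Type*} [Field F] {V : Affine F} {x y a b : F}
    (h : V.Equation x y) (h' : V.Equation a b) (hx : x ≠ a) :
    V.a₁ * y - (3 * x ^ 2 + 2 * V.a₂ * x + V.a₄)
      + (y - b) / (x - a) * (2 * y + V.a₁ * x + V.a₃) =
      (x - a) * (V.addX x a ((y - b) / (x - a)) - x) := by
  rw [Affine.equation_iff] at h h'
  have hu : x - a ≠ 0 := sub_ne_zero.mpr hx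
  set ℓ := (y - b) / (x - a) with hℓ
  have hb : b = y - ℓ * (x - a) := by rw [hℓ, div_mul_cancel₀ _ hu]; ring
  rw [Affine.addX]
  apply mul_left_cancel₀ hu
  rw [hb] at h'
  linear_combination h - h'

variable {K : Type*} [Field K] {W : WeierstrassCurve K} [W.IsElliptic]

/-- The residue field is finite over the separably closed field Kˢᵉᵖ, hence purely inseparable. -/
lemma exists_pow_sub_mem (v : HeightOneSpectrum (CoordRing W)) (q : ℕ)
    [ExpChar (SeparableClosure K) q] (r : CoordRing W) :
    ∃ (m : ℕ) (c : SeparableClosure K), r ^ q ^ m - algebraMap _ _ c ∈ v.asIdeal := by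
  have := v.isMaximal
  let _ : Field (CoordRing W ⧸ v.asIdeal) := Ideal.Quotient.field v.asIdeal
  have hfin : Module.Finite (SeparableClosure K) (CoordRing W ⧸ v.asIdeal) :=
    finite_quotient v.ne_bot
  obtain ⟨m, c, hc⟩ := IsPurelyInseparable.pow_mem (SeparableClosure K) q
    (Ideal.Quotient.mk v.asIdeal r)
  refine ⟨m, c, ?_⟩
  rw [← Ideal.Quotient.eq, map_pow, ← hc]
  rfl

/-- An automorphism over the constants that fixes a closed point acts trivially on its residue
field, which is purely inseparable over the constants. -/
lemma valuation_apply_sub_lt_one {P : Pts W} (v : HeightOneSpectrum (CoordRing W))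
    (hP : semiAut 1 P • (finitePlace v : Pl W) = finitePlace v) (r : CoordRing W) :
    (finitePlace v : Pl W).ring.valuation
      (((semiAut 1 P : semiGroup W) : FunField W ≃ₐ[K] FunField W) (algebraMap _ _ r)
        - algebraMap _ _ r) < 1 := by
  obtain ⟨q, hq⟩ := ExpChar.exists (SeparableClosure K)
  obtain ⟨m, c, hc⟩ := exists_pow_sub_mem v q r
  have hq' : ExpChar (FunField W) q :=
    expChar_of_injective_algebraMap (algebraMap (SeparableClosure K) (FunField W)).injective q
  rw [mem_asIdeal_iff (F := FunField W), map_sub, map_pow,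
    ← IsScalarTower.algebraMap_apply (SeparableClosure K)] at hc
  set τ := ((semiAut 1 P : semiGroup W) : FunField W ≃ₐ[K] FunField W) with hτ
  set f := algebraMap (CoordRing W) (FunField W) r
  have h1 : (finitePlace v : Pl W).ring.valuation (τ f ^ q ^ m - algebraMap _ _ c) < 1 := by
    have h2 := valuation_smul_lt_one_iff (g := semiAut 1 P) (A := (finitePlace v : Pl W))
      (f := τ (f ^ q ^ m - algebraMap _ _ c))
    rw [hτ, AlgEquiv.symm_apply_apply, hP, map_sub, semiAut_algebraMap, map_pow] at h2
    exact h2.mpr hc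
  -- Both f and τf have the same q^m-th power c in the residue field, and Frobenius is additive
  -- there.
  have h3 : (τ f - f) ^ q ^ m =
      (τ f ^ q ^ m - algebraMap _ _ c) - (f ^ q ^ m - algebraMap _ _ c) := by
    rw [sub_pow_expChar_pow]
    ring
  have h4 := (finitePlace v : Pl W).ring.valuation.map_sub_lt h1 hc
  rw [← h3, map_pow] at h4
  by_contra! h5
  exact absurd h4 (not_lt.mpr (one_le_pow₀ h5))

/-- A smooth Weierstrass curve has no singular closed point. -/
lemma not_partial_derivatives_mem (v : HeightOneSpectrum (CoordRing W))
    (hX : (finitePlace v : Pl W).ring.valuation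
      ((Affine.baseChange W (FunField W)).a₁ * yFun W - (3 * xFun W ^ 2 +
        2 * (Affine.baseChange W (FunField W)).a₂ * xFun W
          + (Affine.baseChange W (FunField W)).a₄)) < 1)
    (hY : (finitePlace v : Pl W).ring.valuation
      (2 * yFun W + (Affine.baseChange W (FunField W)).a₁ * xFun W
        + (Affine.baseChange W (FunField W)).a₃) < 1) : False := by
  have := v.isMaximal
  let _ : Field (CoordRing W ⧸ v.asIdeal) := Ideal.Quotient.field v.asIdeal
  let i : K →+* CoordRing W :=
    (algebraMap (SeparableClosure K) (CoordRing W)).comp (algebraMap K (SeparableClosure K))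
  let V : Affine (CoordRing W ⧸ v.asIdeal) := W.map ((Ideal.Quotient.mk v.asIdeal).comp i)
  have hV : V.IsElliptic := inferInstanceAs (W.map _).IsElliptic
  let x : CoordRing W := Affine.CoordinateRing.mk _ (C X)
  let y : CoordRing W := Affine.CoordinateRing.mk _ X
  have hx : i W.a₁ * y - (3 * x ^ 2 + 2 * i W.a₂ * x + i W.a₄) ∈ v.asIdeal := by
    rw [mem_asIdeal_iff (F := FunField W)]
    simp only [map_sub, map_add, map_mul, map_pow, map_ofNat]
    exact hX
  have hy : 2 * y + i W.a₁ * x + i W.a₃ ∈ v.asIdeal := by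
    rw [mem_asIdeal_iff (F := FunField W)]
    simp only [map_add, map_mul, map_ofNat]
    exact hY
  have heq : y ^ 2 + i W.a₁ * x * y + i W.a₃ * y =
      x ^ 3 + i W.a₂ * x ^ 2 + i W.a₄ * x + i W.a₆ := by
    apply IsFractionRing.injective (CoordRing W) (FunField W)
    simp only [map_add, map_mul, map_pow]
    exact (Affine.equation_iff _ _).mp (equation_xFun_yFun W)
  have hE : V.Equation (Ideal.Quotient.mk _ x) (Ideal.Quotient.mk _ y) := by
    rw [Affine.equation_iff]
    have := congrArg (Ideal.Quotient.mk v.asIdeal) heq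
    simp only [map_add, map_mul, map_pow] at this
    exact this
  rw [Affine.equation_iff_nonsingular, Affine.nonsingular_iff'] at hE
  rw [← Ideal.Quotient.eq_zero_iff_mem] at hx hy
  simp only [map_sub, map_add, map_mul, map_pow, map_ofNat] at hx hy
  exact hE.2.elim (fun h => h hx) (fun h => h hy)

/-- A fixed closed point gives (x, y) + (a, b) ≡ (x, y) in its residue field, with (a, b) = -P. The
addition formulas and `secant_derivative` then make both partial derivatives of the Weierstrass
equation vanish there, against smoothness. -/
lemma semiAut_smul_ne {P : Pts W} (hP : P ≠ 0) (A : Pl W) : semiAut 1 P • A ≠ A := by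
  classical
  intro hA
  rcases placeAt_cases A with rfl | ⟨v, rfl⟩
  · rw [semiAut_smul_placeAt_zero] at hA
    exact hP (placeAt_injective hA)
  rcases hneg : -P with _ | ⟨a, b, h⟩
  · exact hP (neg_eq_zero.mp hneg)
  obtain ⟨hne, hx, hy⟩ := semiAut_coord 1 hneg
  have h1 := valuation_apply_sub_lt_one v hA (Affine.CoordinateRing.mk _ (C X))
  have h2 := valuation_apply_sub_lt_one v hA (Affine.CoordinateRing.mk _ X)
  change (finitePlace v : Pl W).ring.valuation (_ - xFun W) < 1 at h1
  change (finitePlace v : Pl W).ring.valuation (_ - yFun W) < 1 at h2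
  change ((semiAut 1 P : semiGroup W) : FunField W ≃ₐ[K] FunField W) (xFun W) = _ at hx
  rw [show algebraMap (CoordRing W) (FunField W) (Affine.CoordinateRing.mk _ (C X)) = xFun W
    from rfl, hx] at h1
  rw [show algebraMap (CoordRing W) (FunField W) (Affine.CoordinateRing.mk _ X) = yFun W
    from rfl, hy] at h2
  set A : Pl W := finitePlace v
  have hE : (Affine.baseChange W (FunField W)).Equation (algebraMap _ (FunField W) a)
      (algebraMap _ (FunField W) b) :=
    h.1.baseChange (IsScalarTower.toAlgHom K (SeparableClosure K) (FunField W))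
  have hsec := secant_derivative (equation_xFun_yFun W) hE hne
  set ℓ := (yFun W - algebraMap (SeparableClosure K) (FunField W) b) /
    (xFun W - algebraMap (SeparableClosure K) (FunField W) a) with hℓ
  set x₃ := (Affine.baseChange W (FunField W)).addX (xFun W) (algebraMap _ _ a) ℓ with hx₃
  have hxA : xFun W ∈ A.ring := coordX_mem_finitePlace v
  have hyA : yFun W ∈ A.ring := v.valuation_le_one _
  have hL : ∀ c : SeparableClosure K, algebraMap _ (FunField W) c ∈ A.ring := A.algebraMap_mem
  have hK : ∀ c : K, algebraMap _ (FunField W) c ∈ A.ring := fun c => by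
    rw [algebraMap_K_eq]; exact hL _
  have hx3A : x₃ ∈ A.ring := by
    have := add_mem ((A.ring.valuation_le_one_iff _).mp h1.le) hxA
    rwa [sub_add_cancel] at this
  -- The formula for the x-coordinate of a sum is a monic quadratic equation for the slope ℓ with
  -- coefficients in the valuation ring.
  have hℓA : ℓ ∈ A.ring := by
    have hint : IsIntegral A.ring ℓ := by
      let c₁ : A.ring := ⟨_, hK W.a₁⟩
      let c₀ : A.ring := ⟨_, add_mem (add_mem (add_mem hx3A (hK W.a₂)) hxA) (hL a)⟩
      refine ⟨X ^ 2 + C c₁ * X - C c₀, ?_, ?_⟩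
      · monicity!
      · simp only [eval₂_sub, eval₂_add, eval₂_mul, eval₂_pow, eval₂_X, eval₂_C]
        change ℓ ^ 2 + (Affine.baseChange W (FunField W)).a₁ * ℓ -
          (x₃ + (Affine.baseChange W (FunField W)).a₂ + xFun W + algebraMap _ _ a) = 0
        rw [hx₃, Affine.addX]
        ring
    obtain ⟨z, hz⟩ := IsIntegrallyClosed.isIntegral_iff.mp hint
    rw [← hz]
    exact z.2
  have hlt : ∀ {c z : FunField W}, c ∈ A.ring → A.ring.valuation z < 1 →
      A.ring.valuation (c * z) < 1 := fun hc hz => by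
    rw [map_mul]
    exact (mul_le_of_le_one_left' ((A.ring.valuation_le_one_iff _).mpr hc)).trans_lt hz
  have hY : A.ring.valuation (2 * yFun W + (Affine.baseChange W (FunField W)).a₁ * xFun W
        + (Affine.baseChange W (FunField W)).a₃) < 1 := by
    have e : 2 * yFun W + (Affine.baseChange W (FunField W)).a₁ * xFun W
        + (Affine.baseChange W (FunField W)).a₃ =
        -(((Affine.baseChange W (FunField W)).addY (xFun W) (algebraMap _ _ a) (yFun W) ℓ - yFun W)
          + (ℓ + (Affine.baseChange W (FunField W)).a₁) * (x₃ - xFun W)) := by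
      rw [Affine.addY, Affine.negY, Affine.negAddY, ← hx₃]
      ring
    rw [e, Valuation.map_neg]
    exact A.ring.valuation.map_add_lt h2 (hlt (add_mem hℓA (hK W.a₁)) h1)
  refine not_partial_derivatives_mem v ?_ hY
  have e := eq_sub_of_add_eq hsec
  rw [e]
  exact A.ring.valuation.map_sub_lt (hlt (sub_mem hxA (hL a)) h1) (hlt hℓA hY)

end Freeness

/-! ### The extended theta group of n[O] -/

section ThetaGroup

variable {K : Type*} [Field K] (W : WeierstrassCurve K)

/-- The action of semilinear automorphisms on nonzero functions. -/
noncomputable def unitsAut : semiGroup W →* MulAut (FunField W)ˣ where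
  toFun g := Units.mapEquiv (g : FunField W ≃ₐ[K] FunField W).toMulEquiv
  map_one' := by ext; rfl
  map_mul' _ _ := by ext; rfl

/-- Pairs `(f, g)` of a nonzero function and a semilinear automorphism; such a pair is regarded as
the operator `a ↦ f * g a`. -/
abbrev SemiOp : Type _ := (FunField W)ˣ ⋊[unitsAut W] semiGroup W

variable {W}

lemma semiOp_mul_left (u v : SemiOp W) : ((u * v).left : FunField W) =
    u.left * (u.right : FunField W ≃ₐ[K] FunField W) (v.left : FunField W) := rfl

noncomputable instance : DistribMulAction (SemiOp W) (FunField W) where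
  smul u a := u.left * (u.right : FunField W ≃ₐ[K] FunField W) a
  one_smul a := one_mul a
  mul_smul u v a := by
    change ((u * v).left : FunField W) * _ = _ * (u.right : FunField W ≃ₐ[K] FunField W) (_ * _)
    rw [semiOp_mul_left, map_mul, mul_assoc]
    rfl
  smul_zero u := by
    change _ * (u.right : FunField W ≃ₐ[K] FunField W) 0 = 0
    rw [map_zero, mul_zero]
  smul_add u a b := by
    change _ * (u.right : FunField W ≃ₐ[K] FunField W) (a + b) = _ * _ + _ * _
    rw [map_add, mul_add]

lemma semiOp_smul_def (u : SemiOp W) (a : FunField W) :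
    u • a = u.left * (u.right : FunField W ≃ₐ[K] FunField W) a := rfl

variable (W) in
/-- Multiplication by a constant. -/
noncomputable def constOp : (SeparableClosure K)ˣ →* SemiOp W :=
  SemidirectProduct.inl.comp (Units.map (algebraMap (SeparableClosure K) (FunField W)).toMonoidHom)

lemma constOp_left (c : (SeparableClosure K)ˣ) :
    ((constOp W c).left : FunField W) = algebraMap (SeparableClosure K) (FunField W) c := rfl

lemma constOp_right (c : (SeparableClosure K)ˣ) : (constOp W c).right = 1 := rfl

lemma constOp_injective : Function.Injective (constOp W) :=
  SemidirectProduct.inl_injective.comp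
    (Units.map_injective (algebraMap (SeparableClosure K) (FunField W)).injective)

/-- Constants are central only for elements over translations (`constOp_commute`); in general the
twist by σ is the source of the Galois action in the 2-cocycles. -/
lemma mul_constOp {u : SemiOp W} {σ : GalK K}
    (hσ : ∀ a : SeparableClosure K, (u.right : FunField W ≃ₐ[K] FunField W) (algebraMap _ _ a) =
      algebraMap _ _ (σ a)) (c : (SeparableClosure K)ˣ) :
    u * constOp W c = constOp W (unitsAct K σ c) * u := by
  apply SemidirectProduct.ext
  · ext
    rw [semiOp_mul_left, semiOp_mul_left, constOp_left, hσ, constOp_left, mul_comm]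
    rfl
  · rw [SemidirectProduct.mul_right, SemidirectProduct.mul_right, constOp_right, constOp_right,
      mul_one, one_mul]

variable [W.IsElliptic]

lemma mul_constOp_of_right {u : SemiOp W} {σ : GalK K} {P : Pts W} (hu : u.right = semiAut σ P)
    (c : (SeparableClosure K)ˣ) : u * constOp W c = constOp W (unitsAct K σ c) * u :=
  mul_constOp (fun a => by rw [hu, semiAut_algebraMap]) c

lemma constOp_commute {u : SemiOp W} {P : Pts W} (hu : u.right = semiAut 1 P)
    (c : (SeparableClosure K)ˣ) : Commute (constOp W c) u := by
  refine ((mul_constOp_of_right hu c).trans ?_).symm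
  congr 2

variable (W) in
/-- The theta group of the line bundle of `n[O]`, extended by the Galois group. -/
noncomputable def thetaGroup (n : ℕ) : Subgroup (SemiOp W) where
  carrier := {u | HasDivisor (u.left : FunField W)
    (Finsupp.single (u.right • placeAt W 0) (n : ℤ) - Finsupp.single (placeAt W 0) (n : ℤ))}
  one_mem' := by
    have : HasDivisor (1 : FunField W) (0 : Pl W →₀ ℤ) := fun A =>
      (hasOrder_zero_iff (Affine.baseChange W (SeparableClosure K)) A).mpr (map_one _)
    simpa using this
  mul_mem' := by
    intro u v hu hv
    have h := HasDivisor.mul hu (HasDivisor.smul hv u.right)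
    rw [Set.mem_ofPred_eq, semiOp_mul_left]
    -- With g and g' the automorphisms of u and v, the divisors n[gO] - n[O] and g(n[g'O] - n[O])
    -- telescope.
    convert h using 1
    rw [Finsupp.mapDomain_sub, Finsupp.mapDomain_single, Finsupp.mapDomain_single, smul_smul,
      SemidirectProduct.mul_right]
    abel
  inv_mem' := by
    intro u hu
    have h := (HasDivisor.smul hu u.right⁻¹).inv
    have e : ((u⁻¹ : SemiOp W).left : FunField W) =
        (((u.right⁻¹ : semiGroup W) : FunField W ≃ₐ[K] FunField W) (u.left : FunField W))⁻¹ := by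
      rw [SemidirectProduct.inv_left, map_inv, Units.val_inv_eq_inv_val]
      rfl
    rw [Set.mem_ofPred_eq, e]
    convert h using 1
    rw [Finsupp.mapDomain_sub, Finsupp.mapDomain_single, Finsupp.mapDomain_single, inv_smul_smul,
      SemidirectProduct.inv_right, neg_sub]

lemma mem_thetaGroup_iff {n : ℕ} {u : SemiOp W} : u ∈ thetaGroup W n ↔
    HasDivisor (u.left : FunField W)
      (Finsupp.single (u.right • placeAt W 0) (n : ℤ) - Finsupp.single (placeAt W 0) (n : ℤ)) :=
  Iff.rfl

lemma constOp_mem_thetaGroup (n : ℕ) (c : (SeparableClosure K)ˣ) :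
    constOp W c ∈ thetaGroup W n := by
  rw [mem_thetaGroup_iff, constOp_right, one_smul, sub_self]
  intro A
  exact (hasOrder_zero_iff (Affine.baseChange W (SeparableClosure K)) A).mpr
    ((isTrivialOn A).eq_one _ c.ne_zero)

/-- Elements of the theta group are determined by the automorphism up to constants. -/
lemma exists_eq_constOp_mul {n : ℕ} {u v : SemiOp W} (hu : u ∈ thetaGroup W n)
    (hv : v ∈ thetaGroup W n) (h : u.right = v.right) : ∃ c, u = constOp W c * v := by
  rw [mem_thetaGroup_iff] at hu hv
  rw [h] at hu
  obtain ⟨c, hc, hcf⟩ :=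
    exists_eq_mul_of_hasDivisor (Affine.baseChange W (SeparableClosure K)) hu hv
  refine ⟨Units.mk0 c hc, SemidirectProduct.ext ?_ ?_⟩
  · ext
    rw [semiOp_mul_left, hcf]
    rfl
  · rw [SemidirectProduct.mul_right, constOp_right, one_mul, h]

variable (W) in
/-- The Galois group, as a subgroup of the extended theta group. -/
noncomputable def galOp : GalK K →* SemiOp W where
  toFun σ := SemidirectProduct.inr (semiAut σ 0)
  map_one' := by rw [semiAut_one, map_one]
  map_mul' σ τ := by
    classical
    rw [← map_mul, semiAut_mul, map_zero, add_zero]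

lemma galOp_right (σ : GalK K) : (galOp W σ).right = semiAut σ 0 := rfl

lemma galOp_left (σ : GalK K) : (galOp W σ).left = 1 := rfl

lemma galOp_mem_thetaGroup (n : ℕ) (σ : GalK K) : galOp W σ ∈ thetaGroup W n := by
  rw [mem_thetaGroup_iff, galOp_right, semiAut_smul_placeAt_zero, sub_self, galOp_left]
  intro A
  exact (hasOrder_zero_iff (Affine.baseChange W (SeparableClosure K)) A).mpr (map_one _)

/-- Torsion points lift to the theta group, by means of functions without poles outside `O`. -/
lemma exists_mem_thetaGroup {n : ℕ} (P : nTorsion W n) :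
    ∃ u ∈ thetaGroup W n, u.right = semiAut 1 (P : Pts W) ∧
      ∃ r : CoordRing W, (u.left : FunField W) = algebraMap _ _ r := by
  classical
  obtain ⟨P, hP⟩ := P
  rcases P with _ | ⟨a, b, h⟩
  · exact ⟨1, one_mem _, semiAut_one.symm, 1, by simp⟩
  · have hP' : n • (Affine.Point.some a b h : Pts W) = 0 := hP
    obtain ⟨r, hr⟩ := exists_span_eq_pow (V := Affine.baseChange W (SeparableClosure K)) h hP'
    have hdiv := hasDivisor_of_span_eq_pow (F := FunField W) h hr (placeAt W 0)
      (isPlaceOf_placeAt W 0)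
    have h0 : algebraMap _ (FunField W) r ≠ 0 := (hdiv (placeAt W 0)).ne_zero
    refine ⟨⟨Units.mk0 _ h0, semiAut 1 (.some a b h)⟩, ?_, rfl, r, rfl⟩
    rw [mem_thetaGroup_iff, semiAut_smul_placeAt_zero, placeAt_some]
    exact hdiv

end ThetaGroup

/-- An invariant function with finite support sums, over a free action of a finite group, to a
multiple of the order of the group. -/
lemma card_dvd_sum_of_free {G X : Type*} [Group G] [Finite G] [MulAction G X]
    (hfree : ∀ (g : G) (x : X), g • x = x → g = 1) (S : Finset X)
    (hS : ∀ (g : G), ∀ x ∈ S, g • x ∈ S)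
    (φ : X → ℤ) (hφ : ∀ (g : G) (x : X), φ (g • x) = φ x) : (Nat.card G : ℤ) ∣ ∑ x ∈ S, φ x := by
  classical
  have := Fintype.ofFinite G
  rw [← Finset.sum_fiberwise_of_maps_to
    (g := fun x => (Quotient.mk'' x : MulAction.orbitRel.Quotient G X))
    (t := S.image fun x => (Quotient.mk'' x : MulAction.orbitRel.Quotient G X))
    fun x hx => Finset.mem_image_of_mem _ hx]
  refine Finset.dvd_sum fun ω hω => ?_
  obtain ⟨x, hx, rfl⟩ := Finset.mem_image.mp hω
  have hinj : Function.Injective fun g : G => g • x := by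
    intro g h hgh
    have : (h⁻¹ * g) • x = x := by rw [mul_smul, inv_smul_eq_iff]; exact hgh
    exact (inv_mul_eq_one.mp (hfree _ _ this)).symm
  -- S is stable, so its fibre over an orbit is the whole orbit, in bijection with G by freeness.
  have hfib : S.filter (fun y => (Quotient.mk'' y : MulAction.orbitRel.Quotient G X) =
      Quotient.mk'' x) = Finset.univ.image fun g : G => g • x := by
    ext y
    rw [Finset.mem_filter, Finset.mem_image, Quotient.eq'', MulAction.orbitRel_apply]
    constructor
    · rintro ⟨-, g, hg⟩
      exact ⟨g, Finset.mem_univ _, hg⟩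
    · rintro ⟨g, -, rfl⟩
      exact ⟨hS g x hx, g, rfl⟩
  rw [hfib, Finset.sum_image fun g _ h _ hgh => hinj hgh, Finset.sum_congr rfl fun g _ => hφ g x,
    Finset.sum_const, Finset.card_univ, Nat.card_eq_fintype_card, nsmul_eq_mul]
  exact dvd_mul_right _ _

/-! ### Descent of the line bundle along a lifted group of translations -/

section Descent

variable {K : Type*} [Field K] {W : WeierstrassCurve K} [W.IsElliptic]

/-- If a group of translations lifts to the theta group of a line bundle, then the line bundle
descends to the quotient, so that the order of the group divides the degree. -/
lemma card_dvd_of_lift {G : Type*} [Group G] [Finite G] {n : ℕ} (T : G →* SemiOp W)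
    (hT : ∀ g, T g ∈ thetaGroup W n)
    (hG : ∀ g, ∃ P : Pts W, (T g).right = semiAut 1 P ∧ (P = 0 → g = 1)) :
    Nat.card G ∣ n := by
  classical
  have := Fintype.ofFinite G
  let r : G →* semiGroup W := SemidirectProduct.rightHom.comp T
  have hr : ∀ g, r g = (T g).right := fun g => rfl
  have hrinj : Function.Injective r := by
    rw [injective_iff_map_eq_one]
    intro g hg
    obtain ⟨P, hP, h⟩ := hG g
    refine h (placeAt_injective ?_)
    rw [← semiAut_smul_placeAt_zero 1 P, ← hP, ← hr, hg, one_smul]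
  let _ : MulAction G (Pl W) := MulAction.compHom _ r
  have hsmul : ∀ (g : G) (A : Pl W), g • A = (T g).right • A := fun _ _ => rfl
  have hfree : ∀ (g : G) (A : Pl W), g • A = A → g = 1 := by
    intro g A h
    obtain ⟨P, hP, h1⟩ := hG g
    by_contra hg
    rw [hsmul, hP] at h
    exact semiAut_smul_ne (mt h1 hg) A h
  have hdeg : ∀ (g : G) (A : Pl W), placeDegree (g • A) = placeDegree A := by
    intro g A
    obtain ⟨P, hP, -⟩ := hG g
    rw [hsmul, hP, placeDegree_smul]
  -- Distinct automorphisms are linearly independent (Dedekind), so the averaging operator, whose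
  -- coefficients are nonzero, is not zero.
  obtain ⟨a, ha⟩ : ∃ a : FunField W, ∑ g : G, T g • a ≠ 0 := by
    by_contra! hcon
    have hli := (linearIndependent_monoidHom (FunField W) (FunField W)).comp
      (fun g : G => (((r g : FunField W ≃ₐ[K] FunField W) : FunField W →+* FunField W) :
        FunField W →* FunField W)) (by
          intro g h hgh
          apply hrinj
          apply Subtype.ext
          exact AlgEquiv.ext fun f => DFunLike.congr_fun hgh f)
    rw [Fintype.linearIndependent_iff] at hli
    have := hli (fun g => ((T g).left : FunField W)) (by
      funext a
      rw [Finset.sum_apply]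
      exact hcon a) 1
    exact (T 1).left.ne_zero this
  set θ := ∑ g : G, T g • a with hθ
  have hinv : ∀ g, T g • θ = θ := by
    intro g
    rw [hθ, Finset.smul_sum]
    simp only [← mul_smul, ← map_mul]
    exact Fintype.sum_equiv (Equiv.mulLeft g) _ _ fun _ => rfl
  obtain ⟨D₀, hD₀, hdeg₀⟩ := exists_hasDivisor ha
  set D := D₀ + Finsupp.single (placeAt W 0) (n : ℤ) with hD
  -- Invariance of θ under f·g(·) reads div θ = n[gO] - n[O] + g(div θ). Adding n[O] turns this into
  -- invariance of D under g.
  have hDinv : ∀ (g : G), D.mapDomain ((T g).right • ·) = D := by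
    intro g
    have h1 := (mem_thetaGroup_iff.mp (hT g)).mul (hD₀.smul (T g).right)
    rw [← semiOp_smul_def, hinv] at h1
    rw [hD, hD₀.unique h1]
    rw [Finsupp.mapDomain_add, Finsupp.mapDomain_single, ← hD₀.unique h1]
    have h2 := hD₀.unique h1
    nth_rewrite 2 [h2]
    abel
  have hDg : ∀ (g : G) (A : Pl W), D (g • A) = D A := by
    intro g A
    conv_lhs => rw [← hDinv g, mapDomain_smul_apply]
    rw [hsmul, inv_smul_smul]
  have hdegD : divDegree D = n := by
    rw [hD, map_add, hdeg₀, divDegree_single, placeDegree_placeAt, zero_add, Nat.cast_one, one_mul]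
  have hsum : divDegree D = ∑ A ∈ D.support, (placeDegree A : ℤ) * D A := rfl
  rw [hsum] at hdegD
  have hdvd := card_dvd_sum_of_free hfree D.support
    (fun g A hA => by rw [Finsupp.mem_support_iff, hDg]; exact Finsupp.mem_support_iff.mp hA)
    (fun A => (placeDegree A : ℤ) * D A) (fun g A => by rw [hdeg, hDg])
  rw [hdegD] at hdvd
  exact_mod_cast hdvd

end Descent

lemma pow_mul_pow_of_commutator {G : Type*} [Group G] {u v z : G} (h : u * v = z * (v * u))
    (hu : Commute z u) (hv : Commute z v) (i j : ℕ) :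
    u ^ i * v ^ j = z ^ (i * j) * (v ^ j * u ^ i) := by
  have h1 : ∀ j : ℕ, u * v ^ j = z ^ j * (v ^ j * u) := by
    intro j
    induction j with
    | zero => simp
    | succ j ih =>
      rw [pow_succ v, ← mul_assoc, ih, mul_assoc, mul_assoc, h, ← mul_assoc (v ^ j) z,
        ← (hv.pow_right j).eq, pow_succ z]
      simp only [mul_assoc]
  induction i with
  | zero => simp
  | succ i ih =>
    rw [pow_succ u, mul_assoc, h1, ← mul_assoc, ← (hu.pow_pow j i).eq, mul_assoc,
      ← mul_assoc (u ^ i), ih, add_mul, one_mul, add_comm, pow_add]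
    simp only [mul_assoc]

/-! ### Lifts of torsion points and their commutator pairing -/

section WeilPairing

variable {K : Type*} [Field K] {W : WeierstrassCurve K} [W.IsElliptic]

open scoped Classical in
variable (W) in
/-- The translations, as a group of automorphisms of the function field. -/
noncomputable def translationHom : Multiplicative (Pts W) →* semiGroup W where
  toFun P := semiAut 1 P.toAdd
  map_one' := semiAut_one
  map_mul' P Q := by rw [semiAut_mul, ptsAct_one, one_mul, toAdd_mul]

open scoped Classical in
lemma semiAut_one_zpow (P : Pts W) (i : ℤ) : semiAut 1 P ^ i = semiAut 1 (i • P) :=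
  (map_zpow (translationHom W) (Multiplicative.ofAdd P) i).symm

open scoped Classical in
lemma semiAut_one_mul (P Q : Pts W) : semiAut 1 P * semiAut 1 Q = semiAut 1 (P + Q) :=
  (map_mul (translationHom W) (Multiplicative.ofAdd P) (Multiplicative.ofAdd Q)).symm

lemma semiAut_one_eq_one_iff {P : Pts W} : semiAut 1 P = 1 ↔ P = 0 := by
  refine ⟨fun h => placeAt_injective ?_, ?_⟩
  · rw [← semiAut_smul_placeAt_zero 1 P, h, one_smul]
  · rintro rfl
    exact semiAut_one

variable {n : ℕ}

lemma exists_pow_eq_units [NeZero (n : K)] (c : (SeparableClosure K)ˣ) : ∃ d, d ^ n = c := by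
  have := neZero_nat K n
  have : NeZero (n : SeparableClosure K) := by
    refine ⟨fun h => NeZero.ne (n : K) ?_⟩
    apply (algebraMap K (SeparableClosure K)).injective
    simpa using h
  obtain ⟨d, hd⟩ := IsSepClosed.exists_pow_nat_eq (c : SeparableClosure K) n
  refine ⟨Units.mk0 d ?_, Units.ext hd⟩
  rintro rfl
  rw [zero_pow (NeZero.ne n)] at hd
  exact c.ne_zero hd.symm

/-- An `n`-torsion point lifts to an element of order dividing `n` of the theta group. -/
lemma exists_mem_thetaGroup_pow_eq_one [NeZero (n : K)] (P : nTorsion W n) :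
    ∃ u ∈ thetaGroup W n, u.right = semiAut 1 (P : Pts W) ∧ u ^ n = 1 ∧
      ∃ r : CoordRing W, (u.left : FunField W) = algebraMap _ _ r := by
  classical
  obtain ⟨u, hu, hP, r, hr⟩ := exists_mem_thetaGroup P
  have hright : (u ^ n).right = (1 : SemiOp W).right := by
    have h0 : n • (P : Pts W) = 0 := P.2
    rw [SemidirectProduct.one_right, ← SemidirectProduct.rightHom_eq_right, map_pow,
      SemidirectProduct.rightHom_eq_right, hP, ← zpow_natCast, semiAut_one_zpow,
      semiAut_one_eq_one_iff, natCast_zsmul]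
    convert h0
  -- The power uⁿ lies over nP = 0, so it is a constant, which is absorbed by an n-th root.
  obtain ⟨c, hc⟩ := exists_eq_constOp_mul (pow_mem hu n) (one_mem _) hright
  obtain ⟨d, hd⟩ := exists_pow_eq_units (n := n) c⁻¹
  refine ⟨constOp W d * u, mul_mem (constOp_mem_thetaGroup n d) hu, ?_, ?_,
    algebraMap (SeparableClosure K) _ d * r, ?_⟩
  · rw [SemidirectProduct.mul_right, constOp_right, one_mul, hP]
  · rw [(constOp_commute hP d).mul_pow, hc, ← map_pow, hd, map_inv, mul_one, inv_mul_cancel]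
  · rw [semiOp_mul_left, constOp_left, constOp_right, hr, map_mul,
      ← IsScalarTower.algebraMap_apply (SeparableClosure K)]
    rfl

/-- The commutator pairing of the theta group. -/
lemma exists_commutator {u v : SemiOp W} (hu : u ∈ thetaGroup W n) (hv : v ∈ thetaGroup W n)
    {P Q : Pts W} (hP : u.right = semiAut 1 P) (hQ : v.right = semiAut 1 Q) :
    ∃ w, u * v = constOp W w * (v * u) := by
  classical
  refine exists_eq_constOp_mul (mul_mem hu hv) (mul_mem hv hu) ?_
  rw [SemidirectProduct.mul_right, SemidirectProduct.mul_right, hP, hQ, semiAut_one_mul,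
    semiAut_one_mul, add_comm]

/-- The commutator does not depend on the lifts. -/
lemma commutator_congr {u v u' v' : SemiOp W} {P Q : Pts W} (hP : u.right = semiAut 1 P)
    (hQ : v.right = semiAut 1 Q) {c d w : (SeparableClosure K)ˣ} (hu : u' = constOp W c * u)
    (hv : v' = constOp W d * v) (h : u * v = constOp W w * (v * u)) :
    u' * v' = constOp W w * (v' * u') := by
  have h1 : Commute (constOp W c) v := constOp_commute hQ c
  have h2 : Commute (constOp W d) u := constOp_commute hP d
  have h3 : Commute (constOp W c) (constOp W d) := (Commute.all c d).map _
  have h4 : Commute (constOp W c * constOp W d) (constOp W w) :=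
    ((Commute.all c w).map _).mul_left ((Commute.all d w).map _)
  calc u' * v' = constOp W c * (u * constOp W d) * v := by rw [hu, hv]; simp only [mul_assoc]
    _ = (constOp W c * constOp W d) * (u * v) := by rw [← h2.eq]; simp only [mul_assoc]
    _ = constOp W w * ((constOp W c * constOp W d) * (v * u)) := by
      rw [h, ← mul_assoc, h4.eq, mul_assoc]
    _ = constOp W w * (v' * u') := by
      rw [h3.eq, hu, hv, mul_assoc (constOp W d) v, ← mul_assoc v, ← h1.eq]
      simp only [mul_assoc]

/-- The Galois group acts on lifts of fixed points by constants. -/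
lemma exists_galOp_mul {u : SemiOp W} (hu : u ∈ thetaGroup W n) {P : Pts W}
    (hP : u.right = semiAut 1 P) {σ : GalK K} (hσ : ptsAct W σ P = P) :
    ∃ c, galOp W σ * u = constOp W c * (u * galOp W σ) := by
  classical
  refine exists_eq_constOp_mul (mul_mem (galOp_mem_thetaGroup n σ) hu)
    (mul_mem hu (galOp_mem_thetaGroup n σ)) ?_
  rw [SemidirectProduct.mul_right, SemidirectProduct.mul_right, galOp_right, hP, semiAut_mul,
    semiAut_mul, hσ, map_zero, add_zero, zero_add, one_mul, mul_one]

/-- Conjugation by s_σ changes lifts of fixed points only by constants and so preserves their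
commutator, yet it carries the constant w to σ(w). -/
lemma commutator_fixed {u v : SemiOp W} (hu : u ∈ thetaGroup W n) (hv : v ∈ thetaGroup W n)
    {P Q : Pts W} (hP : u.right = semiAut 1 P) (hQ : v.right = semiAut 1 Q) {σ : GalK K}
    (hσP : ptsAct W σ P = P) (hσQ : ptsAct W σ Q = Q) {w : (SeparableClosure K)ˣ}
    (h : u * v = constOp W w * (v * u)) : unitsAct K σ w = w := by
  obtain ⟨c, hc⟩ := exists_galOp_mul hu hP hσP
  obtain ⟨d, hd⟩ := exists_galOp_mul hv hQ hσQ
  set s := galOp W σ with hs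
  have h1 := commutator_congr hP hQ (u' := s * u * s⁻¹) (v' := s * v * s⁻¹) (c := c) (d := d)
    (by rw [hc]; group) (by rw [hd]; group) h
  have h2 : s * constOp W w = constOp W (unitsAct K σ w) * s :=
    mul_constOp_of_right (galOp_right σ) w
  have h3 : s * u * s⁻¹ * (s * v * s⁻¹) =
      constOp W (unitsAct K σ w) * (s * v * s⁻¹ * (s * u * s⁻¹)) := by
    calc s * u * s⁻¹ * (s * v * s⁻¹) = s * (u * v) * s⁻¹ := by group
      _ = s * constOp W w * (v * u) * s⁻¹ := by rw [h]; group
      _ = _ := by rw [h2]; group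
  exact constOp_injective (mul_right_cancel (h3.symm.trans h1))

/-- The commutator pairing is nondegenerate. -/
lemma orderOf_commutator [NeZero (n : K)] {u v : SemiOp W} (hu : u ∈ thetaGroup W n)
    (hv : v ∈ thetaGroup W n) {P Q : nTorsion W n} (hP : u.right = semiAut 1 (P : Pts W))
    (hQ : v.right = semiAut 1 (Q : Pts W)) (hun : u ^ n = 1) (hvn : v ^ n = 1)
    (hPQ : ∀ i j : ℤ, i • P + j • Q = 0 → (n : ℤ) ∣ i ∧ (n : ℤ) ∣ j) {w : (SeparableClosure K)ˣ}
    (h : u * v = constOp W w * (v * u)) : orderOf w = n := by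
  classical
  have := neZero_nat K n
  have hcomm := pow_mul_pow_of_commutator h (constOp_commute hP w) (constOp_commute hQ w)
  have hw : w ^ n = 1 := by
    have h1 := hcomm n 1
    rw [hun, one_mul, mul_one, mul_one, ← map_pow] at h1
    apply constOp_injective
    rw [map_one]
    exact mul_right_cancel ((one_mul _).trans h1) |>.symm
  have hdn : orderOf w ∣ n := orderOf_dvd_of_pow_eq_one hw
  set d := orderOf w with hd
  have hcd : Commute u (v ^ d) := by
    have h1 := hcomm 1 d
    rwa [pow_one, one_mul, ← map_pow, hd, pow_orderOf_eq_one, map_one, one_mul] at h1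
  have hright : ∀ i j : ℤ, (u ^ i * v ^ j).right =
      semiAut 1 ((i • P + j • Q : nTorsion W n) : Pts W) := by
    intro i j
    rw [← SemidirectProduct.rightHom_eq_right, map_mul, map_zpow, map_zpow,
      SemidirectProduct.rightHom_eq_right, hP, hQ, semiAut_one_zpow, semiAut_one_zpow,
      semiAut_one_mul]
    congr 1
  have hone : ∀ i j : ℤ, u ^ i * v ^ j = 1 → (n : ℤ) ∣ i ∧ (n : ℤ) ∣ j := by
    intro i j hij
    apply hPQ
    have h1 := hright i j
    rw [hij, SemidirectProduct.one_right] at h1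
    exact Subtype.ext (semiAut_one_eq_one_iff.mp h1.symm)
  have hou : orderOf u = n := by
    refine Nat.dvd_antisymm (orderOf_dvd_of_pow_eq_one hun) ?_
    have := (hone (orderOf u) 0 (by rw [zpow_natCast, pow_orderOf_eq_one, zpow_zero, one_mul])).1
    exact_mod_cast this
  have hvd : IsOfFinOrder (v ^ d) := (isOfFinOrder_iff_pow_eq_one.mpr ⟨n, NeZero.pos n, hvn⟩).pow
  have hu' : IsOfFinOrder u := isOfFinOrder_iff_pow_eq_one.mpr ⟨n, NeZero.pos n, hun⟩
  have hfu : Finite (Subgroup.zpowers u) := hu'.finite_zpowers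
  have hfv : Finite (Subgroup.zpowers (v ^ d)) := hvd.finite_zpowers
  -- Since u and v^d commute, their product group lifts a group of translations, to which
  -- `card_dvd_of_lift` applies.
  let T : Subgroup.zpowers u × Subgroup.zpowers (v ^ d) →* SemiOp W :=
    MonoidHom.noncommCoprod (Subgroup.zpowers u).subtype (Subgroup.zpowers (v ^ d)).subtype (by
      rintro ⟨_, i, rfl⟩ ⟨_, j, rfl⟩
      exact hcd.zpow_zpow i j)
  have hcard : Nat.card (Subgroup.zpowers u × Subgroup.zpowers (v ^ d)) ∣ n := by
    refine card_dvd_of_lift T ?_ ?_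
    · rintro ⟨⟨_, i, rfl⟩, ⟨_, j, rfl⟩⟩
      exact mul_mem (zpow_mem hu i) (zpow_mem (pow_mem hv d) j)
    · rintro ⟨⟨_, i, rfl⟩, ⟨_, j, rfl⟩⟩
      have hT : T (⟨u ^ i, i, rfl⟩, ⟨(v ^ d) ^ j, j, rfl⟩) = u ^ i * v ^ ((d : ℤ) * j) := by
        rw [zpow_mul, zpow_natCast]
        rfl
      refine ⟨_, (congrArg _ hT).trans (hright i (d * j)), fun h0 => ?_⟩
      obtain ⟨hi, hj⟩ := hPQ _ _ (Subtype.ext h0)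
      have h1 : u ^ i = 1 := by
        obtain ⟨k, rfl⟩ := hi
        rw [zpow_mul, zpow_natCast, hun, one_zpow]
      have h2 : (v ^ d) ^ j = 1 := by
        obtain ⟨k, hk⟩ := hj
        rw [← zpow_natCast v, ← zpow_mul, hk, zpow_mul, zpow_natCast, hvn, one_zpow]
      exact Prod.ext (Subtype.ext h1) (Subtype.ext h2)
  rw [Nat.card_prod, Nat.card_zpowers, Nat.card_zpowers, hou] at hcard
  -- Now n times the order of v^d divides n, so v^d = 1. Then dQ = 0, and independence of P and Q
  -- gives that n divides d.
  have hle : orderOf (v ^ d) = 1 :=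
    Nat.dvd_one.mp (Nat.dvd_of_mul_dvd_mul_left (NeZero.pos n) (by rwa [mul_one]))
  rw [orderOf_eq_one_iff] at hle
  refine Nat.dvd_antisymm hdn ?_
  have := (hone 0 d (by rw [zpow_natCast, hle, zpow_zero, mul_one])).2
  exact_mod_cast this

end WeilPairing

/-! ### The Weil pairing as a commutator, and the Kummer characters of the lifts -/

section WeilPairingIff

variable {K : Type*} [Field K] {W : WeierstrassCurve K} [W.IsElliptic] {n : ℕ}

lemma IsTranslation.restrictScalars_eq {P : Pts W}
    {τ : FunField W ≃ₐ[SeparableClosure K] FunField W} (h : IsTranslation W P τ) (f : FunField W) :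
    τ f = (semiAut 1 P : semiGroup W).1 f :=
  AlgEquiv.congr_fun (eq_semiAut (σ := 1) (P := P) (g := τ.restrictScalars K)
    ⟨fun a => τ.commutes a, h⟩) f

lemma exists_isTranslation (P : Pts W) :
    ∃ τ : FunField W ≃ₐ[SeparableClosure K] FunField W, IsTranslation W P τ :=
  ⟨AlgEquiv.ofRingEquiv (f := ((semiAut 1 P : semiGroup W) :
    FunField W ≃ₐ[K] FunField W).toRingEquiv) (fun a => semiAut_algebraMap 1 P a),
    (isSemi_semiAut 1 P).2⟩

/-- The Weil pairing is the commutator pairing of the theta group. -/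
lemma isWeilPairing_iff {u v : SemiOp W} (hu : u ∈ thetaGroup W n) (hv : v ∈ thetaGroup W n)
    {P Q : nTorsion W n} (hP : u.right = semiAut 1 (P : Pts W))
    (hQ : v.right = semiAut 1 (Q : Pts W)) {w : (SeparableClosure K)ˣ}
    (h : u * v = constOp W w * (v * u)) (w' : SeparableClosure K) :
    IsWeilPairing W n P Q w' ↔ w' = w := by
  have hleft : ∀ {u v : SemiOp W}, u * v = constOp W w * (v * u) →
      (u.left : FunField W) * u.right.1 (v.left : FunField W) =
      algebraMap _ _ (w : SeparableClosure K) * (v.left * v.right.1 (u.left : FunField W)) :=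
    fun h => congrArg (fun x : SemiOp W => (x.left : FunField W)) h
  constructor
  · rintro ⟨A, B, O, s, t, f, g, hA, hB, hO, hs, ht, hf, hg, e⟩
    rw [isPlaceOf_iff] at hA hB hO
    change O = placeAt W 0 at hO
    subst hA hB hO
    have hf0 : f ≠ 0 := (hf (placeAt W 0)).ne_zero
    have hg0 : g ≠ 0 := (hg (placeAt W 0)).ne_zero
    let u' : SemiOp W := ⟨Units.mk0 f hf0, semiAut 1 (P : Pts W)⟩
    let v' : SemiOp W := ⟨Units.mk0 g hg0, semiAut 1 (Q : Pts W)⟩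
    have hu' : u' ∈ thetaGroup W n := by
      rw [mem_thetaGroup_iff, semiAut_smul_placeAt_zero]
      exact hf
    have hv' : v' ∈ thetaGroup W n := by
      rw [mem_thetaGroup_iff, semiAut_smul_placeAt_zero]
      exact hg
    obtain ⟨c, hc⟩ := exists_eq_constOp_mul hu' hu hP.symm
    obtain ⟨d, hd⟩ := exists_eq_constOp_mul hv' hv hQ.symm
    have h1 := hleft (commutator_congr hP hQ hc hd h)
    change f * (semiAut 1 (P : Pts W) : semiGroup W).1 g =
      _ * (g * (semiAut 1 (Q : Pts W) : semiGroup W).1 f) at h1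
    rw [← hs.restrictScalars_eq, ← ht.restrictScalars_eq, e] at h1
    have h2 : g * t f ≠ 0 := mul_ne_zero hg0 (by simpa using hf0)
    exact (algebraMap (SeparableClosure K) (FunField W)).injective (mul_right_cancel₀ h2 h1)
  · rintro rfl
    obtain ⟨s, hs⟩ := exists_isTranslation (P : Pts W)
    obtain ⟨t, ht⟩ := exists_isTranslation (Q : Pts W)
    refine ⟨placeAt W P, placeAt W Q, placeAt W 0, s, t, u.left, v.left, isPlaceOf_placeAt W _,
      isPlaceOf_placeAt W _, isPlaceOf_placeAt W _, hs, ht, ?_, ?_, ?_⟩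
    · rw [← semiAut_smul_placeAt_zero 1 (P : Pts W), ← hP]
      exact hu
    · rw [← semiAut_smul_placeAt_zero 1 (Q : Pts W), ← hQ]
      exact hv
    · rw [hs.restrictScalars_eq, ht.restrictScalars_eq, ← hP, ← hQ]
      exact hleft h

lemma exists_algebraMap_eq {c : SeparableClosure K} (hc : ∀ σ : GalK K, σ c = c) :
    ∃ a : K, algebraMap K _ a = c :=
  (InfiniteGalois.mem_range_algebraMap_iff_fixed c).mpr hc

/-- A regular function that the Galois group multiplies by constants has a nonzero coefficient. -/
lemma exists_coefficient {r : CoordRing W} (hr : r ≠ 0) :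
    ∃ α : SeparableClosure K, α ≠ 0 ∧ ∀ (σ : GalK K) (ε : SeparableClosure K),
      (semiAut σ (0 : Pts W) : semiGroup W).1 (algebraMap _ _ r) =
        algebraMap _ _ ε * algebraMap _ _ r →
      σ α = ε * α := by
  obtain ⟨p, q, rfl⟩ := Affine.CoordinateRing.exists_smul_basis_eq r
  -- The untwisted action fixes x and y, so it acts on the coefficients with respect to the basis 1,
  -- y. The leading coefficient of p, or of q if p = 0, will serve as α.
  have key : ∀ (σ : GalK K) (ε : SeparableClosure K),
      (semiAut σ (0 : Pts W) : semiGroup W).1 (algebraMap (CoordRing W) _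
        (p • (1 : CoordRing W) + q • Affine.CoordinateRing.mk _ X)) =
        algebraMap _ _ ε * algebraMap (CoordRing W) _
          (p • (1 : CoordRing W) + q • Affine.CoordinateRing.mk _ X) →
      p.map (σ : SeparableClosure K →+* SeparableClosure K) = C ε * p ∧
      q.map (σ : SeparableClosure K →+* SeparableClosure K) = C ε * q := by
    intro σ ε h
    have hb : ∀ p q : (SeparableClosure K)[X], algebraMap (CoordRing W) (FunField W)
        (p • (1 : CoordRing W) + q • Affine.CoordinateRing.mk _ X) =
          aeval (xFun W) p + aeval (xFun W) q * yFun W :=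
      algebraMap_smul_basis (V := Affine.baseChange W (SeparableClosure K))
    obtain ⟨hx, hy⟩ := semiAut_zero_xFun (W := W) σ
    have hsl : ∀ p : (SeparableClosure K)[X],
        (semiAut σ (0 : Pts W) : semiGroup W).1 (aeval (xFun W) p) =
        aeval (xFun W) (p.map (σ : SeparableClosure K →+* SeparableClosure K)) := by
      intro p
      have := semilinear_aeval (φ := (((semiAut σ (0 : Pts W) : semiGroup W).1 :
        FunField W ≃ₐ[K] FunField W) : FunField W →+* FunField W))
        (semiAut_algebraMap σ 0) p (xFun W)
      refine this.trans ?_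
      congr 2
    rw [hb, map_add, map_mul, hsl, hsl, hy, mul_add, ← mul_assoc,
      ← aeval_C (R := SeparableClosure K) (xFun W) ε, ← map_mul, ← map_mul, ← hb, ← hb] at h
    have h1 := IsFractionRing.injective (CoordRing W) (FunField W) h
    rw [← sub_eq_zero, add_sub_add_comm, ← sub_smul, ← sub_smul] at h1
    obtain ⟨h2, h3⟩ := Affine.CoordinateRing.smul_basis_eq_zero h1
    exact ⟨sub_eq_zero.mp h2, sub_eq_zero.mp h3⟩
  have hcoeff : ∀ {p : (SeparableClosure K)[X]} {σ : GalK K} {ε : SeparableClosure K},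
      p.map (σ : SeparableClosure K →+* SeparableClosure K) = C ε * p →
      σ p.leadingCoeff = ε * p.leadingCoeff := by
    intro p σ ε h
    have := congrArg (fun f : (SeparableClosure K)[X] => f.coeff p.natDegree) h
    simp only [coeff_map, coeff_C_mul] at this
    exact this
  by_cases hp : p = 0
  · have hq : q ≠ 0 := by
      rintro rfl
      apply hr
      rw [hp, zero_smul, zero_smul, add_zero]
    exact ⟨q.leadingCoeff, leadingCoeff_ne_zero.mpr hq, fun σ ε h => hcoeff (key σ ε h).2⟩
  · exact ⟨p.leadingCoeff, leadingCoeff_ne_zero.mpr hp, fun σ ε h => hcoeff (key σ ε h).1⟩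

/-- The Galois action on a lift of order `n` of a fixed point is given by a Kummer character. -/
lemma exists_kummerChar [NeZero (n : K)] {ζ : K} (hζ : IsPrimitiveRoot ζ n) {u : SemiOp W}
    (hu : u ∈ thetaGroup W n) {P : Pts W} (hP : u.right = semiAut 1 P) (hun : u ^ n = 1)
    {r : CoordRing W} (hr : (u.left : FunField W) = algebraMap _ _ r)
    (hfix : ∀ σ : GalK K, ptsAct W σ P = P) :
    ∃ A : ModPowers K n, ∀ σ, galOp W σ * u =
      constOp W (zetaUnit hζ) ^ (kummerChar hζ A σ).val * (u * galOp W σ) := by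
  have hr0 : r ≠ 0 := by
    rintro rfl
    rw [map_zero] at hr
    exact u.left.ne_zero hr
  obtain ⟨α, hα, hασ⟩ := exists_coefficient hr0
  -- That ε is an n-th root of unity follows from uⁿ = 1 by conjugation with s_σ.
  have h1 : ∀ σ : GalK K, ∃ ε : (SeparableClosure K)ˣ, ε ^ n = 1 ∧
      galOp W σ * u = constOp W ε * (u * galOp W σ) ∧ σ α = ε * α := by
    intro σ
    obtain ⟨ε, hε⟩ := exists_galOp_mul hu hP (hfix σ)
    refine ⟨ε, ?_, hε, hασ σ ε ?_⟩
    · have h2 : galOp W σ * u * (galOp W σ)⁻¹ = constOp W ε * u := by rw [hε]; group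
      have h3 := congrArg (· ^ n) h2
      simp only [conj_pow, (constOp_commute hP ε).mul_pow, hun, mul_one, mul_inv_cancel] at h3
      apply constOp_injective
      rw [map_pow, map_one, ← h3]
    · have h2 := congrArg (fun x : SemiOp W => (x.left : FunField W)) hε
      simp only [semiOp_mul_left, galOp_left, Units.val_one, map_one, mul_one, one_mul,
        constOp_right, constOp_left, galOp_right, hr] at h2
      exact h2
  -- As σ multiplies α by an n-th root of unity, αⁿ is Galois invariant. Its class is the required
  -- A.
  obtain ⟨a, ha⟩ : ∃ a : K, algebraMap K _ a = α ^ n := by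
    refine exists_algebraMap_eq fun σ => ?_
    obtain ⟨ε, hε, -, h2⟩ := h1 σ
    rw [map_pow, h2, mul_pow, ← Units.val_pow_eq_pow_val, hε, Units.val_one, one_mul]
  have ha0 : a ≠ 0 := by
    rintro rfl
    rw [map_zero] at ha
    exact pow_ne_zero n hα ha.symm
  refine ⟨QuotientGroup.mk (Units.mk0 a ha0), fun σ => ?_⟩
  obtain ⟨ε, -, h2, h3⟩ := h1 σ
  rw [h2]
  congr 1
  rw [← map_pow]
  congr 1
  apply Units.ext
  have h4 := kummerChar₀_spec hζ (Units.mk0 a ha0) σ α ha.symm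
  rw [h3] at h4
  rw [Units.val_pow_eq_pow_val]
  exact mul_right_cancel₀ hα h4

end WeilPairingIff

/-! ### Computation in a Heisenberg group -/

section Cocycles

lemma pow_val_add {G : Type*} [Group G] {n : ℕ} [NeZero n] {x : G} (hx : x ^ n = 1) (i j : ZMod n) :
    x ^ (i + j).val = x ^ i.val * x ^ j.val := by
  rw [ZMod.val_add, ← pow_add, ← pow_eq_pow_mod _ hx]

lemma pow_val_mul {G : Type*} [Group G] {n : ℕ} {x : G} (hx : x ^ n = 1) (i j : ZMod n) :
    x ^ (i * j).val = x ^ (i.val * j.val) := by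
  rw [ZMod.val_mul, ← pow_eq_pow_mod _ hx]

lemma pow_val_sub {G : Type*} [Group G] {n : ℕ} [NeZero n] {x : G} (hx : x ^ n = 1) (i j : ZMod n) :
    x ^ (i - j).val = x ^ i.val * (x ^ j.val)⁻¹ := by
  rw [eq_mul_inv_iff_mul_eq, ← pow_val_add hx, sub_add_cancel]

/-- The multiplication of standard lifts in a Heisenberg group. -/
lemma heisenberg_mul {G : Type*} [Group G] {n : ℕ} [NeZero n] {u v z s : G} (hu : u ^ n = 1)
    (hv : v ^ n = 1) (hz : z ^ n = 1) (huv : u * v = z * (v * u)) (hzu : Commute z u)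
    (hzv : Commute z v) (hzs : Commute z s) {m₁ m₂ : ZMod n} (hsu : s * u = z ^ m₁.val * (u * s))
    (hsv : s * v = z ^ m₂.val * (v * s)) (i j i' j' : ZMod n) (t : G) :
    u ^ i.val * v ^ j.val * s * (u ^ i'.val * v ^ j'.val * t) =
      z ^ (m₁ * i' + m₂ * j' - j * i').val *
        (u ^ (i + i').val * v ^ (j + j').val * (s * t)) := by
  have e1 : s * u ^ i'.val = z ^ (m₁ * i').val * (u ^ i'.val * s) := by
    have := pow_mul_pow_of_commutator hsu (hzs.pow_left _) (hzu.pow_left _) 1 i'.val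
    rwa [pow_one, one_mul, ← pow_mul, ← pow_val_mul hz] at this
  have e2 : s * v ^ j'.val = z ^ (m₂ * j').val * (v ^ j'.val * s) := by
    have := pow_mul_pow_of_commutator hsv (hzs.pow_left _) (hzv.pow_left _) 1 j'.val
    rwa [pow_one, one_mul, ← pow_mul, ← pow_val_mul hz] at this
  -- Moving v past u costs the inverse of z; this is the source of the term -j i' in the exponent.
  have e3 : v ^ j.val * u ^ i'.val = (z ^ (j * i').val)⁻¹ * (u ^ i'.val * v ^ j.val) := by
    rw [eq_inv_mul_iff_mul_eq, mul_comm j, pow_val_mul hz]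
    exact (pow_mul_pow_of_commutator huv hzu hzv i'.val j.val).symm
  rw [pow_val_sub hz, pow_val_add hz, pow_val_add hu, pow_val_add hv]
  have c1 : Commute (z ^ (m₁ * i').val) (u ^ i.val * v ^ j.val) :=
    (hzu.pow_pow _ _).mul_right (hzv.pow_pow _ _)
  have c2 : Commute (z ^ (m₂ * j').val) (u ^ i.val * v ^ j.val * u ^ i'.val) :=
    ((hzu.pow_pow _ _).mul_right (hzv.pow_pow _ _)).mul_right (hzu.pow_pow _ _)
  have c3 : Commute (z ^ (j * i').val)⁻¹ (u ^ i.val) := (hzu.pow_pow _ _).inv_left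
  calc u ^ i.val * v ^ j.val * s * (u ^ i'.val * v ^ j'.val * t)
      = (u ^ i.val * v ^ j.val) * (s * u ^ i'.val) * v ^ j'.val * t := by simp only [mul_assoc]
    _ = (u ^ i.val * v ^ j.val * z ^ (m₁ * i').val) * u ^ i'.val * (s * v ^ j'.val) * t := by
      rw [e1]; simp only [mul_assoc]
    _ = z ^ (m₁ * i').val * (u ^ i.val * v ^ j.val * u ^ i'.val * z ^ (m₂ * j').val) *
        v ^ j'.val * (s * t) := by
      rw [← c1.eq, e2]; simp only [mul_assoc]
    _ = z ^ (m₁ * i').val * z ^ (m₂ * j').val * u ^ i.val * (v ^ j.val * u ^ i'.val) *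
        v ^ j'.val * (s * t) := by
      rw [← c2.eq]; simp only [mul_assoc]
    _ = z ^ (m₁ * i').val * z ^ (m₂ * j').val * (u ^ i.val * (z ^ (j * i').val)⁻¹) *
        u ^ i'.val * v ^ j.val * v ^ j'.val * (s * t) := by
      rw [e3]; simp only [mul_assoc]
    _ = _ := by rw [← c3.eq]; simp only [mul_assoc]

end Cocycles

/-! ### Brauer classes of cocycles with values in roots of unity -/

section RootCocycle

variable {K : Type*} [Field K] {n : ℕ} [NeZero (n : K)] {ζ : K}

lemma zetaUnit_pow (hζ : IsPrimitiveRoot ζ n) : zetaUnit hζ ^ n = 1 := by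
  apply Units.ext
  rw [Units.val_pow_eq_pow_val, Units.val_one]
  change zetaSep ζ ^ n = 1
  rw [← map_pow, hζ.pow_eq_one, map_one]

lemma unitsAct_zetaUnit (hζ : IsPrimitiveRoot ζ n) (σ : GalK K) :
    unitsAct K σ (zetaUnit hζ) = zetaUnit hζ :=
  Units.ext (AlgEquiv.commutes σ ζ)

/-- The image in `Z²(K, 𝔾ₘ)` of a cocycle with values in `ℤ/n ≅ μₙ`. -/
noncomputable def rootCocycle (hζ : IsPrimitiveRoot ζ n) (β : GalK K × GalK K → ZMod n)
    (hβ : IsLocallyConstant β)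
    (hc : ∀ σ τ ρ, β (τ, ρ) + β (σ, τ * ρ) = β (σ * τ, ρ) + β (σ, τ)) : Z2 (unitsAct K) :=
  ⟨fun p => zetaUnit hζ ^ (β p).val, hβ.comp (fun i : ZMod n => zetaUnit hζ ^ i.val), by
    intro σ τ ρ
    have := neZero_nat K n
    rw [map_pow, unitsAct_zetaUnit, ← pow_val_add (zetaUnit_pow hζ), hc,
      pow_val_add (zetaUnit_pow hζ)]⟩

lemma mk_eq_mk_iff {z z' : Z2 (unitsAct K)} : Br.mk K z = Br.mk K z' ↔
    ∃ h : GalK K → (SeparableClosure K)ˣ, IsLocallyConstant h ∧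
      ∀ σ τ, z'.1 (σ, τ) = z.1 (σ, τ) * (h σ * unitsAct K σ (h τ) / h (σ * τ)) := by
  have h1 : Br.mk K z = Br.mk K z' ↔ z⁻¹ * z' ∈ B2 (unitsAct K) := QuotientGroup.eq
  rw [h1]
  refine exists_congr fun h => and_congr_right fun _ => forall_congr' fun σ =>
    forall_congr' fun τ => ?_
  rw [← inv_mul_eq_iff_eq_mul]
  rfl

/-- The Kummer character is multiplicative. -/
lemma kummerChar_mul_left (hζ : IsPrimitiveRoot ζ n) (a b : ModPowers K n) (σ : GalK K) :
    kummerChar hζ (a * b) σ = kummerChar hζ a σ + kummerChar hζ b σ := by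
  obtain ⟨a, rfl⟩ := QuotientGroup.mk_surjective a
  obtain ⟨b, rfl⟩ := QuotientGroup.mk_surjective b
  obtain ⟨α, hα, hα'⟩ := exists_root n a
  obtain ⟨β, hβ, hβ'⟩ := exists_root n b
  have hab : (α * β) ^ n = algebraMap K (SeparableClosure K) (a * b : Kˣ) := by
    rw [mul_pow, hα', hβ', Units.val_mul, map_mul]
  rw [← QuotientGroup.mk_mul, kummerChar_mk, kummerChar_mk, kummerChar_mk]
  apply zeta_pow_inj hζ
  apply mul_right_cancel₀ (mul_ne_zero hα hβ)
  rw [← kummerChar₀_spec hζ (a * b) σ _ hab, map_mul, kummerChar₀_spec hζ a σ α hα',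
    kummerChar₀_spec hζ b σ β hβ', zeta_pow_add hζ]
  ring

lemma kummerChar_inv_left (hζ : IsPrimitiveRoot ζ n) (a : ModPowers K n) (σ : GalK K) :
    kummerChar hζ a⁻¹ σ = -kummerChar hζ a σ := by
  have h1 : kummerChar hζ 1 σ = 0 := by
    have h2 := (congrArg (fun c => kummerChar hζ c σ) (mul_one (1 : ModPowers K n))).symm.trans
      (kummerChar_mul_left hζ 1 1 σ)
    rwa [left_eq_add] at h2
  rw [eq_neg_iff_add_eq_zero, ← kummerChar_mul_left, inv_mul_cancel, h1]

end RootCocycle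

/-! ### The obstruction in terms of lifts to the theta group -/

section Obstruction

/-- For a trivial action all 1-coboundaries vanish, so a class contains a single cocycle. -/
lemma eq_of_mk_eq {K : Type*} [Field K] {W : WeierstrassCurve K} {n : ℕ}
    (htriv : TrivialTorsion W n) {x y : Z1 (nTorsionAct W n)}
    (h : (QuotientAddGroup.mk x : H1Torsion W n) = QuotientAddGroup.mk y) : x = y := by
  obtain ⟨t, ht⟩ := QuotientAddGroup.eq.mp h
  apply Subtype.ext
  funext σ
  have h1 := ht σ
  rw [htriv, sub_self] at h1
  exact neg_add_eq_zero.mp h1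

variable {K : Type*} [Field K] {W : WeierstrassCurve K} [W.IsElliptic] {n : ℕ}

/-- The semilinear action of the Galois group on the function field of a torsor. -/
noncomputable def torsorAction (x : Z1 (nTorsionAct W n)) : SemilinearAction K (FunField W) where
  act := (semiGroup W).subtype.comp
    { toFun := fun σ => semiAut σ (x.1 σ : Pts W)
      map_one' := by
        have h := x.2.2 1 1
        have h0 : x.1 1 = 0 := by
          rw [one_mul, left_eq_add] at h
          rw [← h]
          exact Subtype.ext (ptsAct_one _).symm
        rw [h0]
        exact semiAut_one
      map_mul' := fun σ τ => by
        classical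
        rw [semiAut_mul, x.2.2 σ τ]
        rfl }
  semilinear σ a := semiAut_algebraMap σ _ a

/-- A semilinear automorphism is determined by its action on constants and on the generic point. -/
lemma isTorsorAction_iff (x : Z1 (nTorsionAct W n)) (ρ : SemilinearAction K (FunField W)) :
    IsTorsorAction W x.1 ρ ↔ ∀ σ, ρ.act σ = semiAut σ (x.1 σ : Pts W) :=
  forall_congr' fun σ => ⟨fun h => eq_semiAut ⟨ρ.semilinear σ, h⟩, fun h => by
    rw [h]
    exact (isSemi_semiAut σ _).2⟩

lemma onDivisor_single {x : Z1 (nTorsionAct W n)} {ρ : SemilinearAction K (FunField W)}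
    (h : IsTorsorAction W x.1 ρ) (σ : GalK K) (A : Pl W) (m : ℤ) :
    ρ.onDivisor σ (Finsupp.single A m) =
      Finsupp.single (semiAut σ (x.1 σ : Pts W) • A) m := by
  rw [SemilinearAction.onDivisor, Finsupp.mapDomain_single]
  congr 1
  apply Place.ext'
  change A.ring.comap (ρ.act σ).symm.toRingEquiv.toRingHom = _
  rw [(isTorsorAction_iff x ρ).mp h]
  rfl

/-- The obstruction is computed by lifts to the theta group. -/
lemma isPeriodIndexObstruction_iff_of_lift (htriv : TrivialTorsion W n)
    (x : Z1 (nTorsionAct W n)) (R : GalK K → SemiOp W) (hR : ∀ σ, R σ ∈ thetaGroup W n)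
    (hx : ∀ σ, (R σ).right = semiAut σ (x.1 σ : Pts W))
    (hloc : IsLocallyConstant fun σ => (R σ).left) (z : Z2 (unitsAct K))
    (hz : ∀ σ τ, R σ * R τ = constOp W (z.1 (σ, τ)) * R (σ * τ)) (c : Br K) :
    IsPeriodIndexObstruction W n (QuotientAddGroup.mk x) c ↔ c = Br.mk K z := by
  constructor
  · rintro ⟨x', ρ, A, hx', hρ, hA, f, z', hf, hdiv, hz', rfl⟩
    obtain rfl := eq_of_mk_eq htriv hx'
    obtain rfl : A = placeAt W 0 := isPlaceOf_iff.mp hA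
    have hact := (isTorsorAction_iff x' ρ).mp hρ
    let R' : GalK K → SemiOp W := fun σ => ⟨f σ, semiAut σ (x'.1 σ : Pts W)⟩
    have hR' : ∀ σ, R' σ ∈ thetaGroup W n := fun σ => by
      have := hdiv σ
      rw [onDivisor_single hρ] at this
      exact this
    -- Any admissible functions f give a second family of lifts. It differs from R by constants
    -- d(σ), and the 2-cocycles differ by the coboundary of d.
    have h1 : ∀ σ, ∃ d, R' σ = constOp W d * R σ := fun σ =>
      exists_eq_constOp_mul (hR' σ) (hR σ) (hx σ).symm
    choose d hd using h1
    have hmulR : ∀ σ τ, R' σ * R' τ = constOp W (z'.1 (σ, τ)) * R' (σ * τ) := by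
      intro σ τ
      apply SemidirectProduct.ext
      · apply Units.ext
        rw [semiOp_mul_left, semiOp_mul_left, constOp_left, constOp_right]
        refine (Eq.trans ?_ (hz' σ τ).symm)
        rw [hact]
      · have h2 := congrArg SemidirectProduct.right (hz σ τ)
        rw [SemidirectProduct.mul_right, SemidirectProduct.mul_right, hx, hx, hx,
          constOp_right] at h2
        rw [SemidirectProduct.mul_right, SemidirectProduct.mul_right, constOp_right]
        exact h2
    -- Local constancy of f and of the functions in R passes to d through the embedding of constants
    -- into functions.
    have hdloc : IsLocallyConstant d := by
      have h2 : IsLocallyConstant fun σ => f σ * ((R σ).left)⁻¹ := hf.mul hloc.inv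
      refine IsLocallyConstant.desc d
        (Units.map (algebraMap (SeparableClosure K) (FunField W)).toMonoidHom) ?_
        (Units.map_injective (algebraMap (SeparableClosure K) (FunField W)).injective)
      convert h2 using 1
      funext σ
      rw [eq_mul_inv_iff_mul_eq]
      have := congrArg SemidirectProduct.left (hd σ)
      apply Units.ext
      exact congrArg Units.val this.symm
    refine (mk_eq_mk_iff.mpr ⟨d, hdloc, fun σ τ => ?_⟩).symm
    have h2 := hmulR σ τ
    rw [hd, hd, hd] at h2
    have h3 : constOp W (d σ) * R σ * (constOp W (d τ) * R τ) =
        constOp W (d σ * unitsAct K σ (d τ) * z.1 (σ, τ)) * R (σ * τ) := by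
      calc constOp W (d σ) * R σ * (constOp W (d τ) * R τ)
          = constOp W (d σ) * (R σ * constOp W (d τ)) * R τ := by simp only [mul_assoc]
        _ = constOp W (d σ) * constOp W (unitsAct K σ (d τ)) * (R σ * R τ) := by
          rw [mul_constOp_of_right (hx σ)]; simp only [mul_assoc]
        _ = _ := by rw [hz, map_mul, map_mul]; simp only [mul_assoc]
    rw [h3, ← mul_assoc, ← map_mul] at h2
    have h4 := constOp_injective (mul_right_cancel h2)
    rw [← mul_div_assoc, eq_div_iff_mul_eq', ← h4, mul_comm]
  · rintro rfl
    have hρ : IsTorsorAction W x.1 (torsorAction x) := (isTorsorAction_iff x _).mpr fun _ => rfl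
    refine ⟨x, torsorAction x, placeAt W 0, rfl, hρ, isPlaceOf_placeAt W 0,
      fun σ => (R σ).left, z, hloc, fun σ => ?_, fun σ τ => ?_, rfl⟩
    · rw [onDivisor_single hρ, ← hx]
      exact hR σ
    · have h2 := congrArg (fun u : SemiOp W => (u.left : FunField W)) (hz σ τ)
      simp only [semiOp_mul_left, constOp_left, constOp_right] at h2
      rw [hx] at h2
      exact h2.symm

end Obstruction

/-! ### Comparison with the norm residue symbol -/

section Symbol

variable {K : Type*} [Field K] {n : ℕ} [NeZero (n : K)] {ζ : K}

/-- The cocycle of the Heisenberg group extension of `(ℤ/n)²`, on which the Galois group acts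
through the Kummer characters of `A` and `B`. -/
noncomputable def heisenbergCocycle (hζ : IsPrimitiveRoot ζ n) (A B : ModPowers K n)
    {a b : GalK K → ZMod n} (ha : IsLocallyConstant a) (hb : IsLocallyConstant b)
    (ha' : ∀ σ τ, a (σ * τ) = a σ + a τ) (hb' : ∀ σ τ, b (σ * τ) = b σ + b τ) :
    Z2 (unitsAct K) :=
  rootCocycle hζ (fun p =>
      kummerChar hζ A p.1 * a p.2 + kummerChar hζ B p.1 * b p.2 - b p.1 * a p.2)
    (by
      have hA := kummerChar_isLocallyConstant hζ A
      have hB := kummerChar_isLocallyConstant hζ B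
      have h1 : Continuous (Prod.fst : GalK K × GalK K → GalK K) := continuous_fst
      have h2 : Continuous (Prod.snd : GalK K × GalK K → GalK K) := continuous_snd
      exact (((hA.comp_continuous h1).mul (ha.comp_continuous h2)).add
        ((hB.comp_continuous h1).mul (hb.comp_continuous h2))).sub
        ((hb.comp_continuous h1).mul (ha.comp_continuous h2)))
    (by
      intro σ τ ρ
      simp only [ha', hb', kummerChar_mul]
      ring)

/-- Expanding the right side bilinearly gives ⟨a, b⟩ + ⟨B, b⟩ - ⟨a, A⟩. By antisymmetry up to
coboundaries, ⟨a, b⟩ becomes -⟨b, a⟩ and -⟨a, A⟩ becomes ⟨A, a⟩. -/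
lemma mk_heisenbergCocycle (hζ : IsPrimitiveRoot ζ n) (A B a b : ModPowers K n) :
    Br.mk K (heisenbergCocycle hζ A B (kummerChar_isLocallyConstant hζ a)
      (kummerChar_isLocallyConstant hζ b) (kummerChar_mul hζ a) (kummerChar_mul hζ b)) =
      normResidue hζ (B * a) (A⁻¹ * b) - normResidue hζ B A⁻¹ := by
  have := neZero_nat K n
  have hz := zetaUnit_pow hζ
  have e : normResidue hζ (B * a) (A⁻¹ * b) - normResidue hζ B A⁻¹ =
      Br.mk K (symbolCocycle hζ (B * a) (A⁻¹ * b) * (symbolCocycle hζ B A⁻¹)⁻¹) := rfl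
  have hl := kummerChar_isLocallyConstant hζ
  rw [e]
  -- For characters χ and ψ the coboundary of χψ is -(χ(σ)ψ(τ) + ψ(σ)χ(τ)). The cochain -ba + Aa
  -- therefore supplies both exchanges.
  refine mk_eq_mk_iff.mpr ⟨fun σ => zetaUnit hζ ^
    (kummerChar hζ b σ * kummerChar hζ a σ * (-1) + kummerChar hζ A σ * kummerChar hζ a σ).val,
    ((((hl b).mul (hl a)).mul (.const _)).add ((hl A).mul (hl a))).comp
      (fun i : ZMod n => zetaUnit hζ ^ i.val), fun σ τ => ?_⟩
  change zetaUnit hζ ^ (kummerChar hζ (B * a) σ * kummerChar hζ (A⁻¹ * b) τ).val *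
    (zetaUnit hζ ^ (kummerChar hζ B σ * kummerChar hζ A⁻¹ τ).val)⁻¹ =
    zetaUnit hζ ^ (kummerChar hζ A σ * kummerChar hζ a τ + kummerChar hζ B σ * kummerChar hζ b τ
      - kummerChar hζ b σ * kummerChar hζ a τ).val * _
  rw [map_pow, unitsAct_zetaUnit, ← pow_val_sub hz, ← pow_val_add hz, div_eq_mul_inv,
    ← pow_val_sub hz, ← pow_val_add hz]
  congr 2
  simp only [kummerChar_mul, kummerChar_mul_left, kummerChar_inv_left]
  ring

end Symbol

/-! ### The period-index obstruction as a Heisenberg cocycle -/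

section Main

lemma periodIndexObstruction_spec {K : Type*} [Field K] {W : WeierstrassCurve K}
    [W.IsElliptic] {n : ℕ} {ξ : H1Torsion W n} {c₀ : Br K}
    (h : ∀ c, IsPeriodIndexObstruction W n ξ c ↔ c = c₀) : periodIndexObstruction W n ξ = c₀ := by
  have hex : ∃ c, IsPeriodIndexObstruction W n ξ c := ⟨c₀, (h c₀).mpr rfl⟩
  rw [periodIndexObstruction, dif_pos hex]
  exact (h _).mp hex.choose_spec

variable {K : Type*} [Field K] {W : WeierstrassCurve K} [W.IsElliptic] {n : ℕ} [NeZero (n : K)]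
  {ζ : K}

lemma basis_apply [NeZero n] {M : Type*} [AddCommGroup M] (e : ZMod n × ZMod n ≃+ M)
    (i j : ZMod n) : e (i, j) = (i.val : ℤ) • e (1, 0) + (j.val : ℤ) • e (0, 1) := by
  rw [← map_zsmul, ← map_zsmul, ← map_add]
  congr 1
  simp

/-- The class of the Heisenberg cocycle is the period-index obstruction. -/
lemma isPeriodIndexObstruction_iff (hζ : IsPrimitiveRoot ζ n) (htriv : TrivialTorsion W n)
    (e : ZMod n × ZMod n ≃+ nTorsion W n) {u v : SemiOp W} (hu : u ∈ thetaGroup W n)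
    (hv : v ∈ thetaGroup W n) (hP : u.right = semiAut 1 (e (1, 0) : Pts W))
    (hQ : v.right = semiAut 1 (e (0, 1) : Pts W)) (hun : u ^ n = 1) (hvn : v ^ n = 1)
    (huv : u * v = constOp W (zetaUnit hζ) * (v * u)) {A B : ModPowers K n}
    (hA : ∀ σ, galOp W σ * u =
      constOp W (zetaUnit hζ) ^ (kummerChar hζ A σ).val * (u * galOp W σ))
    (hB : ∀ σ, galOp W σ * v =
      constOp W (zetaUnit hζ) ^ (kummerChar hζ B σ).val * (v * galOp W σ))
    (x : Z1 (nTorsionAct W n)) {a b : GalK K → ZMod n} (ha : IsLocallyConstant a)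
    (hb : IsLocallyConstant b) (ha' : ∀ σ τ, a (σ * τ) = a σ + a τ)
    (hb' : ∀ σ τ, b (σ * τ) = b σ + b τ) (hx : ∀ σ, x.1 σ = e (a σ, b σ)) (c : Br K) :
    IsPeriodIndexObstruction W n (QuotientAddGroup.mk x) c ↔
      c = Br.mk K (heisenbergCocycle hζ A B ha hb ha' hb') := by
  classical
  have := neZero_nat K n
  have hz : constOp W (zetaUnit hζ) ^ n = 1 := by rw [← map_pow, zetaUnit_pow, map_one]
  have hzs : ∀ σ, Commute (constOp W (zetaUnit hζ)) (galOp W σ) := fun σ => by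
    have := mul_constOp_of_right (galOp_right (W := W) σ) (zetaUnit hζ)
    rw [unitsAct_zetaUnit] at this
    exact this.symm
  -- The lift of σ is u^{a(σ)} v^{b(σ)} s_σ. The factor s_σ carries the function 1, so the function
  -- of the lift depends only on a(σ) and b(σ), whence local constancy.
  refine isPeriodIndexObstruction_iff_of_lift htriv x
    (fun σ => u ^ (a σ).val * v ^ (b σ).val * galOp W σ)
    (fun σ => mul_mem (mul_mem (pow_mem hu _) (pow_mem hv _)) (galOp_mem_thetaGroup n σ))
    (fun σ => ?_) ?_ _ (fun σ τ => ?_) c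
  · rw [hx, basis_apply]
    rw [← SemidirectProduct.rightHom_eq_right, map_mul, map_mul, map_pow, map_pow,
      SemidirectProduct.rightHom_eq_right, hP, hQ, galOp_right, ← zpow_natCast, ← zpow_natCast,
      semiAut_one_zpow, semiAut_one_zpow, semiAut_one_mul, semiAut_mul, map_zero, add_zero, one_mul]
    congr 1
  · have h1 : IsLocallyConstant fun σ => (a σ, b σ) := ha.prodMk hb
    convert h1.comp (fun p : ZMod n × ZMod n => (u ^ p.1.val * v ^ p.2.val).left) using 1
    funext σ
    rw [SemidirectProduct.mul_left, galOp_left, map_one, mul_one]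
    rfl
  · rw [heisenberg_mul hun hvn hz huv (constOp_commute hP _) (constOp_commute hQ _) (hzs σ)
      (hA σ) (hB σ), ha', hb', map_mul, ← map_pow]
    rfl

end Main

end PeriodIndex

open PeriodIndex

theorem theorem6 {K : Type*} [Field K] (E : WeierstrassCurve K) [E.IsElliptic]
    (n : ℕ) [NeZero (n : K)] (htriv : PeriodIndex.TrivialTorsion E n)
    (e : ZMod n × ZMod n ≃+ PeriodIndex.nTorsion E n) :
    (∀ (ξ : PeriodIndex.H1Torsion E n) (c : PeriodIndex.Br K),
      PeriodIndex.IsPeriodIndexObstruction E n ξ c ↔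
        PeriodIndex.periodIndexObstruction E n ξ = c) ∧
    ∃ (ζ : K) (hζ : IsPrimitiveRoot ζ n),
      (∀ w : SeparableClosure K, PeriodIndex.IsWeilPairing E n (e (1, 0)) (e (0, 1)) w ↔
        w = algebraMap K (SeparableClosure K) ζ) ∧
      ∃ C₁ C₂ : PeriodIndex.ModPowers K n, ∀ a b : PeriodIndex.ModPowers K n,
        PeriodIndex.periodIndexObstruction E n (PeriodIndex.kummerClass hζ htriv e a b) =
          PeriodIndex.normResidue hζ (C₁ * a) (C₂ * b) - PeriodIndex.normResidue hζ C₁ C₂ := by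
  classical
  have := neZero_nat K n
  obtain ⟨u, hu, hP, hun, r, hr⟩ := exists_mem_thetaGroup_pow_eq_one (e (1, 0))
  obtain ⟨v, hv, hQ, hvn, s, hs⟩ := exists_mem_thetaGroup_pow_eq_one (e (0, 1))
  have hfix : ∀ (P : nTorsion E n) (σ : GalK K), ptsAct E σ (P : Pts E) = P := fun P σ =>
    congrArg Subtype.val (htriv σ P)
  obtain ⟨w, hw⟩ := exists_commutator hu hv hP hQ
  have hword : orderOf w = n := by
    refine orderOf_commutator hu hv hP hQ hun hvn (fun i j hij => ?_) hw
    rw [← map_zsmul, ← map_zsmul, ← map_add, map_eq_zero_iff e e.injective] at hij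
    simpa [Prod.ext_iff, ZMod.intCast_zmod_eq_zero_iff_dvd, ZMod.intCast_zmod_eq_zero_iff_dvd]
      using hij
  obtain ⟨ζ, hζw⟩ := exists_algebraMap_eq (c := (w : SeparableClosure K)) fun σ =>
    congrArg Units.val (commutator_fixed hu hv hP hQ (hfix _ σ) (hfix _ σ) hw)
  have hζ : IsPrimitiveRoot ζ n := by
    have h1 : IsPrimitiveRoot (w : SeparableClosure K) n := by
      rw [IsPrimitiveRoot.coe_units_iff, ← hword]
      exact IsPrimitiveRoot.orderOf w
    rw [← hζw] at h1
    exact h1.of_map_of_injective (algebraMap K (SeparableClosure K)).injective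
  have hwz : w = zetaUnit hζ := Units.ext hζw.symm
  rw [hwz] at hw
  obtain ⟨A, hA⟩ := exists_kummerChar hζ hu hP hun hr (hfix _)
  obtain ⟨B, hB⟩ := exists_kummerChar hζ hv hQ hvn hs (hfix _)
  have key := @isPeriodIndexObstruction_iff K _ E _ n _ ζ hζ htriv e u v hu hv hP hQ
    hun hvn hw A B hA hB
  -- The constants are C₁ = B and C₂ = A⁻¹, with A and B the Kummer classes attached to the lifts of
  -- e(1, 0) and e(0, 1).
  refine ⟨fun ξ c => ?_, ζ, hζ, fun w' => ?_, B, A⁻¹, fun a b => ?_⟩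
  · obtain ⟨x, rfl⟩ := QuotientAddGroup.mk_surjective ξ
    -- With trivial action a cocycle is a homomorphism, so its coordinates under e are characters
    -- and the formula for Heisenberg cocycles covers every class ξ.
    have hadd : ∀ σ τ, e.symm (x.1 (σ * τ)) = e.symm (x.1 σ) + e.symm (x.1 τ) := fun σ τ => by
      rw [x.2.2, htriv, map_add]
    have h := key x (a := fun σ => (e.symm (x.1 σ)).1) (b := fun σ => (e.symm (x.1 σ)).2)
      (x.2.1.comp fun P => (e.symm P).1) (x.2.1.comp fun P => (e.symm P).2)
      (fun σ τ => by rw [hadd]; rfl) (fun σ τ => by rw [hadd]; rfl)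
      (fun σ => (e.apply_symm_apply _).symm)
    rw [h, periodIndexObstruction_spec h, eq_comm]
  · rw [isWeilPairing_iff hu hv hP hQ hw]
    rfl
  · rw [← mk_heisenbergCocycle]
    exact periodIndexObstruction_spec (key _ _ _ _ _ fun _ => rfl)
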